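/- A \emph{polygon} is a closed set $P\subset\mathbb R^2$ which is the region enclosed by a simple closed polygonal line (with the line included). A vertex $v$ of $P$ is \emph{concave} if its interior angle $\sphericalangle(v,P)$ exceeds $\pi$; $\mathcal V_P'$ denotes the set of concave vertices. (At a boundary point that is not a vertex the interior angle is $\pi$.) The intrinsic distance $d_P(p,p')$ is the minimal length of a Lipschitz curve in $P$ from $p$ to $p'$, and $d(P)=\max_{p,p'\in P}d_P(p,p')$. A segment $[p;q]\subset P$ with $p,q\in\partial P$ \emph{induces a partition} $P=Q_1\cup Q_2$ if $Q_1,Q_2$ are polygons with $Q_1\cup Q_2=P$ and $Q_1\cap Q_2=[p;q]$. For $0<\eta<1$ and a segment $[v;w]$ of length $l$, let $\gamma:[0,l]\to[v;w]$ be its arc-length parametrization from $v$ to $w$, let $$\mathrm{cig}([v;w],\eta)=\bigcup_{t\in[0,l]}B\big(\gamma(t),\eta\min\{t,l-t\}\big)$$ with open balls $B$, and let $$\mathrm{cig}_P([v;w],\eta)=\big\{x\in\overline{\mathrm{cig}([v;w],\eta)}:\ \exists\,p\in[v;w]\text{ with }[p;x]\subset P\big\}.$$ A segment $[v;w]$ with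 $v\in\mathcal V_P'$, $w\in\partial P$, which induces a partition $P=Q_1\cup Q_2$, satisfies the \emph{segmentation property} (SP) with parameter $\eta$ if $$\mathcal V_P'\cap \mathrm{cig}_P([v;w],\eta)\subset\{v,w\}$$ and, for $i=1,2$, whenever $Q_i$ is a triangle, $\sphericalangle(v,Q_i)>\tfrac12\arcsin\eta$. For $0<\vartheta<1$, a polygon $P$ is \emph{$\vartheta$-semiconvex} if for each segment $[v;w]$ with $v\in\mathcal V_P'$, $w\in\partial P$, which induces a partition $P=Q_1\cup Q_2$, one has $$|v-w|\ \ge\ \vartheta\min_{k=1,2}d(Q_k),$$ and $P$ is \emph{(SP)-$\vartheta$-semiconvex} (with parameter $\eta$) if this inequality holds for each such segment that also satisfies (SP) with parameter $\eta$. \textbf{Theorem.} There is $\eta_0\in(0,1)$ such that for every $\vartheta\in(0,1)$ there is $\bar\vartheta=\bar\vartheta(\vartheta)\in(0,\vartheta]$ such that for every $\eta\in(0,\eta_0]$ with $\vartheta\le\frac12\eta$, every polygon which is (SP)-$\vartheta$-semiconvex with parameter $\eta$ is $\bar\vartheta$-semiconvex. -/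

import Mathlib

open scoped ENNReal NNReal

/-- The Euclidean plane. -/
abbrev Plane : Type := EuclideanSpace ℝ (Fin 2)

/-! ### Polygons -/

/-- A closed polygonal line with at least three (pairwise distinct) vertices is simple if two
different edges meet at most in common endpoints. -/
def IsSimplePolygonalLine {n : ℕ} (γ : Polygon Plane n) : Prop :=
  3 ≤ n ∧ Function.Injective γ.vertices ∧
    ∀ i j : Fin n, i ≠ j →
      γ.edgeSet ℝ i ∩ γ.edgeSet ℝ j ⊆
        {γ.vertices i, γ.vertices (finRotate n i)} ∩ {γ.vertices j, γ.vertices (finRotate n j)}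

/-- The closed region enclosed by a closed polygonal line: the line itself together with the
bounded connected components of its complement. -/
def enclosedRegion {n : ℕ} (γ : Polygon Plane n) : Set Plane :=
  γ.boundary ℝ ∪
    {x | x ∈ (γ.boundary ℝ)ᶜ ∧ Bornology.IsBounded (connectedComponentIn (γ.boundary ℝ)ᶜ x)}

/-- A polygon is the closed region enclosed by a simple closed polygonal line. -/
def IsPolygon (P : Set Plane) : Prop :=
  ∃ (n : ℕ) (γ : Polygon Plane n), IsSimplePolygonalLine γ ∧ P = enclosedRegion γ

/-- A (nondegenerate, closed) triangle. -/
def IsTriangle (Q : Set Plane) : Prop :=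
  ∃ a b c : Plane, AffineIndependent ℝ ![a, b, c] ∧ Q = convexHull ℝ {a, b, c}

/-- The interior angle of `P` at `v`, in radians: the length of the set of directions in which one
can leave `v` while staying in `P` for a short time. At a vertex of a polygon this is the usual
interior angle, and at every other boundary point it equals `π`. -/
noncomputable def interiorAngle (P : Set Plane) (v : Plane) : ℝ :=
  (MeasureTheory.volume {φ : ℝ | φ ∈ Set.Ioc (-Real.pi) Real.pi ∧
    ∃ ε > 0, ∀ t ∈ Set.Ioo (0 : ℝ) ε, v + t • !₂[Real.cos φ, Real.sin φ] ∈ P}).toReal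

/-- The vertices of a polygon: the boundary points at which the boundary is not straight. -/
def polygonVertices (P : Set Plane) : Set Plane :=
  {v | v ∈ frontier P ∧ interiorAngle P v ≠ Real.pi}

/-- The concave vertices of a polygon: interior angle larger than `π`. -/
def concaveVertices (P : Set Plane) : Set Plane :=
  {v | v ∈ polygonVertices P ∧ Real.pi < interiorAngle P v}

/-! ### Intrinsic metric and intrinsic diameter -/

/-- The intrinsic distance in `P`: the least length `l` of a curve `γ : [0, l] → P`, parametrized by
arc length, from `p` to `q` (`∞` if there is no such curve). -/
noncomputable def intrinsicDist (P : Set Plane) (p q : Plane) : ℝ≥0∞ :=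
  sInf {L : ℝ≥0∞ | ∃ (l : ℝ≥0) (γ : ℝ → Plane), L = l ∧
    HasUnitSpeedOn γ (Set.Icc 0 (l : ℝ)) ∧ Set.MapsTo γ (Set.Icc 0 (l : ℝ)) P ∧
    γ 0 = p ∧ γ l = q}

/-- The intrinsic diameter `d(P)`. -/
noncomputable def intrinsicDiam (P : Set Plane) : ℝ≥0∞ :=
  ⨆ p ∈ P, ⨆ q ∈ P, intrinsicDist P p q

/-! ### Cigars -/

/-- The `η`-cigar of a curve `γ : [0, l] → ℝ²` parametrized by arc length. -/
def cigar (γ : ℝ → Plane) (l η : ℝ) : Set Plane :=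
  ⋃ t ∈ Set.Icc 0 l, Metric.ball (γ t) (η * min t (l - t))

/-- The `η`-cigar of the segment `[p; q]`, parametrized by arc length from `p` to `q`. -/
noncomputable def segmentCigar (p q : Plane) (η : ℝ) : Set Plane :=
  cigar (fun t => AffineMap.lineMap p q (t / dist p q)) (dist p q) η

/-- The visible region of `[v; w]`: the points of the closed cigar that can be joined to a point of
`[v; w]` by a segment in `P`. -/
def visibleCigar (P : Set Plane) (v w : Plane) (η : ℝ) : Set Plane :=
  {x | x ∈ closure (segmentCigar v w η) ∧ ∃ p ∈ segment ℝ v w, segment ℝ p x ⊆ P}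

/-! ### Partitions, the segmentation property, and semiconvexity -/

/-- The segment `[p; q] ⊆ P` with endpoints on the boundary of `P` induces the partition
`P = Q₁ ∪ Q₂` into two polygons with `Q₁ ∩ Q₂ = [p; q]`. -/
def InducesPartition (P : Set Plane) (p q : Plane) (Q₁ Q₂ : Set Plane) : Prop :=
  p ∈ frontier P ∧ q ∈ frontier P ∧ segment ℝ p q ⊆ P ∧
    IsPolygon Q₁ ∧ IsPolygon Q₂ ∧ P = Q₁ ∪ Q₂ ∧ segment ℝ p q = Q₁ ∩ Q₂

/-- The segmentation property (SP), with parameter `η`, of a segment `[v; w]` starting at a concave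
vertex `v` and inducing the partition `P = Q₁ ∪ Q₂`. -/
def SegmentationProperty (η : ℝ) (P : Set Plane) (v w : Plane) (Q₁ Q₂ : Set Plane) : Prop :=
  concaveVertices P ∩ visibleCigar P v w η ⊆ {v, w} ∧
    (IsTriangle Q₁ → 1 / 2 * Real.arcsin η < interiorAngle Q₁ v) ∧
    (IsTriangle Q₂ → 1 / 2 * Real.arcsin η < interiorAngle Q₂ v)

/-- `ϑ`-semiconvexity. -/
def IsSemiconvex (ϑ : ℝ) (P : Set Plane) : Prop :=
  ∀ v ∈ concaveVertices P, ∀ w ∈ frontier P, ∀ Q₁ Q₂ : Set Plane,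
    InducesPartition P v w Q₁ Q₂ →
      ENNReal.ofReal ϑ * min (intrinsicDiam Q₁) (intrinsicDiam Q₂) ≤ ENNReal.ofReal (dist v w)

/-- (SP)-`ϑ`-semiconvexity, where `η` is the parameter of (SP). -/
def IsSPSemiconvex (η ϑ : ℝ) (P : Set Plane) : Prop :=
  ∀ v ∈ concaveVertices P, ∀ w ∈ frontier P, ∀ Q₁ Q₂ : Set Plane,
    InducesPartition P v w Q₁ Q₂ → SegmentationProperty η P v w Q₁ Q₂ →
      ENNReal.ofReal ϑ * min (intrinsicDiam Q₁) (intrinsicDiam Q₂) ≤ ENNReal.ofReal (dist v w)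

/-!
Let the inequality fail badly for a chord of length `l₀`: both parts have intrinsic diameter larger
than `100 l₀ / ϑ`. Then there are points `x`, `y`, one in each part, that are far from the chord in
the intrinsic distance of `P`. It suffices to find a chord from a concave vertex that is not much
longer than `l₀`, still separates `x` from `y` and is still far from both of them, and that has the
segmentation property: both of its parts are then large, which contradicts the inequality that is
assumed for such chords.

Such a chord is found by minimization. Among the admissible chords, that is, those which separate
`x` from `y` and are far from them, one takes a chord `[v; w]` of nearly minimal length, where chords
whose second endpoint is not a concave vertex count `5/4` of their length, and then the shortest one
among those with endpoints in the finite set of concave vertices and `w` (`Extremal`,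
`IsPolygon.exists_extremal`). Suppose that the segmentation property fails for it, for instance
since a concave vertex in the cigar is visible from the chord. Among such vertices one finds one,
say `u`, for which the triangle `v w u` lies in `P` and has chords or boundary segments as its
other sides (`IsPolygon.exists_niceTri`). One of these sides is a chord that separates `x` from `y`
(`IsChord.transition`), and it is shorter than `[v; w]` (`Extremal.not_niceTri`).

The vertex may be visible only from an endpoint of the chord, and the triangle on the chord may then
fail to lie in `P` near this endpoint; or the angle of one part at `v` may be small. In these cases
the boundary leaves `v` or `w` at a small angle with the chord
(`IsPolygon.localCone_or_edgeDir`), and this is impossible (`Extremal.no_edge_right`,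
`Extremal.no_edge_left`): either there is another chord, which is shorter, or a chord cuts off a
part of `P` that lies in a small triangle (`IsPolygon.exists_ear`) and thus contains neither `x`
nor `y`. For a boundary direction at `v` and `w` not a concave vertex, the new chord may be slightly
longer than `[v; w]`, and this is where the weight `5/4` is used.

The topology of polygons needed for this is proved from scratch: the Jordan curve theorem for simple
polygonal lines by means of winding numbers (`IsSimpleChain.jordan`), the local structure
of a polygon at its boundary points (`IsPolygon.localStructure`), and the fact that a chord cuts a
polygon into two polygons (`IsChord.exists_partition`).
-/

/-! ### Planar linear algebra -/

/-- The determinant of two plane vectors. -/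
def det (x y : Plane) : ℝ := x 0 * y 1 - x 1 * y 0

theorem plane_ext {x y : Plane} (h0 : x 0 = y 0) (h1 : x 1 = y 1) : x = y := by
  ext i; fin_cases i <;> assumption

theorem det_self (x : Plane) : det x x = 0 := by unfold det; ring
theorem det_swap (x y : Plane) : det x y = -det y x := by unfold det; ring
theorem det_add_right (x y z : Plane) : det x (y + z) = det x y + det x z := by
  simp [det]; ring
theorem det_add_left (x y z : Plane) : det (x + y) z = det x z + det y z := by
  simp [det]; ring
theorem det_sub_left (x y z : Plane) : det (x - y) z = det x z - det y z := by
  simp [det]; ring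
theorem det_smul_right (c : ℝ) (x y : Plane) : det x (c • y) = c * det x y := by
  simp [det]; ring
theorem det_smul_left (c : ℝ) (x y : Plane) : det (c • x) y = c * det x y := by
  simp [det]; ring
theorem det_neg_right (x y : Plane) : det x (-y) = -det x y := by
  simp [det]; ring
theorem det_neg_left (x y : Plane) : det (-x) y = -det x y := by
  simp [det]; ring
theorem det_zero_right (x : Plane) : det x 0 = 0 := by simp [det]
theorem det_zero_left (x : Plane) : det 0 x = 0 := by simp [det]

@[fun_prop]
theorem continuous_det {α : Type*} [TopologicalSpace α] {f g : α → Plane}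
    (hf : Continuous f) (hg : Continuous g) : Continuous fun a => det (f a) (g a) := by
  unfold det; fun_prop

/-- Cramer's rule in the plane. -/
theorem cramer {a b : Plane} (h : det a b ≠ 0) (x : Plane) :
    x = (det x b / det a b) • a + (det a x / det a b) • b := by
  apply plane_ext <;> simp <;> field_simp <;> simp [det] <;> ring

theorem exists_smul_of_det_eq_zero {a x : Plane} (ha : a ≠ 0) (h : det a x = 0) :
    ∃ c : ℝ, x = c • a := by
  have hs : a 0 ^ 2 + a 1 ^ 2 ≠ 0 := by
    intro h0
    apply ha
    have h1 : a 0 = 0 := by nlinarith [sq_nonneg (a 0), sq_nonneg (a 1)]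
    have h2 : a 1 = 0 := by nlinarith [sq_nonneg (a 0), sq_nonneg (a 1)]
    exact plane_ext (by simpa using h1) (by simpa using h2)
  unfold det at h
  refine ⟨(a 0 * x 0 + a 1 * x 1) / (a 0 ^ 2 + a 1 ^ 2), plane_ext ?_ ?_⟩
  · simp; field_simp; linear_combination (- a 1) * h
  · simp; field_simp; linear_combination (a 0) * h

/-! ### Segments -/

theorem segment_lineMap (a b : Plane) {s t : ℝ} (h : s ≤ t) :
    segment ℝ (AffineMap.lineMap a b s : Plane) (AffineMap.lineMap a b t)
      = (AffineMap.lineMap a b : ℝ → Plane) '' Set.Icc s t := by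
  rw [← segment_eq_Icc h, image_segment]

theorem openSegment_eq_lineMap (a b : Plane) :
    openSegment ℝ a b = (AffineMap.lineMap a b : ℝ → Plane) '' Set.Ioo 0 1 :=
  openSegment_eq_image_lineMap ℝ a b

theorem lineMap_inj {a b : Plane} (h : a ≠ b) {s t : ℝ}
    (hst : (AffineMap.lineMap a b s : Plane) = AffineMap.lineMap a b t) : s = t :=
  AffineMap.lineMap_injective ℝ h hst

theorem isClosed_segment (a b : Plane) : IsClosed (segment ℝ a b) := by
  rw [segment_eq_image_lineMap]
  exact (isCompact_Icc.image (by fun_prop)).isClosed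

theorem isCompact_segment (a b : Plane) : IsCompact (segment ℝ a b) := by
  rw [segment_eq_image_lineMap]
  exact isCompact_Icc.image (by fun_prop)

theorem ne_of_mem_openSegment {a b p : Plane} (h : a ≠ b) (hp : p ∈ openSegment ℝ a b) :
    p ≠ a ∧ p ≠ b := by
  rw [openSegment_eq_lineMap] at hp
  obtain ⟨t, ht, rfl⟩ := hp
  constructor
  · intro he
    have := lineMap_inj h (he.trans (AffineMap.lineMap_apply_zero a b).symm)
    exact ht.1.ne' this
  · intro he
    have := lineMap_inj h (he.trans (AffineMap.lineMap_apply_one a b).symm)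
    exact ht.2.ne this

theorem segment_split {a b p : Plane} (hp : p ∈ segment ℝ a b) :
    segment ℝ a b = segment ℝ a p ∪ segment ℝ p b := by
  rw [segment_eq_image_lineMap] at hp
  obtain ⟨t, ht, rfl⟩ := hp
  have h1 := segment_lineMap a b ht.1
  have h2 := segment_lineMap a b ht.2
  have h3 := segment_lineMap a b (zero_le_one (α := ℝ))
  simp only [AffineMap.lineMap_apply_zero, AffineMap.lineMap_apply_one] at h1 h2 h3
  rw [h1, h2, h3, ← Set.image_union, Set.Icc_union_Icc_eq_Icc ht.1 ht.2]

theorem segment_inter_split {a b p : Plane} (hab : a ≠ b) (hp : p ∈ segment ℝ a b) :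
    segment ℝ a p ∩ segment ℝ p b = {p} := by
  rw [segment_eq_image_lineMap] at hp
  obtain ⟨t, ht, rfl⟩ := hp
  have h1 := segment_lineMap a b ht.1
  have h2 := segment_lineMap a b ht.2
  simp only [AffineMap.lineMap_apply_zero, AffineMap.lineMap_apply_one] at h1 h2
  rw [h1, h2, ← Set.image_inter (AffineMap.lineMap_injective ℝ hab),
    Set.Icc_inter_Icc_eq_singleton ht.1 ht.2, Set.image_singleton]

theorem segment_eq_insert_openSegment (a b : Plane) :
    segment ℝ a b = insert a (insert b (openSegment ℝ a b)) :=
  (insert_endpoints_openSegment ℝ a b).symm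

/-! ### Closed simple chains of segments -/

/-- A closed simple polygonal line as a sequence `f 0, …, f n = f 0` of points; only the values at
indices `≤ n` matter. -/
structure IsSimpleChain (n : ℕ) (f : ℕ → Plane) : Prop where
  three : 3 ≤ n
  closed : f n = f 0
  inj : ∀ i j, i < n → j < n → f i = f j → i = j
  edges : ∀ i j, i < j → j < n → segment ℝ (f i) (f (i + 1)) ∩ segment ℝ (f j) (f (j + 1)) ⊆
    {f i, f (i + 1)} ∩ {f j, f (j + 1)}

/-- The union of the edges of a chain. -/
def chainSet (n : ℕ) (f : ℕ → Plane) : Set Plane :=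
  {x | ∃ i < n, x ∈ segment ℝ (f i) (f (i + 1))}

/-- A set together with the bounded components of its complement. -/
def filled (B : Set Plane) : Set Plane :=
  B ∪ {x | x ∈ Bᶜ ∧ Bornology.IsBounded (connectedComponentIn Bᶜ x)}

theorem chainSet_eq_iUnion (n : ℕ) (f : ℕ → Plane) :
    chainSet n f = ⋃ i ∈ Finset.range n, segment ℝ (f i) (f (i + 1)) := by
  ext x; simp [chainSet]

theorem isCompact_chainSet (n : ℕ) (f : ℕ → Plane) : IsCompact (chainSet n f) := by
  rw [chainSet_eq_iUnion]
  exact (Finset.range n).isCompact_biUnion fun i _ => isCompact_segment _ _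

namespace IsSimpleChain

variable {n : ℕ} {f : ℕ → Plane}

theorem edges' (h : IsSimpleChain n f) {i j : ℕ} (hij : i ≠ j) (hi : i < n) (hj : j < n) :
    segment ℝ (f i) (f (i + 1)) ∩ segment ℝ (f j) (f (j + 1)) ⊆
    {f i, f (i + 1)} ∩ {f j, f (j + 1)} := by
  rcases lt_or_gt_of_ne hij with h1 | h1
  · exact h.edges i j h1 hj
  · rw [Set.inter_comm, Set.inter_comm {f i, _}]
    exact h.edges j i h1 hi

theorem mod_succ (h : IsSimpleChain n f) {k : ℕ} (hk : k < n) : f ((k + 1) % n) = f (k + 1) := by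
  rcases Nat.lt_or_ge (k + 1) n with h1 | h1
  · rw [Nat.mod_eq_of_lt h1]
  · have : k + 1 = n := by omega
    rw [this, Nat.mod_self, h.closed]

theorem succ_ne (h : IsSimpleChain n f) {i : ℕ} (hi : i < n) : f i ≠ f (i + 1) := by
  intro he
  have h3 := h.three
  rw [← h.mod_succ hi] at he
  have := h.inj _ _ hi (Nat.mod_lt _ (by omega)) he
  rcases Nat.lt_or_ge (i + 1) n with h1 | h1
  · rw [Nat.mod_eq_of_lt h1] at this; omega
  · have h2 : i + 1 = n := by omega
    rw [h2, Nat.mod_self] at this; omega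

theorem shift_edge (h : IsSimpleChain n f) (s i : ℕ) :
    f ((i + 1 + s) % n) = f ((i + s) % n + 1) := by
  have h3 := h.three
  rw [← h.mod_succ (Nat.mod_lt _ (by omega)), Nat.mod_add_mod]
  congr 2; omega

/-- Renumbering the vertices cyclically. -/
theorem shift (h : IsSimpleChain n f) (s : ℕ) : IsSimpleChain n fun i => f ((i + s) % n) := by
  have h3 := h.three
  have hinj : ∀ i j, i < n → j < n → (i + s) % n = (j + s) % n → i = j := by
    intro i j hi hj hij
    have : i ≡ j [MOD n] := Nat.ModEq.add_right_cancel' s hij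
    rwa [Nat.ModEq, Nat.mod_eq_of_lt hi, Nat.mod_eq_of_lt hj] at this
  refine ⟨h3, by simp, ?_, ?_⟩
  · intro i j hi hj hij
    exact hinj i j hi hj (h.inj _ _ (Nat.mod_lt _ (by omega)) (Nat.mod_lt _ (by omega)) hij)
  · intro i j hij hj
    simp only [h.shift_edge]
    exact h.edges' (fun he => hij.ne (hinj i j (by omega) hj he))
      (Nat.mod_lt _ (by omega)) (Nat.mod_lt _ (by omega))

theorem shift_chainSet (h : IsSimpleChain n f) (s : ℕ) :
    chainSet n (fun i => f ((i + s) % n)) = chainSet n f := by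
  have h3 := h.three
  ext x
  simp only [chainSet, Set.mem_ofPred_eq, h.shift_edge]
  constructor
  · rintro ⟨i, hi, hx⟩
    exact ⟨_, Nat.mod_lt _ (by omega), hx⟩
  · rintro ⟨k, hk, hx⟩
    refine ⟨(k + (n - s % n)) % n, Nat.mod_lt _ (by omega), ?_⟩
    have hs : s % n < n := Nat.mod_lt _ (by omega)
    have : ((k + (n - s % n)) % n + s) % n = k := by
      rw [Nat.mod_add_mod, ← Nat.add_mod_mod,
        show k + (n - s % n) + s % n = k + n by omega, Nat.add_mod_right, Nat.mod_eq_of_lt hk]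
    rwa [this]

/-- Inserting a point of the last edge as a new vertex. -/
theorem insertLast (h : IsSimpleChain n f) {p : Plane} (hp : p ∈ openSegment ℝ (f (n - 1)) (f 0)) :
    ∃ g : ℕ → Plane, IsSimpleChain (n + 1) g ∧ chainSet (n + 1) g = chainSet n f ∧
      (∀ i < n, g i = f i) ∧ g n = p := by
  have h3 := h.three
  obtain ⟨m, rfl⟩ : ∃ m, n = m + 1 := ⟨n - 1, by omega⟩
  simp only [Nat.add_sub_cancel] at hp
  have hne : f m ≠ f 0 := by
    have := h.succ_ne (i := m) (by omega)
    rwa [h.closed] at this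
  have hps := openSegment_subset_segment ℝ _ _ hp
  have hsplit := segment_split hps
  have hint := segment_inter_split hne hps
  obtain ⟨hpm, hp0⟩ := ne_of_mem_openSegment hne hp
  have hA : segment ℝ (f m) p ⊆ segment ℝ (f m) (f (m + 1)) := by
    rw [h.closed, hsplit]; exact Set.subset_union_left
  have hB : segment ℝ p (f 0) ⊆ segment ℝ (f m) (f (m + 1)) := by
    rw [h.closed, hsplit]; exact Set.subset_union_right
  have h0A : f 0 ∉ segment ℝ (f m) p := fun hh => hp0
    (Set.mem_singleton_iff.1 (hint ▸ ⟨hh, right_mem_segment ℝ _ _⟩ : f 0 ∈ ({p} : Set Plane))).symm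
  have hmB : f m ∉ segment ℝ p (f 0) := fun hh => hpm
    (Set.mem_singleton_iff.1 (hint ▸ ⟨left_mem_segment ℝ _ _, hh⟩ : f m ∈ ({p} : Set Plane))).symm
  let g : ℕ → Plane := fun i => if i < m + 1 then f i else if i = m + 1 then p else f 0
  have g1 : ∀ i < m + 1, g i = f i := fun i hi => if_pos hi
  have g2 : g (m + 1) = p := by simp [g]
  have g3 : g (m + 2) = f 0 := by simp [g]
  have hpv : ∀ i < m + 1, f i ≠ p := by
    intro i hi hip
    rcases Nat.lt_or_ge i m with h1 | h1
    · have := h.edges i m h1 (by omega)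
        ⟨left_mem_segment ℝ _ _, hip ▸ hA (right_mem_segment ℝ _ _)⟩
      rcases this.2 with h2 | h2
      · exact hpm (hip ▸ h2)
      · exact hp0 (hip ▸ (h2.trans h.closed))
    · have : i = m := by omega
      subst this
      exact hpm hip.symm
  refine ⟨g, ⟨by omega, by rw [g3, g1 0 (by omega)], ?_, ?_⟩, ?_, g1, g2⟩
  · intro i j hi hj hij
    rcases Nat.lt_or_ge i (m + 1) with h1 | h1 <;> rcases Nat.lt_or_ge j (m + 1) with h2 | h2
    · rw [g1 i h1, g1 j h2] at hij
      exact h.inj i j h1 h2 hij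
    · obtain rfl : j = m + 1 := by omega
      rw [g1 i h1, g2] at hij
      exact absurd hij (hpv i h1)
    · obtain rfl : i = m + 1 := by omega
      rw [g1 j h2, g2] at hij
      exact absurd hij.symm (hpv j h2)
    · omega
  · intro i j hij hj
    rcases Nat.lt_or_ge j m with h1 | h1
    · rw [g1 i (by omega), g1 (i + 1) (by omega), g1 j (by omega), g1 (j + 1) (by omega)]
      exact h.edges i j hij (by omega)
    · rcases Nat.lt_or_ge j (m + 1) with h2 | h2
      · obtain rfl : j = m := by omega
        rw [g1 i (by omega), g1 (i + 1) (by omega), g1 j (by omega), g2]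
        rintro x ⟨hx1, hx2⟩
        have := h.edges i j hij (by omega) ⟨hx1, hA hx2⟩
        refine ⟨this.1, ?_⟩
        rcases this.2 with h4 | h4
        · exact Or.inl h4
        · exact absurd ((h4.trans h.closed) ▸ hx2) h0A
      · obtain rfl : j = m + 1 := by omega
        rw [g2, g3]
        rcases Nat.lt_or_ge i m with h4 | h4
        · rw [g1 i (by omega), g1 (i + 1) (by omega)]
          rintro x ⟨hx1, hx2⟩
          have := h.edges i m h4 (by omega) ⟨hx1, hB hx2⟩
          refine ⟨this.1, ?_⟩
          rcases this.2 with h5 | h5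
          · exact absurd (h5 ▸ hx2) hmB
          · exact Or.inr (h5.trans h.closed)
        · obtain rfl : i = m := by omega
          rw [g1 i (by omega), g2, hint]
          rintro x rfl
          simp
  · ext x
    constructor
    · rintro ⟨i, hi, hx⟩
      rcases Nat.lt_or_ge i m with h1 | h1
      · rw [g1 i (by omega), g1 (i + 1) (by omega)] at hx
        exact ⟨i, by omega, hx⟩
      · rcases Nat.lt_or_ge i (m + 1) with h2 | h2
        · obtain rfl : i = m := by omega
          rw [g1 i (by omega), g2] at hx
          exact ⟨i, by omega, hA hx⟩
        · obtain rfl : i = m + 1 := by omega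
          rw [g2, g3] at hx
          exact ⟨m, by omega, hB hx⟩
    · rintro ⟨i, hi, hx⟩
      rcases Nat.lt_or_ge i m with h1 | h1
      · exact ⟨i, by omega, by rwa [g1 i (by omega), g1 (i + 1) (by omega)]⟩
      · obtain rfl : i = m := by omega
        rw [h.closed, hsplit] at hx
        rcases hx with hx | hx
        · exact ⟨i, by omega, by rwa [g1 i (by omega), g2]⟩
        · exact ⟨i + 1, by omega, by rwa [g2, g3]⟩

/-- Every point of a simple chain may be taken as its first vertex. -/
theorem exists_start (h : IsSimpleChain n f) {p : Plane} (hp : p ∈ chainSet n f) :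
    ∃ (m : ℕ) (g : ℕ → Plane), IsSimpleChain m g ∧ chainSet m g = chainSet n f ∧ g 0 = p := by
  have h3 := h.three
  obtain ⟨i, hi, hx⟩ := hp
  by_cases hpi : ∃ k < n, f k = p
  · obtain ⟨k, hk, rfl⟩ := hpi
    exact ⟨n, _, h.shift k, h.shift_chainSet k, by simp [Nat.mod_eq_of_lt hk]⟩
  · push Not at hpi
    have hop : p ∈ openSegment ℝ (f i) (f (i + 1)) := by
      refine mem_openSegment_of_ne_left_right (hpi i hi) ?_ hx
      rw [← h.mod_succ hi]
      exact hpi _ (Nat.mod_lt _ (by omega))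
    have h4 := h.shift (i + 1)
    have e1 : (n - 1 + (i + 1)) % n = i := by
      rw [show n - 1 + (i + 1) = i + n by omega, Nat.add_mod_right, Nat.mod_eq_of_lt hi]
    obtain ⟨g, hg, hgs, -, hgn⟩ := h4.insertLast (p := p) (by
      simp only [zero_add]
      rw [e1, h.mod_succ hi]; exact hop)
    exact ⟨n + 1, _, hg.shift n, (hg.shift_chainSet n).trans (hgs.trans (h.shift_chainSet _)),
      by simp [hgn]⟩

end IsSimpleChain

/-! ### Polygons as filled chains -/

theorem boundary_eq_chainSet {n : ℕ} (γ : Polygon Plane n) (f : ℕ → Plane)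
    (hf : ∀ i : Fin n, f i = γ.vertices i ∧ f (i + 1) = γ.vertices (finRotate n i)) :
    γ.boundary ℝ = chainSet n f := by
  ext x
  simp only [Polygon.boundary, Polygon.edgeSet, Set.mem_iUnion, chainSet, Set.mem_ofPred_eq,
    affineSegment_eq_segment]
  constructor
  · rintro ⟨i, hx⟩
    refine ⟨i, i.2, ?_⟩
    rw [(hf i).1, (hf i).2]; exact hx
  · rintro ⟨i, hi, hx⟩
    refine ⟨⟨i, hi⟩, ?_⟩
    have := hf ⟨i, hi⟩
    rw [← this.1, ← this.2]; exact hx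

theorem finRotate_val {n : ℕ} (i : Fin n) : (finRotate n i : ℕ) = (i + 1) % n := by
  obtain ⟨m, rfl⟩ : ∃ m, n = m + 1 := ⟨n - 1, by have := i.2; omega⟩
  rw [finRotate_apply, Fin.val_add]
  simp

theorem isPolygon_iff {P : Set Plane} :
    IsPolygon P ↔ ∃ (n : ℕ) (f : ℕ → Plane), IsSimpleChain n f ∧ P = filled (chainSet n f) := by
  constructor
  · rintro ⟨n, γ, ⟨h3, hinj, hed⟩, rfl⟩
    have hn : 0 < n := by omega
    let f : ℕ → Plane := fun i => γ.vertices ⟨i % n, Nat.mod_lt _ hn⟩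
    have hf : ∀ i : Fin n, f i = γ.vertices i ∧ f (i + 1) = γ.vertices (finRotate n i) := by
      intro i
      constructor
      · simp [f, Nat.mod_eq_of_lt i.2]
      · simp only [f]
        congr 1
        ext
        rw [finRotate_val]
    refine ⟨n, f, ⟨h3, by simp [f], ?_, ?_⟩, ?_⟩
    · intro i j hi hj hij
      have := hinj hij
      simpa [Nat.mod_eq_of_lt hi, Nat.mod_eq_of_lt hj] using this
    · intro i j hij hj
      have h1 := hed ⟨i, by omega⟩ ⟨j, hj⟩ (by simp; omega)
      simp only [Polygon.edgeSet, affineSegment_eq_segment] at h1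
      have hi := hf ⟨i, by omega⟩
      have hj := hf ⟨j, hj⟩
      simp only at hi hj
      rw [← hi.1, ← hi.2, ← hj.1, ← hj.2] at h1
      exact h1
    · unfold enclosedRegion filled
      rw [boundary_eq_chainSet γ f hf]
  · rintro ⟨n, f, h, rfl⟩
    have h3 := h.three
    let γ : Polygon Plane n := ⟨fun i => f i⟩
    have hf : ∀ i : Fin n, f i = γ.vertices i ∧ f (i + 1) = γ.vertices (finRotate n i) := by
      intro i
      refine ⟨rfl, ?_⟩
      show f (i + 1) = f (finRotate n i)
      rw [finRotate_val, h.mod_succ i.2]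
    refine ⟨n, γ, ⟨h3, ?_, ?_⟩, ?_⟩
    · intro i j hij
      exact Fin.ext (h.inj i j i.2 j.2 hij)
    · intro i j hij
      simp only [Polygon.edgeSet, affineSegment_eq_segment, ← (hf i).1, ← (hf i).2, ← (hf j).1,
        ← (hf j).2]
      exact h.edges' (fun he => hij (Fin.ext he)) i.2 j.2
    · unfold enclosedRegion filled
      rw [boundary_eq_chainSet γ f hf]

/-! ### Winding numbers -/

/-- The complex number with the same coordinates. -/
def toC (x : Plane) : ℂ := ⟨x 0, x 1⟩

theorem toC_sub (x y : Plane) : toC (x - y) = toC x - toC y := by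
  apply Complex.ext <;> simp [toC]

theorem toC_add (x y : Plane) : toC (x + y) = toC x + toC y := by
  apply Complex.ext <;> simp [toC]

theorem toC_smul (c : ℝ) (x : Plane) : toC (c • x) = c * toC x := by
  apply Complex.ext <;> simp [toC]

theorem toC_eq_zero {x : Plane} : toC x = 0 ↔ x = 0 := by
  constructor
  · intro h
    exact plane_ext (by simpa [toC] using congrArg Complex.re h)
      (by simpa [toC] using congrArg Complex.im h)
  · rintro rfl
    apply Complex.ext <;> simp [toC]

theorem toC_injective : Function.Injective toC := fun x y h => by
  have : toC (x - y) = 0 := by rw [toC_sub, h, sub_self]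
  exact sub_eq_zero.1 (toC_eq_zero.1 this)

@[fun_prop]
theorem continuous_toC : Continuous toC := by
  have : toC = fun x : Plane => ((x 0 : ℝ) : ℂ) + ((x 1 : ℝ) : ℂ) * Complex.I := by
    ext x; apply Complex.ext <;> simp [toC]
  rw [this]; fun_prop

/-- The oriented angle under which the segment from `a` to `b` is seen from `x`. -/
noncomputable def turn (a b x : Plane) : ℝ := Complex.arg (toC (b - x) / toC (a - x))

/-- `2π` times the winding number of a chain around `x`. -/
noncomputable def wind (n : ℕ) (f : ℕ → Plane) (x : Plane) : ℝ :=
  ∑ i ∈ Finset.range n, turn (f i) (f (i + 1)) x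

/-- A segment is seen under an angle different from `π` from a point off it. Hence `turn` is continuous
there. -/
theorem ratio_mem_slitPlane {a b x : Plane} (hx : x ∉ segment ℝ a b) :
    toC (b - x) / toC (a - x) ∈ Complex.slitPlane := by
  have ha : toC (a - x) ≠ 0 := by
    rw [Ne, toC_eq_zero, sub_eq_zero]
    rintro rfl
    exact hx (left_mem_segment ℝ _ _)
  by_contra h
  rw [Complex.mem_slitPlane_iff] at h
  push Not at h
  set z := toC (b - x) / toC (a - x) with hz
  have hzr : z = ((z.re : ℝ) : ℂ) := by apply Complex.ext <;> simp [h.2]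
  have h1 : toC (b - x) = ((z.re : ℝ) : ℂ) * toC (a - x) := by
    rw [← hzr, hz, div_mul_cancel₀ _ ha]
  rw [← toC_smul] at h1
  have h2 := toC_injective h1
  set c := z.re
  have hc : (0:ℝ) < 1 - c := by linarith [h.1]
  apply hx
  refine ⟨-c / (1 - c), 1 / (1 - c), by apply div_nonneg <;> linarith [h.1], by positivity, by
    field_simp; ring, ?_⟩
  have h3 : b = x + c • (a - x) := by rw [← h2]; abel
  rw [h3]
  apply plane_ext <;> simp <;> field_simp <;> ring

theorem continuousAt_turn {a b x : Plane} (hx : x ∉ segment ℝ a b) :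
    ContinuousAt (turn a b) x := by
  have ha : toC (a - x) ≠ 0 := by
    rw [Ne, toC_eq_zero, sub_eq_zero]
    rintro rfl
    exact hx (left_mem_segment ℝ _ _)
  have h1 : ContinuousAt (fun y => toC (b - y) / toC (a - y)) x :=
    ContinuousAt.div (by fun_prop) (by fun_prop) ha
  exact ContinuousAt.comp (f := fun y => toC (b - y) / toC (a - y))
    (Complex.continuousAt_arg (ratio_mem_slitPlane hx)) h1

theorem turn_symm {a b x : Plane} (hx : x ∉ segment ℝ a b) : turn b a x = -turn a b x := by
  have h := ratio_mem_slitPlane hx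
  unfold turn
  rw [← inv_div, Complex.arg_inv, if_neg (Complex.slitPlane_arg_ne_pi h)]

theorem mem_chainSet_vertex {n : ℕ} {f : ℕ → Plane} (h : IsSimpleChain n f) {i : ℕ} (hi : i ≤ n) :
    f i ∈ chainSet n f := by
  rcases Nat.lt_or_ge i n with h1 | h1
  · exact ⟨i, h1, left_mem_segment ℝ _ _⟩
  · obtain rfl : i = n := by omega
    rw [h.closed]
    exact ⟨0, by have := h.three; omega, left_mem_segment ℝ _ _⟩

theorem continuousOn_wind (n : ℕ) (f : ℕ → Plane) :
    ContinuousOn (wind n f) (chainSet n f)ᶜ := by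
  intro x hx
  apply ContinuousAt.continuousWithinAt
  unfold wind
  apply tendsto_finsetSum
  intro i hi
  exact continuousAt_turn fun hh => hx ⟨i, Finset.mem_range.1 hi, hh⟩

/-- The angles add up to a multiple of `2π` since the quotients telescope. -/
theorem wind_mem {n : ℕ} {f : ℕ → Plane} (h : IsSimpleChain n f) {x : Plane}
    (hx : x ∉ chainSet n f) : ∃ k : ℤ, wind n f x = k * (2 * Real.pi) := by
  have hne : ∀ i ≤ n, toC (f i - x) ≠ 0 := by
    intro i hi he
    rw [toC_eq_zero, sub_eq_zero] at he
    exact hx (he ▸ mem_chainSet_vertex h hi)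
  have key : ((wind n f x : ℝ) : Real.Angle) = 0 := by
    have h1 : ((wind n f x : ℝ) : Real.Angle) = ∑ i ∈ Finset.range n,
        ((Complex.arg (toC (f (i + 1) - x)) : Real.Angle) - (Complex.arg (toC (f i - x)))) := by
      unfold wind
      rw [← Real.Angle.coe_coeHom, map_sum]
      apply Finset.sum_congr rfl
      intro i hi
      rw [Finset.mem_range] at hi
      rw [Real.Angle.coe_coeHom, turn, Complex.arg_div_coe_angle (hne _ (by omega))
        (hne _ (by omega))]
    rw [h1, Finset.sum_range_sub (fun i => (Complex.arg (toC (f i - x)) : Real.Angle)), h.closed,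
      sub_self]
  rw [Real.Angle.coe_eq_zero_iff] at key
  obtain ⟨k, hk⟩ := key
  exact ⟨k, by rw [← hk]; simp⟩

theorem wind_eq_of_preconnected {n : ℕ} {f : ℕ → Plane} (h : IsSimpleChain n f) {S : Set Plane}
    (hS : IsPreconnected S) (hSc : S ⊆ (chainSet n f)ᶜ) {x y : Plane} (hx : x ∈ S) (hy : y ∈ S) :
    wind n f x = wind n f y := by
  have h2 : IsPreconnected (wind n f '' S) :=
    hS.image _ ((continuousOn_wind n f).mono hSc)
  by_contra hne
  wlog hlt : wind n f x < wind n f y generalizing x y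
  · exact this hy hx (Ne.symm hne) (lt_of_le_of_ne (not_lt.1 hlt) (Ne.symm hne))
  obtain ⟨k, hk⟩ := wind_mem h (hSc hx)
  obtain ⟨l, hl⟩ := wind_mem h (hSc hy)
  have hpi := Real.pi_pos
  rw [hk, hl] at hlt
  have hkl : k < l := by
    have := lt_of_mul_lt_mul_right hlt (by positivity)
    exact_mod_cast this
  have hkl' : (k : ℝ) + 1 ≤ l := by exact_mod_cast hkl
  have hmem : (k + 1 / 2 : ℝ) * (2 * Real.pi) ∈ wind n f '' S := by
    apply h2.Icc_subset ⟨x, hx, rfl⟩ ⟨y, hy, rfl⟩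
    rw [hk, hl]
    constructor <;> nlinarith
  obtain ⟨z, hz, hzw⟩ := hmem
  obtain ⟨m, hm⟩ := wind_mem h (hSc hz)
  rw [hm] at hzw
  have h3 := mul_right_cancel₀ (by positivity) hzw
  have h4 : (2 * m : ℝ) = 2 * k + 1 := by linarith
  have h5 : (2 * m : ℤ) = 2 * k + 1 := by exact_mod_cast h4
  omega

open Filter Topology in
/-- Far away, the winding number vanishes. -/
theorem exists_wind_eq_zero {n : ℕ} {f : ℕ → Plane} (h : IsSimpleChain n f) (R : ℝ) :
    ∃ x : Plane, R < ‖x‖ ∧ x ∉ chainSet n f ∧ wind n f x = 0 := by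
  let X : ℝ → Plane := fun t => !₂[t, 0]
  have hX0 : ∀ t, X t 0 = t := fun t => by simp [X]
  have hX1 : ∀ t, X t 1 = 0 := fun t => by simp [X]
  have hnorm : ∀ t, |t| ≤ ‖X t‖ := by
    intro t
    have := PiLp.norm_apply_le (X t) 0
    rwa [hX0, Real.norm_eq_abs] at this
  have hr : ∀ a b : Plane, Tendsto (fun t => toC (b - X t) / toC (a - X t)) atTop (𝓝 1) := by
    intro a b
    have h1 : Tendsto (fun t : ℝ => (1 : ℂ) + toC (b - a) / toC (a - X t)) atTop (𝓝 (1 + 0)) := by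
      apply Tendsto.const_add
      rw [tendsto_zero_iff_norm_tendsto_zero]
      simp only [norm_div]
      apply Tendsto.div_atTop tendsto_const_nhds
      apply tendsto_atTop_mono (f := fun t : ℝ => t - a 0)
      · intro t
        have := Complex.abs_re_le_norm (toC (a - X t))
        simp only [toC, PiLp.sub_apply, hX0] at this ⊢
        refine le_trans ?_ this
        rw [abs_sub_comm]
        exact le_abs_self _
      · exact tendsto_atTop_add_const_right _ _ tendsto_id
    rw [add_zero] at h1
    refine h1.congr' ?_
    filter_upwards [eventually_gt_atTop (a 0)] with t ht
    have hne : toC (a - X t) ≠ 0 := by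
      intro h0
      have := congrArg Complex.re h0
      simp [toC, hX0] at this
      linarith
    field_simp
    rw [← toC_add]
    congr 1; abel
  have hturn : ∀ a b : Plane, Tendsto (fun t => turn a b (X t)) atTop (𝓝 0) := by
    intro a b
    have := (Complex.continuousAt_arg Complex.one_mem_slitPlane).tendsto.comp (hr a b)
    rwa [Complex.arg_one] at this
  have hw : Tendsto (fun t => wind n f (X t)) atTop (𝓝 0) := by
    have : Tendsto (fun t => ∑ i ∈ Finset.range n, turn (f i) (f (i + 1)) (X t)) atTop
        (𝓝 (∑ i ∈ Finset.range n, 0)) := tendsto_finsetSum _ fun i _ => hturn _ _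
    rw [Finset.sum_const_zero] at this
    exact this
  obtain ⟨B, hB⟩ := (isCompact_chainSet n f).isBounded.exists_norm_le
  have hpi := Real.pi_pos
  have hsm : ∀ᶠ t in atTop, |wind n f (X t)| < 1 := by
    have := hw.abs
    rw [abs_zero] at this
    exact this.eventually_lt_const one_pos
  obtain ⟨t, ht1, ht2, ht3⟩ :=
    (hsm.and ((eventually_gt_atTop (max B 0)).and (eventually_gt_atTop R))).exists
  have htn : t ≤ ‖X t‖ := (le_abs_self t).trans (hnorm t)
  have hxc : X t ∉ chainSet n f := by
    intro hh
    have := hB _ hh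
    linarith [le_max_left B 0]
  refine ⟨X t, by linarith, hxc, ?_⟩
  obtain ⟨k, hk⟩ := wind_mem h hxc
  have hk0 : k = 0 := by
    by_contra hne
    have h1 : (1 : ℝ) ≤ |(k : ℝ)| := by exact_mod_cast Int.one_le_abs hne
    rw [hk, abs_mul, abs_of_pos (by positivity : (0:ℝ) < 2 * Real.pi)] at ht1
    nlinarith [Real.pi_gt_three]
  rw [hk, hk0]; simp

/-- The vector rotated by a right angle. -/
noncomputable def rot (d : Plane) : Plane := !₂[-d 1, d 0]

theorem rot_zero (d : Plane) : rot d 0 = -d 1 := by simp [rot]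
theorem rot_one (d : Plane) : rot d 1 = d 0 := by simp [rot]

theorem det_rot_pos {d : Plane} (hd : d ≠ 0) : 0 < det d (rot d) := by
  have : d 0 ≠ 0 ∨ d 1 ≠ 0 := by
    by_contra h
    push Not at h
    exact hd (plane_ext (by simp [h.1]) (by simp [h.2]))
  simp only [det, rot_zero, rot_one]
  rcases this with h | h <;> nlinarith [sq_nonneg (d 0), sq_nonneg (d 1), sq_pos_of_ne_zero h]

theorem det_of_mem_segment {a b x : Plane} (hx : x ∈ segment ℝ a b) : det (b - a) (x - a) = 0 := by
  obtain ⟨s, t, -, -, hst, rfl⟩ := hx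
  obtain rfl : s = 1 - t := by linarith
  simp [det]; ring

open Filter Topology in
/-- The winding number jumps by one when an edge is crossed. -/
theorem wind_jump {n : ℕ} {f : ℕ → Plane} (h : IsSimpleChain n f) {p : Plane}
    (hp : p ∈ openSegment ℝ (f 0) (f 1)) :
    ∃ ν : Plane, ∀ᶠ s in 𝓝[>] (0 : ℝ), p + s • ν ∉ chainSet n f ∧ p - s • ν ∉ chainSet n f ∧
      wind n f (p + s • ν) - wind n f (p - s • ν) = 2 * Real.pi := by
  have h3 := h.three
  have hne : f 0 ≠ f 1 := h.succ_ne (i := 0) (by omega)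
  set d := f 1 - f 0 with hd
  have hd0 : d ≠ 0 := sub_ne_zero.2 hne.symm
  have hdr := det_rot_pos hd0
  obtain ⟨hp0, hp1⟩ := ne_of_mem_openSegment hne hp
  have hps := openSegment_subset_segment ℝ _ _ hp
  have hother : ∀ i, 0 < i → i < n → p ∉ segment ℝ (f i) (f (i + 1)) := by
    intro i hi hin hpi
    have := (h.edges 0 i hi hin ⟨hps, hpi⟩).1
    rcases this with h1 | h1
    · exact hp0 h1
    · exact hp1 h1
  obtain ⟨m, rfl⟩ : ∃ m, n = m + 1 := ⟨n - 1, by omega⟩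
  let rest : Plane → ℝ := fun x => ∑ i ∈ Finset.range m, turn (f (i + 1)) (f (i + 1 + 1)) x
  have hwr : ∀ x, wind (m + 1) f x = rest x + turn (f 0) (f 1) x := by
    intro x; simp only [wind, rest, Finset.sum_range_succ']
  have hrc : ContinuousAt rest p := by
    apply tendsto_finsetSum
    intro i hi
    exact continuousAt_turn (hother _ (by omega) (by have := Finset.mem_range.1 hi; omega))
  have hplus : Tendsto (fun s : ℝ => p + s • rot d) (𝓝[>] 0) (𝓝 p) := by
    have : Tendsto (fun s : ℝ => p + s • rot d) (𝓝 0) (𝓝 (p + (0:ℝ) • rot d)) :=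
      Continuous.tendsto (by fun_prop) 0
    rw [zero_smul, add_zero] at this
    exact this.mono_left nhdsWithin_le_nhds
  have hminus : Tendsto (fun s : ℝ => p - s • rot d) (𝓝[>] 0) (𝓝 p) := by
    have : Tendsto (fun s : ℝ => p - s • rot d) (𝓝 0) (𝓝 (p - (0:ℝ) • rot d)) :=
      Continuous.tendsto (by fun_prop) 0
    rw [zero_smul, sub_zero] at this
    exact this.mono_left nhdsWithin_le_nhds
  have hrd : ∀ᶠ s in 𝓝[>] (0:ℝ), |rest (p + s • rot d) - rest (p - s • rot d)| < 1 := by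
    have h1 := ((hrc.tendsto.comp hplus).sub (hrc.tendsto.comp hminus)).abs
    rw [sub_self, abs_zero] at h1
    exact h1.eventually_lt_const one_pos
  have hoff : ∀ᶠ x in 𝓝 p, ∀ i, 0 < i → i < m + 1 → x ∉ segment ℝ (f i) (f (i + 1)) := by
    have : ∀ᶠ x in 𝓝 p, ∀ i ∈ Finset.Ico 1 (m + 1), x ∉ segment ℝ (f i) (f (i + 1)) := by
      rw [Filter.eventually_all_finset]
      intro i hi
      rw [Finset.mem_Ico] at hi
      exact (isClosed_segment _ _).isOpen_compl.mem_nhds (hother i (by omega) hi.2)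
    filter_upwards [this] with x hx i hi hin
    exact hx i (Finset.mem_Ico.2 ⟨hi, hin⟩)
  rw [openSegment_eq_lineMap] at hp
  obtain ⟨t, ⟨ht0, ht1⟩, rfl⟩ := hp
  set p : Plane := AffineMap.lineMap (f 0) (f 1) t with hpdef
  have hpa : p - f 0 = t • d := by
    rw [hpdef, hd, AffineMap.lineMap_apply]; simp
  have hpb : f 1 - p = (1 - t) • d := by
    have : f 1 - p = d - (p - f 0) := by rw [hd]; abel
    rw [this, hpa]; module
  have hside : ∀ s : ℝ, det d (p + s • rot d - f 0) = s * det d (rot d) := by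
    intro s
    rw [show p + s • rot d - f 0 = t • d + s • rot d by rw [← hpa]; abel, det_add_right,
      det_smul_right, det_smul_right, det_self]
    ring
  have hdC : toC d ≠ 0 := by rwa [Ne, toC_eq_zero]
  have hrotC : toC (rot d) = Complex.I * toC d := by
    apply Complex.ext <;> simp [toC, rot_zero, rot_one]
  have hratio : ∀ s : ℝ, s ≠ 0 → toC (f 1 - (p + s • rot d)) / toC (f 0 - (p + s • rot d)) =
      ⟨-(t * (1 - t) - s ^ 2) / (t ^ 2 + s ^ 2), s / (t ^ 2 + s ^ 2)⟩ := by
    intro s hs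
    have e1 : toC (f 1 - (p + s • rot d)) = ((1 - t : ℝ) - s * Complex.I) * toC d := by
      rw [show f 1 - (p + s • rot d) = (1 - t) • d - s • rot d by rw [← hpb]; abel, toC_sub,
        toC_smul, toC_smul, hrotC]
      ring
    have e2 : toC (f 0 - (p + s • rot d)) = (-(t : ℂ) - s * Complex.I) * toC d := by
      rw [show f 0 - (p + s • rot d) = (-1 : ℝ) • (t • d) - s • rot d by rw [← hpa]; module,
        toC_sub, toC_smul, toC_smul, toC_smul, hrotC]
      push_cast; ring
    rw [e1, e2, mul_div_mul_right _ _ hdC]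
    have hpos : 0 < t ^ 2 + s ^ 2 := by positivity
    have hne : (-(t : ℂ) - s * Complex.I) ≠ 0 := by
      intro h0
      have := congrArg Complex.re h0
      simp at this
      exact ht0.ne' this
    rw [div_eq_iff hne]
    apply Complex.ext
    · simp; field_simp; ring
    · simp; field_simp; ring
  refine ⟨rot d, ?_⟩
  have hsmall : ∀ᶠ s in 𝓝[>] (0:ℝ), s ^ 2 < t * (1 - t) := by
    have : Tendsto (fun s : ℝ => s ^ 2) (𝓝[>] 0) (𝓝 (0 ^ 2)) :=
      (Continuous.tendsto (by fun_prop) 0).mono_left nhdsWithin_le_nhds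
    apply this.eventually_lt_const
    rw [zero_pow two_ne_zero]
    exact mul_pos ht0 (by linarith)
  filter_upwards [hrd, hplus.eventually hoff, hminus.eventually hoff, hsmall,
    self_mem_nhdsWithin] with s h1 h2 h4 h5 h6
  have h6 : 0 < s := h6
  have hpos : 0 < t ^ 2 + s ^ 2 := by positivity
  have c1 : p + s • rot d ∉ chainSet (m + 1) f := by
    rintro ⟨i, hi, hx⟩
    rcases Nat.eq_zero_or_pos i with rfl | hi0
    · have := det_of_mem_segment hx
      rw [zero_add, ← hd, hside] at this
      nlinarith
    · exact h2 i hi0 hi hx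
  have c2 : p - s • rot d ∉ chainSet (m + 1) f := by
    rintro ⟨i, hi, hx⟩
    rcases Nat.eq_zero_or_pos i with rfl | hi0
    · have := det_of_mem_segment hx
      rw [zero_add, ← hd, sub_eq_add_neg p, ← neg_smul, hside] at this
      nlinarith
    · exact h4 i hi0 hi hx
  refine ⟨c1, c2, ?_⟩
  have t1 : Real.pi / 2 < turn (f 0) (f 1) (p + s • rot d) := by
    unfold turn
    rw [hratio s h6.ne']
    by_contra hle
    rw [not_lt, Complex.arg_le_pi_div_two_iff] at hle
    simp only at hle
    rcases hle with h7 | h7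
    · have : -(t * (1 - t) - s ^ 2) / (t ^ 2 + s ^ 2) < 0 := by
        apply div_neg_of_neg_of_pos _ hpos; linarith
      linarith
    · have : 0 < s / (t ^ 2 + s ^ 2) := by positivity
      linarith
  have t2 : turn (f 0) (f 1) (p - s • rot d) < -(Real.pi / 2) := by
    unfold turn
    rw [sub_eq_add_neg p, ← neg_smul, hratio (-s) (by linarith)]
    by_contra hle
    rw [not_lt, Complex.neg_pi_div_two_le_arg_iff] at hle
    simp only at hle
    have : 0 < s / (t ^ 2 + s ^ 2) := by positivity
    rcases hle with h7 | h7
    · have : -(t * (1 - t) - (-s) ^ 2) / (t ^ 2 + (-s) ^ 2) < 0 := by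
        apply div_neg_of_neg_of_pos <;> nlinarith
      linarith
    · rw [neg_sq, neg_div] at h7
      linarith
  have t3 : turn (f 0) (f 1) (p + s • rot d) ≤ Real.pi := Complex.arg_le_pi _
  have t4 : -Real.pi < turn (f 0) (f 1) (p - s • rot d) := Complex.neg_pi_lt_arg _
  obtain ⟨k, hk⟩ := wind_mem h c1
  obtain ⟨l, hl⟩ := wind_mem h c2
  have hdiff : wind (m + 1) f (p + s • rot d) - wind (m + 1) f (p - s • rot d)
      = ((k - l : ℤ) : ℝ) * (2 * Real.pi) := by rw [hk, hl]; push_cast; ring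
  rw [hdiff]
  rw [hwr, hwr] at hdiff
  rw [abs_lt] at h1
  have hpi := Real.pi_gt_three
  have b1 : (0 : ℝ) < ((k - l : ℤ) : ℝ) := by
    by_contra hle
    nlinarith
  have b2 : ((k - l : ℤ) : ℝ) < 2 := by
    by_contra hle
    nlinarith
  have b3 : k - l = 1 := by
    have : (0 : ℤ) < k - l := by exact_mod_cast b1
    have : k - l < (2 : ℤ) := by exact_mod_cast b2
    omega
  rw [b3]; simp

/-! ### The Jordan curve theorem for simple chains -/

/-- The closed cone with apex `e` spanned counterclockwise from `d₁` to `d₂`. -/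
def cone (e d₁ d₂ : Plane) : Set Plane := {x | 0 ≤ det d₁ (x - e) ∧ 0 ≤ det (x - e) d₂}

/-- The open cone with apex `e` spanned counterclockwise from `d₁` to `d₂`. -/
def openCone (e d₁ d₂ : Plane) : Set Plane := {x | 0 < det d₁ (x - e) ∧ 0 < det (x - e) d₂}

/-- The directions `d₁`, `d₂` span a convex cone: either a proper one or a half-plane. -/
def SpanCone (d₁ d₂ : Plane) : Prop :=
  0 < det d₁ d₂ ∨ (d₁ ≠ 0 ∧ ∃ c : ℝ, 0 < c ∧ d₂ = -(c • d₁))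

/-- In the ball of radius `r` around `e`, the set `B` consists of two rays from `e`, which bound the
cone from `d₁` to `d₂`. -/
def LocalRays (B : Set Plane) (e d₁ d₂ : Plane) (r : ℝ) : Prop :=
  0 < r ∧ SpanCone d₁ d₂ ∧
    ∀ x ∈ Metric.ball e r, x ∈ B ↔ x ∈ cone e d₁ d₂ ∧ x ∉ openCone e d₁ d₂

theorem SpanCone.exists_interior {d₁ d₂ : Plane} (h : SpanCone d₁ d₂) :
    ∃ s, 0 < det d₁ s ∧ 0 < det s d₂ := by
  rcases h with h | ⟨h, c, hc, rfl⟩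
  · refine ⟨d₁ + d₂, ?_, ?_⟩
    · rw [det_add_right, det_self]; linarith
    · rw [det_add_left, det_self]; linarith
  · refine ⟨rot d₁, det_rot_pos h, ?_⟩
    rw [det_neg_right, det_smul_right, det_swap]
    have := det_rot_pos h
    nlinarith

theorem convex_cone (e d₁ d₂ : Plane) : Convex ℝ (cone e d₁ d₂) := by
  intro x hx y hy a b ha hb hab
  have : a • x + b • y - e = a • (x - e) + b • (y - e) := by
    obtain rfl : a = 1 - b := by linarith
    module
  constructor
  · rw [this, det_add_right, det_smul_right, det_smul_right]
    have := hx.1; have := hy.1; positivity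
  · rw [this, det_add_left, det_smul_left, det_smul_left]
    have := hx.2; have := hy.2; positivity

theorem convex_pos_det_right (e d : Plane) : Convex ℝ {x | 0 < det d (x - e)} := by
  intro x hx y hy a b ha hb hab
  have : a • x + b • y - e = a • (x - e) + b • (y - e) := by
    obtain rfl : a = 1 - b := by linarith
    module
  have hx : 0 < det d (x - e) := hx
  have hy : 0 < det d (y - e) := hy
  show 0 < det d (a • x + b • y - e)
  rw [this, det_add_right, det_smul_right, det_smul_right]
  rcases ha.eq_or_lt with rfl | ha
  · have : b = 1 := by linarith
    rw [this]; linarith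
  · have := mul_pos ha hx
    have := mul_nonneg hb hy.le
    linarith

theorem convex_openCone (e d₁ d₂ : Plane) : Convex ℝ (openCone e d₁ d₂) := by
  have : openCone e d₁ d₂ = {x | 0 < det d₁ (x - e)} ∩ {x | 0 < det (-d₂) (x - e)} := by
    ext x
    simp only [openCone, Set.mem_ofPred_eq, Set.mem_inter_iff, det_neg_left, det_swap d₂, neg_neg]
  rw [this]
  exact (convex_pos_det_right e d₁).inter (convex_pos_det_right e (-d₂))

/-- The part of a ball outside a closed cone is connected. -/
theorem isPreconnected_ball_diff_cone {e d₁ d₂ : Plane} (h : SpanCone d₁ d₂) {r : ℝ} (hr : 0 < r) :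
    IsPreconnected (Metric.ball e r \ cone e d₁ d₂) := by
  have heq : Metric.ball e r \ cone e d₁ d₂ = (Metric.ball e r ∩ {x | 0 < det (-d₁) (x - e)}) ∪
      (Metric.ball e r ∩ {x | 0 < det d₂ (x - e)}) := by
    ext x
    simp only [cone, Set.mem_sdiff, Set.mem_ofPred_eq, Set.mem_union, Set.mem_inter_iff,
      det_neg_left, not_and_or, not_le, det_swap d₂]
    constructor
    · rintro ⟨h1, h2 | h2⟩
      · exact Or.inl ⟨h1, by linarith⟩
      · exact Or.inr ⟨h1, by linarith⟩
    · rintro (⟨h1, h2⟩ | ⟨h1, h2⟩)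
      · exact ⟨h1, Or.inl (by linarith)⟩
      · exact ⟨h1, Or.inr (by linarith)⟩
  rw [heq]
  obtain ⟨s, hs1, hs2⟩ := h.exists_interior
  have hs0 : 0 < ‖s‖ := by
    rw [norm_pos_iff]; rintro rfl; simp [det_zero_right] at hs1
  set x : Plane := e - (r / (2 * ‖s‖)) • s with hx
  have hc : 0 < r / (2 * ‖s‖) := by positivity
  have hxe : x - e = -((r / (2 * ‖s‖)) • s) := by rw [hx]; abel
  have hxb : x ∈ Metric.ball e r := by
    rw [Metric.mem_ball, dist_eq_norm, hxe, norm_neg, norm_smul, Real.norm_of_nonneg hc.le]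
    field_simp; linarith
  refine IsPreconnected.union x ⟨hxb, ?_⟩ ⟨hxb, ?_⟩
    ((convex_ball e r).inter (convex_pos_det_right e _)).isPreconnected
    ((convex_ball e r).inter (convex_pos_det_right e _)).isPreconnected
  · show 0 < det (-d₁) (x - e)
    rw [hxe, det_neg_left, det_neg_right, det_smul_right, neg_neg]
    positivity
  · show 0 < det d₂ (x - e)
    rw [hxe, det_neg_right, det_smul_right, det_swap]
    nlinarith

open Filter Topology in
theorem tendsto_add_smul_nhds (x s : Plane) :
    Tendsto (fun t : ℝ => x + t • s) (𝓝[>] 0) (𝓝 x) := by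
  have : Tendsto (fun t : ℝ => x + t • s) (𝓝 0) (𝓝 (x + (0:ℝ) • s)) :=
    Continuous.tendsto (by fun_prop) 0
  rw [zero_smul, add_zero] at this
  exact this.mono_left nhdsWithin_le_nhds

open Filter Topology in
/-- Points of two rays are limits of points of the open cone and of points outside the closed
cone. -/
theorem LocalRays.mem_closure {B : Set Plane} {e d₁ d₂ : Plane} {r : ℝ}
    (h : LocalRays B e d₁ d₂ r) {x : Plane} (hx : x ∈ Metric.ball e r) (hxB : x ∈ B) :
    x ∈ closure (Metric.ball e r ∩ openCone e d₁ d₂) ∧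
      x ∈ closure (Metric.ball e r \ cone e d₁ d₂) := by
  obtain ⟨hr, hsc, hB⟩ := h
  obtain ⟨s, hs1, hs2⟩ := hsc.exists_interior
  obtain ⟨⟨h1, h2⟩, h3⟩ := (hB x hx).1 hxB
  have hball : Metric.ball e r ∈ 𝓝 x := Metric.isOpen_ball.mem_nhds hx
  constructor
  · refine mem_closure_of_tendsto (tendsto_add_smul_nhds x s) ?_
    filter_upwards [(tendsto_add_smul_nhds x s).eventually hball, self_mem_nhdsWithin] with t ht1 ht
    have ht : 0 < t := ht
    refine ⟨ht1, ?_, ?_⟩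
    · rw [add_sub_right_comm, det_add_right, det_smul_right]; positivity
    · rw [add_sub_right_comm, det_add_left, det_smul_left]; positivity
  · refine mem_closure_of_tendsto (tendsto_add_smul_nhds x (-s)) ?_
    filter_upwards [(tendsto_add_smul_nhds x (-s)).eventually hball, self_mem_nhdsWithin]
      with t ht1 ht
    have ht : 0 < t := ht
    refine ⟨ht1, fun hc => h3 ?_⟩
    obtain ⟨h4, h5⟩ := hc
    rw [add_sub_right_comm, det_add_right, det_smul_right, det_neg_right] at h4
    rw [add_sub_right_comm, det_add_left, det_smul_left, det_neg_left] at h5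
    have := mul_pos ht hs1
    have := mul_pos ht hs2
    exact ⟨by linarith, by linarith⟩

theorem LocalRays.ball_diff {B : Set Plane} {e d₁ d₂ : Plane} {r : ℝ}
    (h : LocalRays B e d₁ d₂ r) : Metric.ball e r \ B =
      (Metric.ball e r ∩ openCone e d₁ d₂) ∪ (Metric.ball e r \ cone e d₁ d₂) := by
  ext x
  have hoc : x ∈ openCone e d₁ d₂ → x ∈ cone e d₁ d₂ := fun hx => ⟨hx.1.le, hx.2.le⟩
  constructor
  · rintro ⟨h1, h2⟩
    rw [h.2.2 x h1] at h2
    by_cases h3 : x ∈ cone e d₁ d₂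
    · exact Or.inl ⟨h1, by tauto⟩
    · exact Or.inr ⟨h1, h3⟩
  · rintro (⟨h1, h2⟩ | ⟨h1, h2⟩)
    · exact ⟨h1, by rw [h.2.2 x h1]; tauto⟩
    · exact ⟨h1, by rw [h.2.2 x h1]; tauto⟩

theorem mem_segment_add_iff {e d x : Plane} (hx : x ∈ Metric.ball e ‖d‖) :
    x ∈ segment ℝ e (e + d) ↔ ∃ c : ℝ, 0 ≤ c ∧ x = e + c • d := by
  rw [segment_eq_image']
  constructor
  · rintro ⟨t, ht, rfl⟩
    exact ⟨t, ht.1, by simp⟩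
  · rintro ⟨c, hc, rfl⟩
    refine ⟨c, ⟨hc, ?_⟩, by simp⟩
    rw [Metric.mem_ball, dist_eq_norm, add_sub_cancel_left, norm_smul, Real.norm_of_nonneg hc] at hx
    by_contra h1
    nlinarith [norm_nonneg d]

theorem mem_rays_iff {e d₁ d₂ x : Plane} (h : SpanCone d₁ d₂) :
    ((∃ c : ℝ, 0 ≤ c ∧ x = e + c • d₁) ∨ ∃ c : ℝ, 0 ≤ c ∧ x = e + c • d₂) ↔
      x ∈ cone e d₁ d₂ ∧ x ∉ openCone e d₁ d₂ := by
  have hd1 : d₁ ≠ 0 := by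
    rcases h with h | h
    · rintro rfl; simp [det_zero_left] at h
    · exact h.1
  have hd2 : d₂ ≠ 0 := by
    rcases h with h | ⟨h, c, hc, rfl⟩
    · rintro rfl; simp [det_zero_right] at h
    · simpa using ⟨hc.ne', h⟩
  constructor
  · rintro (⟨c, hc, rfl⟩ | ⟨c, hc, rfl⟩)
    · simp only [cone, openCone, Set.mem_ofPred_eq, add_sub_cancel_left, det_smul_right, det_self,
        det_smul_left]
      refine ⟨⟨by simp, ?_⟩, by simp⟩
      rcases h with h | ⟨h, b, hb, rfl⟩
      · positivity
      · simp [det_neg_right, det_smul_right, det_self]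
    · simp only [cone, openCone, Set.mem_ofPred_eq, add_sub_cancel_left, det_smul_right, det_self,
        det_smul_left]
      refine ⟨⟨?_, by simp⟩, by simp⟩
      rcases h with h | ⟨h, b, hb, rfl⟩
      · positivity
      · simp [det_neg_right, det_smul_right, det_self]
  · rintro ⟨⟨h1, h2⟩, h3⟩
    have h3' : det d₁ (x - e) = 0 ∨ det (x - e) d₂ = 0 := by
      by_contra hh
      push Not at hh
      exact h3 ⟨lt_of_le_of_ne h1 hh.1.symm, lt_of_le_of_ne h2 hh.2.symm⟩
    rcases h with h | ⟨h, b, hb, rfl⟩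
    · rcases h3' with h4 | h4
      · obtain ⟨c, hc⟩ := exists_smul_of_det_eq_zero hd1 h4
        left
        refine ⟨c, ?_, by rw [← hc]; abel⟩
        rw [hc, det_smul_left] at h2
        by_contra hneg
        nlinarith
      · rw [det_swap, neg_eq_zero] at h4
        obtain ⟨c, hc⟩ := exists_smul_of_det_eq_zero hd2 h4
        right
        refine ⟨c, ?_, by rw [← hc]; abel⟩
        rw [hc, det_smul_right] at h1
        by_contra hneg
        nlinarith
    · have h4 : det d₁ (x - e) = 0 := by
        rcases h3' with h4 | h4
        · exact h4
        · rw [det_neg_right, det_smul_right, det_swap] at h4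
          have : b * det d₁ (x - e) = 0 := by linarith
          exact (mul_eq_zero.1 this).resolve_left hb.ne'
      obtain ⟨c, hc⟩ := exists_smul_of_det_eq_zero hd1 h4
      rcases le_or_gt 0 c with h5 | h5
      · exact Or.inl ⟨c, h5, by rw [← hc]; abel⟩
      · refine Or.inr ⟨-c / b, by apply div_nonneg <;> linarith, ?_⟩
        rw [smul_neg, smul_smul, div_mul_cancel₀ _ hb.ne', neg_smul, neg_neg, ← hc]
        abel

namespace IsSimpleChain

variable {n : ℕ} {f : ℕ → Plane}

open Filter Topology in
/-- Near each of its points, a simple chain consists of two rays. -/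
theorem exists_localRays (h : IsSimpleChain n f) {e : Plane} (he : e ∈ chainSet n f) :
    ∃ d₁ d₂ r, LocalRays (chainSet n f) e d₁ d₂ r := by
  obtain ⟨m, g, hg, hgs, rfl⟩ := h.exists_start he
  rw [← hgs]
  clear hgs he h
  have h3 := hg.three
  obtain ⟨k, rfl⟩ : ∃ k, m = k + 1 := ⟨m - 1, by omega⟩
  set e := g 0
  set d := g 1 - e with hd
  set d' := g k - e with hd'
  have hed : e + d = g 1 := by rw [hd]; abel
  have hed' : e + d' = g k := by rw [hd']; abel
  have hd0 : d ≠ 0 := sub_ne_zero.2 (hg.succ_ne (i := 0) (by omega)).symm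
  have hd0' : d' ≠ 0 := by
    rw [hd', sub_ne_zero]
    have := hg.succ_ne (i := k) (by omega)
    rwa [hg.closed] at this
  have hother : ∀ i, 0 < i → i < k → e ∉ segment ℝ (g i) (g (i + 1)) := by
    intro i hi hik hmem
    have := hg.edges 0 i hi (by omega) ⟨left_mem_segment ℝ _ _, hmem⟩
    rcases this.2 with h1 | h1
    · exact hi.ne (hg.inj 0 i (by omega) (by omega) h1)
    · exact absurd (hg.inj 0 (i + 1) (by omega) (by omega) h1) (by omega)
  have hoff : ∀ᶠ x in 𝓝 e, ∀ i ∈ Finset.Ico 1 k, x ∉ segment ℝ (g i) (g (i + 1)) := by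
    rw [Filter.eventually_all_finset]
    intro i hi
    rw [Finset.mem_Ico] at hi
    exact (isClosed_segment _ _).isOpen_compl.mem_nhds (hother i (by omega) hi.2)
  obtain ⟨r₀, hr₀, hoff⟩ := Metric.eventually_nhds_iff_ball.1 hoff
  have hnd : 0 < ‖d‖ := norm_pos_iff.2 hd0
  have hnd' : 0 < ‖d'‖ := norm_pos_iff.2 hd0'
  set r := min r₀ (min ‖d‖ ‖d'‖) with hr
  have hrpos : 0 < r := lt_min hr₀ (lt_min hnd hnd')
  have hloc : ∀ x ∈ Metric.ball e r, x ∈ chainSet (k + 1) g ↔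
      (∃ c : ℝ, 0 ≤ c ∧ x = e + c • d) ∨ ∃ c : ℝ, 0 ≤ c ∧ x = e + c • d' := by
    intro x hx
    rw [← mem_segment_add_iff (Metric.ball_subset_ball
      ((min_le_right _ _).trans (min_le_left _ _)) hx),
      ← mem_segment_add_iff (Metric.ball_subset_ball
      ((min_le_right _ _).trans (min_le_right _ _)) hx), hed, hed']
    constructor
    · rintro ⟨i, hi, hxi⟩
      rcases Nat.eq_zero_or_pos i with rfl | hi0
      · exact Or.inl hxi
      · rcases Nat.lt_or_ge i k with h1 | h1
        · exact absurd hxi (hoff x (Metric.ball_subset_ball (min_le_left _ _) hx) i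
            (Finset.mem_Ico.2 ⟨hi0, h1⟩))
        · obtain rfl : i = k := by omega
          rw [hg.closed, segment_symm] at hxi
          exact Or.inr hxi
    · rintro (hx1 | hx1)
      · exact ⟨0, by omega, hx1⟩
      · refine ⟨k, by omega, ?_⟩
        rw [hg.closed, segment_symm]; exact hx1
  have hnot : ∀ c : ℝ, 0 < c → d' ≠ c • d := by
    intro c hc hcd
    obtain ⟨t, ht0, ht1, htc⟩ : ∃ t : ℝ, 0 < t ∧ t < 1 ∧ t < c :=
      ⟨min 1 c / 2, by positivity, by linarith [min_le_left 1 c], by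
        have := min_le_right 1 c; linarith⟩
    have m1 : e + t • d ∈ segment ℝ (g 0) (g 1) := by
      rw [← hed, segment_eq_image']
      exact ⟨t, ⟨ht0.le, ht1.le⟩, by simp [e]⟩
    have m2 : e + t • d ∈ segment ℝ (g k) (g (k + 1)) := by
      rw [hg.closed, segment_symm, ← hed', segment_eq_image']
      refine ⟨t / c, ⟨by positivity, (div_le_one hc).2 htc.le⟩, ?_⟩
      simp only [add_sub_cancel_left, hcd, smul_smul, e]
      rw [div_mul_cancel₀ _ hc.ne']
    have := (hg.edges 0 k (by omega) (by omega) ⟨m1, m2⟩).1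
    rcases this with h1 | h1
    · have h2 : t • d = 0 := by
        have : e + t • d = e := h1
        simpa using this
      exact (smul_ne_zero ht0.ne' hd0) h2
    · have h2 : (1 - t) • d = 0 := by
        have : e + t • d = e + d := h1.trans hed.symm
        have := add_left_cancel this
        rw [sub_smul, one_smul, this, sub_self]
      exact (smul_ne_zero (by linarith) hd0) h2
  rcases lt_trichotomy (det d d') 0 with h1 | h1 | h1
  · have hsc : SpanCone d' d := Or.inl (by rw [det_swap]; linarith)
    refine ⟨d', d, r, hrpos, hsc, fun x hx => ?_⟩
    rw [hloc x hx, or_comm, mem_rays_iff hsc]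
  · have hsc : SpanCone d d' := by
      obtain ⟨c, hc⟩ := exists_smul_of_det_eq_zero hd0 h1
      refine Or.inr ⟨hd0, -c, ?_, by rw [hc]; simp⟩
      rcases lt_trichotomy c 0 with h2 | h2 | h2
      · linarith
      · rw [h2, zero_smul] at hc; exact absurd hc hd0'
      · exact absurd hc (hnot c h2)
    refine ⟨d, d', r, hrpos, hsc, fun x hx => ?_⟩
    rw [hloc x hx, mem_rays_iff hsc]
  · have hsc : SpanCone d d' := Or.inl h1
    refine ⟨d, d', r, hrpos, hsc, fun x hx => ?_⟩
    rw [hloc x hx, mem_rays_iff hsc]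

end IsSimpleChain

theorem isPreconnected_chainSet (n : ℕ) (f : ℕ → Plane) : IsPreconnected (chainSet n f) := by
  induction n with
  | zero =>
    have : chainSet 0 f = ∅ := by ext x; simp [chainSet]
    rw [this]; exact isPreconnected_empty
  | succ m ih =>
    have hs : chainSet (m + 1) f = chainSet m f ∪ segment ℝ (f m) (f (m + 1)) := by
      ext x
      constructor
      · rintro ⟨i, hi, hx⟩
        rcases Nat.lt_or_ge i m with h1 | h1
        · exact Or.inl ⟨i, h1, hx⟩
        · obtain rfl : i = m := by omega
          exact Or.inr hx
      · rintro (⟨i, hi, hx⟩ | hx)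
        · exact ⟨i, by omega, hx⟩
        · exact ⟨m, by omega, hx⟩
    rw [hs]
    rcases m with _ | m
    · have : chainSet 0 f = ∅ := by ext x; simp [chainSet]
      rw [this, Set.empty_union]
      exact (convex_segment _ _).isPreconnected
    · exact IsPreconnected.union (f (m + 1)) ⟨m, by omega, right_mem_segment ℝ _ _⟩
        (left_mem_segment ℝ _ _) ih (convex_segment _ _).isPreconnected

/-- The complement of a ball around the origin is connected. -/
theorem isPreconnected_norm_gt (R : ℝ) (hR : 0 ≤ R) : IsPreconnected {x : Plane | R < ‖x‖} := by
  have h1 : IsConnected ({0}ᶜ : Set Plane) := by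
    apply isConnected_compl_singleton_of_one_lt_rank
    rw [rank_eq_card_basis (EuclideanSpace.basisFun (Fin 2) ℝ).toBasis]
    simp
  have h2 : {x : Plane | R < ‖x‖} = (fun x : Plane => x + (R / ‖x‖) • x) '' {0}ᶜ := by
    ext x
    constructor
    · intro hx
      have hx : R < ‖x‖ := hx
      have hx0 : 0 < ‖x‖ := lt_of_le_of_lt hR hx
      have hc : 0 < (‖x‖ - R) / ‖x‖ := div_pos (by linarith) hx0
      refine ⟨((‖x‖ - R) / ‖x‖) • x, ?_, ?_⟩
      · rw [Set.mem_compl_iff, Set.mem_singleton_iff]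
        exact smul_ne_zero hc.ne' (norm_pos_iff.1 hx0)
      · simp only [norm_smul, Real.norm_of_nonneg hc.le, smul_smul]
        rw [div_mul_cancel₀ _ hx0.ne', ← add_smul]
        have : (‖x‖ - R) / ‖x‖ + R / (‖x‖ - R) * ((‖x‖ - R) / ‖x‖) = 1 := by
          have : ‖x‖ - R ≠ 0 := by linarith
          field_simp; ring
        rw [this, one_smul]
    · rintro ⟨y, hy, rfl⟩
      have hy0 : 0 < ‖y‖ := norm_pos_iff.2 hy
      show R < ‖y + (R / ‖y‖) • y‖
      have : y + (R / ‖y‖) • y = (1 + R / ‖y‖) • y := by module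
      rw [this, norm_smul, Real.norm_of_nonneg (by positivity)]
      field_simp; linarith
  rw [h2]
  apply h1.isPreconnected.image
  intro x hx
  apply ContinuousAt.continuousWithinAt
  have : ‖x‖ ≠ 0 := norm_ne_zero_iff.2 hx
  fun_prop (disch := assumption)

/-- The points enclosed by `B`: the bounded components of the complement. -/
def innerRegion (B : Set Plane) : Set Plane :=
  {x | x ∈ Bᶜ ∧ Bornology.IsBounded (connectedComponentIn Bᶜ x)}

/-- The points outside of `B`: the unbounded components of the complement. -/
def outerRegion (B : Set Plane) : Set Plane :=
  {x | x ∈ Bᶜ ∧ ¬ Bornology.IsBounded (connectedComponentIn Bᶜ x)}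

/-- The components of the complement of `B` that have `e` in their closure. -/
def sides (B : Set Plane) (e : Plane) : Set (Set Plane) :=
  {C | ∃ x ∈ Bᶜ, C = connectedComponentIn Bᶜ x ∧ e ∈ closure C}

/-- Where `B` consists of two rays, at most two components of its complement touch it, and they are the
same at all points. -/
theorem LocalRays.sides_eq {B : Set Plane} {e d₁ d₂ : Plane} {r : ℝ}
    (h : LocalRays B e d₁ d₂ r) (he : e ∈ B) : ∃ C D : Set Plane,
      ∀ x ∈ Metric.ball e r, x ∈ B → sides B x = {C, D} := by
  have hr := h.1
  have hee : e ∈ Metric.ball e r := Metric.mem_ball_self hr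
  have hcl := h.mem_closure hee he
  obtain ⟨s, hs⟩ := closure_nonempty_iff.1 ⟨e, hcl.1⟩
  obtain ⟨t, ht⟩ := closure_nonempty_iff.1 ⟨e, hcl.2⟩
  have hbd := h.ball_diff
  have hS : Metric.ball e r ∩ openCone e d₁ d₂ ⊆ Bᶜ := fun x hx =>
    (hbd.symm ▸ Or.inl hx : x ∈ Metric.ball e r \ B).2
  have hT : Metric.ball e r \ cone e d₁ d₂ ⊆ Bᶜ := fun x hx =>
    (hbd.symm ▸ Or.inr hx : x ∈ Metric.ball e r \ B).2
  have hSc : Metric.ball e r ∩ openCone e d₁ d₂ ⊆ connectedComponentIn Bᶜ s :=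
    ((convex_ball e r).inter (convex_openCone _ _ _)).isPreconnected.subset_connectedComponentIn
      hs hS
  have hTc : Metric.ball e r \ cone e d₁ d₂ ⊆ connectedComponentIn Bᶜ t :=
    (isPreconnected_ball_diff_cone h.2.1 hr).subset_connectedComponentIn ht hT
  refine ⟨connectedComponentIn Bᶜ s, connectedComponentIn Bᶜ t, fun x hx hxB => ?_⟩
  have hxcl := h.mem_closure hx hxB
  ext C
  simp only [sides, Set.mem_ofPred_eq, Set.mem_insert_iff, Set.mem_singleton_iff]
  constructor
  · rintro ⟨y, hy, rfl, hyc⟩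
    obtain ⟨z, hzb, hzc⟩ := mem_closure_iff.1 hyc _ Metric.isOpen_ball hx
    have hzB : z ∈ Bᶜ := connectedComponentIn_subset _ _ hzc
    have := connectedComponentIn_eq hzc
    rw [this]
    have hz : z ∈ Metric.ball e r \ B := ⟨hzb, hzB⟩
    rw [hbd] at hz
    rcases hz with hz | hz
    · exact Or.inl (connectedComponentIn_eq (hSc hz)).symm
    · exact Or.inr (connectedComponentIn_eq (hTc hz)).symm
  · rintro (rfl | rfl)
    · exact ⟨s, hS hs, rfl, closure_mono hSc hxcl.1⟩
    · exact ⟨t, hT ht, rfl, closure_mono hTc hxcl.2⟩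

namespace IsSimpleChain

variable {n : ℕ} {f : ℕ → Plane}

theorem nonempty (h : IsSimpleChain n f) : (chainSet n f).Nonempty :=
  ⟨f 0, mem_chainSet_vertex h (by omega)⟩

theorem isOpen_compl (_ : IsSimpleChain n f) : IsOpen (chainSet n f)ᶜ :=
  (isCompact_chainSet n f).isClosed.isOpen_compl

/-- The components touching a point are the same for all points of the chain: this is obvious
locally, and the chain is connected. -/
theorem sides_const (h : IsSimpleChain n f) {e e' : Plane} (he : e ∈ chainSet n f)
    (he' : e' ∈ chainSet n f) : sides (chainSet n f) e = sides (chainSet n f) e' := by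
  set B := chainSet n f
  have hloc : ∀ x ∈ B, ∃ r > 0, ∀ y ∈ Metric.ball x r, y ∈ B → sides B y = sides B x := by
    intro x hx
    obtain ⟨d₁, d₂, r, hr⟩ := h.exists_localRays hx
    obtain ⟨C, D, hCD⟩ := hr.sides_eq hx
    exact ⟨r, hr.1, fun y hy hyB => (hCD y hy hyB).trans
      (hCD x (Metric.mem_ball_self hr.1) hx).symm⟩
  choose! r hr hrs using hloc
  by_contra hne
  have hpc : IsPreconnected B := isPreconnected_chainSet n f
  let U : Set Plane := ⋃ x ∈ {x | x ∈ B ∧ sides B x = sides B e}, Metric.ball x (r x)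
  let V : Set Plane := ⋃ x ∈ {x | x ∈ B ∧ sides B x ≠ sides B e}, Metric.ball x (r x)
  obtain ⟨y, hyB, hyU, hyV⟩ := hpc U V (isOpen_biUnion fun _ _ => Metric.isOpen_ball)
    (isOpen_biUnion fun _ _ => Metric.isOpen_ball) (by
      intro x hx
      by_cases hxe : sides B x = sides B e
      · exact Or.inl (Set.mem_biUnion (⟨hx, hxe⟩ : x ∈ {x | x ∈ B ∧ sides B x = sides B e})
          (Metric.mem_ball_self (hr x hx)))
      · exact Or.inr (Set.mem_biUnion (⟨hx, hxe⟩ : x ∈ {x | x ∈ B ∧ sides B x ≠ sides B e})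
          (Metric.mem_ball_self (hr x hx))))
    ⟨e, he, Set.mem_biUnion (⟨he, rfl⟩ : e ∈ {x | x ∈ B ∧ sides B x = sides B e})
          (Metric.mem_ball_self (hr e he))⟩
    ⟨e', he', Set.mem_biUnion (⟨he', Ne.symm hne⟩ : e' ∈ {x | x ∈ B ∧ sides B x ≠ sides B e})
          (Metric.mem_ball_self (hr e' he'))⟩
  simp only [U, V, Set.mem_iUnion, Set.mem_ofPred_eq] at hyU hyV
  obtain ⟨x, ⟨hxB, hxe⟩, hyx⟩ := hyU
  obtain ⟨z, ⟨hzB, hze⟩, hyz⟩ := hyV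
  exact hze (((hrs z hzB y hyz hyB).symm.trans (hrs x hxB y hyx hyB)).trans hxe)

/-- Every component of the complement touches the chain. -/
theorem component_mem_sides (h : IsSimpleChain n f) {e x : Plane} (he : e ∈ chainSet n f)
    (hx : x ∉ chainSet n f) :
    connectedComponentIn (chainSet n f)ᶜ x ∈ sides (chainSet n f) e := by
  set B := chainSet n f
  set C := connectedComponentIn Bᶜ x with hC
  have hxC : x ∈ C := mem_connectedComponentIn hx
  have hopen : IsOpen C := h.isOpen_compl.connectedComponentIn
  suffices ∃ e' ∈ B, e' ∈ closure C by
    obtain ⟨e', he', hec⟩ := this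
    rw [h.sides_const he he']
    exact ⟨x, hx, rfl, hec⟩
  by_contra hno
  push Not at hno
  have hcl : closure C ⊆ Bᶜ := fun y hy hyB => hno y hyB hy
  have hsub : closure C ⊆ C := isPreconnected_connectedComponentIn.closure.subset_connectedComponentIn
    (subset_closure hxC) hcl
  have hclosed : IsClosed C := closure_subset_iff_isClosed.1 hsub
  have huniv : C = Set.univ := IsClopen.eq_univ ⟨hclosed, hopen⟩ ⟨x, hxC⟩
  have : e ∈ C := huniv ▸ Set.mem_univ e
  exact connectedComponentIn_subset _ _ this he

/-- The Jordan curve theorem for polygonal lines: the complement of a simple chain has a bounded and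
an unbounded component, and each point of the chain is a limit of both. They are told apart by the
winding number. -/
theorem jordan (h : IsSimpleChain n f) :
    ∃ i o : Plane, innerRegion (chainSet n f) = connectedComponentIn (chainSet n f)ᶜ i ∧
      outerRegion (chainSet n f) = connectedComponentIn (chainSet n f)ᶜ o ∧
      i ∈ innerRegion (chainSet n f) ∧ o ∈ outerRegion (chainSet n f) ∧
      (∀ e ∈ chainSet n f, e ∈ closure (innerRegion (chainSet n f)) ∧
        e ∈ closure (outerRegion (chainSet n f))) ∧
      (∀ x ∈ outerRegion (chainSet n f), wind n f x = 0) ∧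
      (∀ x ∈ innerRegion (chainSet n f), |wind n f x| = 2 * Real.pi) := by
  set B := chainSet n f with hBdef
  have h3 := h.three
  obtain ⟨R, hR⟩ := (isCompact_chainSet n f).isBounded.exists_norm_le
  have hR0 : 0 ≤ R := (norm_nonneg _).trans (hR _ h.nonempty.some_mem)
  set O : Set Plane := {x | R < ‖x‖} with hO
  have hOB : O ⊆ Bᶜ := fun x (hx : R < ‖x‖) hxB => absurd (hR x hxB) (not_le.2 hx)
  have hOc : IsPreconnected O := isPreconnected_norm_gt R hR0
  obtain ⟨o, hoR, hoB, ho0⟩ := exists_wind_eq_zero h R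
  have hoO : o ∈ O := hoR
  have hOsub : O ⊆ connectedComponentIn Bᶜ o := hOc.subset_connectedComponentIn hoO hOB
  -- a component is unbounded if and only if it is the component of `o`
  have hunb : ∀ x ∈ Bᶜ, ¬ Bornology.IsBounded (connectedComponentIn Bᶜ x) →
      connectedComponentIn Bᶜ x = connectedComponentIn Bᶜ o := by
    intro x hx hb
    have : ∃ y ∈ connectedComponentIn Bᶜ x, y ∈ O := by
      by_contra hno
      push Not at hno
      exact hb (isBounded_iff_forall_norm_le.2 ⟨R, fun y hy => not_lt.1 (hno y hy)⟩)
    obtain ⟨y, hyC, hyO⟩ := this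
    rw [connectedComponentIn_eq hyC, ← connectedComponentIn_eq (hOsub hyO)]
  have hounb : ¬ Bornology.IsBounded (connectedComponentIn Bᶜ o) := by
    intro hb
    obtain ⟨S, hS⟩ := isBounded_iff_forall_norm_le.1 hb
    obtain ⟨x, hx, hxB, -⟩ := exists_wind_eq_zero h (max R S)
    have hx1 : R < ‖x‖ := lt_of_le_of_lt (le_max_left _ _) hx
    have := hS x (hOsub hx1)
    linarith [le_max_right R S]
  have hout : outerRegion B = connectedComponentIn Bᶜ o := by
    ext x
    constructor
    · rintro ⟨hx, hb⟩
      rw [← hunb x hx hb]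
      exact mem_connectedComponentIn hx
    · intro hx
      refine ⟨connectedComponentIn_subset _ _ hx, ?_⟩
      rw [← connectedComponentIn_eq hx]; exact hounb
  -- points on the two sides of an edge
  set p : Plane := AffineMap.lineMap (f 0) (f 1) (1 / 2 : ℝ) with hp
  have hpo : p ∈ openSegment ℝ (f 0) (f 1) := by
    rw [openSegment_eq_lineMap]; exact ⟨1 / 2, ⟨by norm_num, by norm_num⟩, rfl⟩
  have hpB : p ∈ B := ⟨0, by omega, openSegment_subset_segment ℝ _ _ hpo⟩
  obtain ⟨ν, hν⟩ := wind_jump h hpo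
  obtain ⟨s, hx1, hx2, hjump⟩ := hν.exists
  set x₁ := p + s • ν
  set x₂ := p - s • ν
  have hcc : ∀ {x y : Plane}, x ∈ Bᶜ → y ∈ connectedComponentIn Bᶜ x → wind n f x = wind n f y :=
    fun {x y} hx hy => wind_eq_of_preconnected h isPreconnected_connectedComponentIn
      (connectedComponentIn_subset _ _) (mem_connectedComponentIn hx) hy
  have hne12 : connectedComponentIn Bᶜ x₁ ≠ connectedComponentIn Bᶜ x₂ := by
    intro heq
    have := hcc hx1 (heq ▸ mem_connectedComponentIn hx2 : x₂ ∈ connectedComponentIn Bᶜ x₁)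
    rw [this, sub_self] at hjump
    have := Real.pi_pos
    linarith
  obtain ⟨d₁, d₂, r, hr⟩ := h.exists_localRays hpB
  obtain ⟨C, D, hCD⟩ := hr.sides_eq hpB
  have hCD := hCD p (Metric.mem_ball_self hr.1) hpB
  have hcomp : ∀ x ∈ Bᶜ, connectedComponentIn Bᶜ x = C ∨ connectedComponentIn Bᶜ x = D := by
    intro x hx
    have := h.component_mem_sides hpB hx
    rw [hCD] at this
    exact this
  have hthird : ∀ x ∈ Bᶜ, connectedComponentIn Bᶜ x = connectedComponentIn Bᶜ x₁ ∨
      connectedComponentIn Bᶜ x = connectedComponentIn Bᶜ x₂ := by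
    intro x hx
    rcases hcomp x hx with h1 | h1 <;> rcases hcomp x₁ hx1 with h2 | h2 <;>
      rcases hcomp x₂ hx2 with h4 | h4 <;>
      first
      | exact Or.inl (h1.trans h2.symm)
      | exact Or.inr (h1.trans h4.symm)
      | exact absurd (h2.trans h4.symm) hne12
  -- choose the bounded one
  obtain ⟨i, hiB, hine, hiw, hall⟩ : ∃ i ∈ Bᶜ,
      connectedComponentIn Bᶜ i ≠ connectedComponentIn Bᶜ o ∧ |wind n f i| = 2 * Real.pi ∧
      ∀ x ∈ Bᶜ, connectedComponentIn Bᶜ x = connectedComponentIn Bᶜ o ∨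
        connectedComponentIn Bᶜ x = connectedComponentIn Bᶜ i := by
    have hpi : |2 * Real.pi| = 2 * Real.pi := abs_of_pos (by positivity)
    rcases hthird o hoB with h1 | h1
    · refine ⟨x₂, hx2, fun he => hne12 (h1.symm.trans he.symm), ?_, fun x hx => ?_⟩
      · have := hcc hoB (h1.symm ▸ mem_connectedComponentIn hx1)
        rw [← this, ho0, zero_sub] at hjump
        rw [← abs_neg, hjump, hpi]
      · rw [h1]; exact hthird x hx
    · refine ⟨x₁, hx1, fun he => hne12 (he.trans h1), ?_, fun x hx => ?_⟩
      · have := hcc hoB (h1.symm ▸ mem_connectedComponentIn hx2)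
        rw [← this, ho0, sub_zero] at hjump
        rw [hjump, hpi]
      · rw [h1]; exact (hthird x hx).symm
  have hib : Bornology.IsBounded (connectedComponentIn Bᶜ i) := by
    by_contra hb
    exact hine (hunb i hiB hb)
  have hinn : innerRegion B = connectedComponentIn Bᶜ i := by
    ext x
    constructor
    · rintro ⟨hx, hb⟩
      rcases hall x hx with h1 | h1
      · rw [h1] at hb; exact absurd hb hounb
      · rw [← h1]; exact mem_connectedComponentIn hx
    · intro hx
      refine ⟨connectedComponentIn_subset _ _ hx, ?_⟩
      rw [← connectedComponentIn_eq hx]; exact hib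
  refine ⟨i, o, hinn, hout, ⟨hiB, hib⟩, ⟨hoB, hounb⟩, ?_, ?_, ?_⟩
  · intro e he
    constructor
    · obtain ⟨x, hx, hxe, hcl⟩ := h.component_mem_sides he hiB
      rw [hinn]; exact hcl
    · obtain ⟨x, hx, hxe, hcl⟩ := h.component_mem_sides he hoB
      rw [hout]; exact hcl
  · intro x hx
    rw [hout] at hx
    rw [← hcc hoB hx, ho0]
  · intro x hx
    rw [hinn] at hx
    rw [← hcc hiB hx, hiw]

end IsSimpleChain

/-! ### Topology of polygons -/

theorem compl_eq_inner_union_outer (B : Set Plane) : Bᶜ = innerRegion B ∪ outerRegion B := by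
  ext x
  simp only [innerRegion, outerRegion, Set.mem_union, Set.mem_ofPred_eq]
  tauto

/-- A polygon together with a simple chain bounding it. -/
theorem IsPolygon.exists_chain {P : Set Plane} (hP : IsPolygon P) :
    ∃ (n : ℕ) (f : ℕ → Plane), IsSimpleChain n f ∧ P = chainSet n f ∪ innerRegion (chainSet n f) :=
  isPolygon_iff.1 hP

section

variable {n : ℕ} {f : ℕ → Plane} {P : Set Plane}

theorem IsSimpleChain.isOpen_inner (h : IsSimpleChain n f) : IsOpen (innerRegion (chainSet n f)) := by
  obtain ⟨i, o, h1, -⟩ := h.jordan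
  rw [h1]; exact h.isOpen_compl.connectedComponentIn

theorem IsSimpleChain.isOpen_outer (h : IsSimpleChain n f) : IsOpen (outerRegion (chainSet n f)) := by
  obtain ⟨i, o, -, h1, -⟩ := h.jordan
  rw [h1]; exact h.isOpen_compl.connectedComponentIn

theorem IsSimpleChain.compl_filled (_ : IsSimpleChain n f) :
    (chainSet n f ∪ innerRegion (chainSet n f))ᶜ = outerRegion (chainSet n f) := by
  have := compl_eq_inner_union_outer (chainSet n f)
  ext x
  have hx : x ∈ (chainSet n f)ᶜ ↔ x ∈ innerRegion (chainSet n f) ∪ outerRegion (chainSet n f) := by rw [this]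
  simp only [Set.mem_compl_iff, Set.mem_union] at hx ⊢
  have h1 : x ∈ outerRegion (chainSet n f) → x ∉ innerRegion (chainSet n f) := fun a b => a.2 b.2
  tauto

theorem IsSimpleChain.interior_filled (h : IsSimpleChain n f) :
    interior (chainSet n f ∪ innerRegion (chainSet n f)) = innerRegion (chainSet n f) := by
  apply Set.Subset.antisymm
  · intro x hx
    rcases interior_subset hx with h1 | h1
    · obtain ⟨i, o, -, -, -, -, hcl, -⟩ := h.jordan
      obtain ⟨y, hy1, hy2⟩ := mem_closure_iff.1 (hcl x h1).2 _ isOpen_interior hx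
      rw [← h.compl_filled] at hy2
      exact absurd (interior_subset hy1) hy2
    · exact h1
  · exact interior_maximal Set.subset_union_right h.isOpen_inner

theorem IsSimpleChain.isClosed_filled (h : IsSimpleChain n f) :
    IsClosed (chainSet n f ∪ innerRegion (chainSet n f)) := by
  rw [← isOpen_compl_iff, h.compl_filled]; exact h.isOpen_outer

theorem IsSimpleChain.frontier_filled (h : IsSimpleChain n f) :
    frontier (chainSet n f ∪ innerRegion (chainSet n f)) = chainSet n f := by
  rw [h.isClosed_filled.frontier_eq, h.interior_filled]
  ext x
  constructor
  · rintro ⟨h1 | h1, h2⟩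
    · exact h1
    · exact absurd h1 h2
  · exact fun hx => ⟨Or.inl hx, fun h2 => h2.1 hx⟩

theorem IsPolygon.isClosed (hP : IsPolygon P) : IsClosed P := by
  obtain ⟨n, f, h, rfl⟩ := hP.exists_chain
  exact h.isClosed_filled

theorem IsPolygon.frontier_subset (hP : IsPolygon P) : frontier P ⊆ P :=
  hP.isClosed.frontier_subset

theorem IsPolygon.isPreconnected_interior (hP : IsPolygon P) : IsPreconnected (interior P) := by
  obtain ⟨n, f, h, rfl⟩ := hP.exists_chain
  obtain ⟨i, o, h1, -⟩ := h.jordan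
  rw [h.interior_filled, h1]
  exact isPreconnected_connectedComponentIn

theorem IsPolygon.interior_nonempty (hP : IsPolygon P) : (interior P).Nonempty := by
  obtain ⟨n, f, h, rfl⟩ := hP.exists_chain
  obtain ⟨i, o, -, -, h1, -⟩ := h.jordan
  rw [h.interior_filled]
  exact ⟨i, h1⟩

theorem IsPolygon.subset_closure_interior (hP : IsPolygon P) : P ⊆ closure (interior P) := by
  obtain ⟨n, f, h, rfl⟩ := hP.exists_chain
  obtain ⟨i, o, -, -, -, -, hcl, -⟩ := h.jordan
  rw [h.interior_filled]
  rintro x (hx | hx)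
  · exact (hcl x hx).1
  · exact subset_closure hx

theorem IsPolygon.mem_interior_or_frontier (hP : IsPolygon P) {x : Plane} (hx : x ∈ P) :
    x ∈ interior P ∨ x ∈ frontier P := by
  rw [hP.isClosed.frontier_eq]
  by_cases h : x ∈ interior P
  · exact Or.inl h
  · exact Or.inr ⟨hx, h⟩

end

/-! ### Local structure of polygons and interior angles -/

/-- The unit vector with polar angle `φ`. -/
noncomputable def unitVec (φ : ℝ) : Plane := !₂[Real.cos φ, Real.sin φ]

theorem det_unitVec (a b : ℝ) : det (unitVec a) (unitVec b) = Real.sin (b - a) := by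
  simp [det, unitVec, Real.sin_sub]; ring

theorem norm_unitVec (φ : ℝ) : ‖unitVec φ‖ = 1 := by
  rw [EuclideanSpace.norm_eq]
  simp [unitVec, Fin.sum_univ_two]

theorem unitVec_add_two_pi (φ : ℝ) : unitVec (φ + 2 * Real.pi) = unitVec φ := by
  simp [unitVec]

theorem exists_polar {d : Plane} (hd : d ≠ 0) :
    ∃ ρ a : ℝ, 0 < ρ ∧ -Real.pi < a ∧ a ≤ Real.pi ∧ d = ρ • unitVec a := by
  have hd' : toC d ≠ 0 := by rwa [Ne, toC_eq_zero]
  refine ⟨‖toC d‖, Complex.arg (toC d), norm_pos_iff.2 hd', Complex.neg_pi_lt_arg _,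
    Complex.arg_le_pi _, plane_ext ?_ ?_⟩
  · simp only [unitVec, PiLp.smul_apply, smul_eq_mul]
    simp [Complex.norm_mul_cos_arg, toC]
  · simp only [unitVec, PiLp.smul_apply, smul_eq_mul]
    simp [Complex.norm_mul_sin_arg, toC]

theorem exists_polar_pair {d₁ d₂ : Plane} (h : 0 < det d₁ d₂) :
    ∃ ρ₁ ρ₂ a ω : ℝ, 0 < ρ₁ ∧ 0 < ρ₂ ∧ 0 < ω ∧ ω < Real.pi ∧ d₁ = ρ₁ • unitVec a ∧
      d₂ = ρ₂ • unitVec (a + ω) := by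
  have h1 : d₁ ≠ 0 := by rintro rfl; simp [det_zero_left] at h
  have h2 : d₂ ≠ 0 := by rintro rfl; simp [det_zero_right] at h
  obtain ⟨ρ₁, a, hρ₁, ha1, ha2, rfl⟩ := exists_polar h1
  obtain ⟨ρ₂, b, hρ₂, hb1, hb2, rfl⟩ := exists_polar h2
  rw [det_smul_left, det_smul_right, det_unitVec] at h
  have hs : 0 < Real.sin (b - a) := by
    have := mul_pos hρ₁ hρ₂
    by_contra hn
    nlinarith [mul_nonneg this.le (neg_nonneg.2 (not_lt.1 hn))]
  rcases lt_or_ge 0 (b - a) with h3 | h3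
  · refine ⟨ρ₁, ρ₂, a, b - a, hρ₁, hρ₂, h3, ?_, rfl, by congr 2; ring⟩
    by_contra hn
    have : Real.sin (b - a - 2 * Real.pi) ≤ 0 :=
      Real.sin_nonpos_of_nonpos_of_neg_pi_le (by linarith) (by linarith)
    rw [Real.sin_sub_two_pi] at this
    linarith
  · refine ⟨ρ₁, ρ₂, a, b - a + 2 * Real.pi, hρ₁, hρ₂, by linarith, ?_, rfl, ?_⟩
    · by_contra hn
      have : Real.sin (b - a) ≤ 0 :=
        Real.sin_nonpos_of_nonpos_of_neg_pi_le (by linarith) (by linarith)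
      linarith
    · rw [show a + (b - a + 2 * Real.pi) = b + 2 * Real.pi by ring, unitVec_add_two_pi]

/-- The directions in which one can leave `v` while staying in `P` for a short time. -/
def directions (P : Set Plane) (v : Plane) : Set ℝ :=
  {φ | ∃ ε > 0, ∀ t ∈ Set.Ioo (0 : ℝ) ε, v + t • unitVec φ ∈ P}

theorem interiorAngle_eq (P : Set Plane) (v : Plane) : interiorAngle P v =
    (MeasureTheory.volume (Set.Ioc (-Real.pi) Real.pi ∩ directions P v)).toReal := rfl

theorem directions_add_two_pi {P : Set Plane} {v : Plane} {φ : ℝ} :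
    φ + 2 * Real.pi ∈ directions P v ↔ φ ∈ directions P v := by
  simp only [directions, Set.mem_ofPred_eq, unitVec_add_two_pi]

/-- The measure of a `2π`-periodic set in a period does not depend on the period. -/
theorem volume_periodic {A : Set ℝ} (hA : MeasurableSet A)
    (hper : ∀ φ, φ + 2 * Real.pi ∈ A ↔ φ ∈ A) (a b : ℝ) :
    MeasureTheory.volume (A ∩ Set.Ioc a (a + 2 * Real.pi)) =
      MeasureTheory.volume (A ∩ Set.Ioc b (b + 2 * Real.pi)) := by
  have hpi : 0 < 2 * Real.pi := by positivity
  have h1 := isAddFundamentalDomain_Ioc hpi a (MeasureTheory.volume)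
  have h2 := isAddFundamentalDomain_Ioc hpi b (MeasureTheory.volume)
  apply h1.measure_set_eq h2 hA
  rintro ⟨g, hg⟩
  obtain ⟨k, rfl⟩ := AddSubgroup.mem_zmultiples_iff.1 hg
  ext φ
  simp only [Set.mem_preimage]
  have hz : ∀ (k : ℤ) (φ : ℝ), k • (2 * Real.pi) + φ ∈ A ↔ φ ∈ A := by
    intro k
    induction k using Int.induction_on with
    | zero => simp
    | succ i ih =>
      intro φ
      rw [← ih φ, ← hper ((i : ℤ) • (2 * Real.pi) + φ), add_smul, one_smul]
      congr! 1; ring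
    | pred i ih =>
      intro φ
      rw [← ih φ, ← hper ((-(i : ℤ) - 1) • (2 * Real.pi) + φ), sub_smul, one_smul]
      congr! 1; ring
  exact hz k φ

theorem volume_directions_lt_top (P : Set Plane) (v : Plane) :
    MeasureTheory.volume (Set.Ioc (-Real.pi) Real.pi ∩ directions P v) < ⊤ :=
  lt_of_le_of_lt (MeasureTheory.measure_mono Set.inter_subset_left) (by simp)

/-- An interval of directions into `P` bounds the interior angle from below. -/
theorem le_interiorAngle {P : Set Plane} {v : Plane} {a ω : ℝ} (hω0 : 0 ≤ ω)
    (hω : ω ≤ 2 * Real.pi) (h : Set.Ioo a (a + ω) ⊆ directions P v) : ω ≤ interiorAngle P v := by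
  let A : Set ℝ := ⋃ k : ℤ, Set.Ioo (a + k * (2 * Real.pi)) (a + ω + k * (2 * Real.pi))
  have hA : MeasurableSet A := MeasurableSet.iUnion fun k => measurableSet_Ioo
  have hper : ∀ φ, φ + 2 * Real.pi ∈ A ↔ φ ∈ A := by
    intro φ
    simp only [A, Set.mem_iUnion, Set.mem_Ioo]
    constructor
    · rintro ⟨k, h1, h2⟩
      exact ⟨k - 1, by push_cast; linarith, by push_cast; linarith⟩
    · rintro ⟨k, h1, h2⟩
      exact ⟨k + 1, by push_cast; linarith, by push_cast; linarith⟩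
  have hdir : ∀ (k : ℤ) (φ : ℝ), φ + k * (2 * Real.pi) ∈ directions P v ↔ φ ∈ directions P v := by
    intro k
    induction k using Int.induction_on with
    | zero => simp
    | succ i ih =>
      intro φ
      rw [← ih φ, ← directions_add_two_pi (φ := φ + ((i : ℤ) : ℝ) * (2 * Real.pi))]
      congr! 1; push_cast; ring
    | pred i ih =>
      intro φ
      rw [← ih φ, ← directions_add_two_pi (φ := φ + ((-(i : ℤ) - 1 : ℤ) : ℝ) * (2 * Real.pi))]
      congr! 1; push_cast; ring
  have hAsub : A ⊆ directions P v := by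
    intro φ hφ
    obtain ⟨k, h1, h2⟩ := Set.mem_iUnion.1 hφ
    rw [← hdir (-k)]
    exact h ⟨by push_cast; linarith, by push_cast; linarith⟩
  have hvol : ENNReal.ofReal ω ≤
      MeasureTheory.volume (Set.Ioc (-Real.pi) Real.pi ∩ directions P v) := by
    calc ENNReal.ofReal ω = MeasureTheory.volume (Set.Ioo a (a + ω)) := by
          rw [Real.volume_Ioo]; congr 1; ring
      _ ≤ MeasureTheory.volume (A ∩ Set.Ioc a (a + 2 * Real.pi)) := by
          apply MeasureTheory.measure_mono
          intro φ hφ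
          refine ⟨Set.mem_iUnion.2 ⟨0, by simpa using hφ⟩, hφ.1, ?_⟩
          linarith [hφ.2]
      _ = MeasureTheory.volume (A ∩ Set.Ioc (-Real.pi) (-Real.pi + 2 * Real.pi)) :=
          volume_periodic hA hper _ _
      _ ≤ _ := by
          apply MeasureTheory.measure_mono
          rintro φ ⟨h1, h2⟩
          refine ⟨⟨h2.1, by linarith [h2.2]⟩, hAsub h1⟩
  rw [interiorAngle_eq]
  calc ω = (ENNReal.ofReal ω).toReal := (ENNReal.toReal_ofReal hω0).symm
    _ ≤ _ := ENNReal.toReal_mono (volume_directions_lt_top P v).ne hvol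

/-- If `P` lies locally in a half-plane, then its interior angle is at most `π`. -/
theorem interiorAngle_le_pi {P : Set Plane} {v d : Plane} {r : ℝ} (hr : 0 < r) (hd : d ≠ 0)
    (h : ∀ x ∈ Metric.ball v r, x ∈ P → 0 ≤ det d (x - v)) : interiorAngle P v ≤ Real.pi := by
  obtain ⟨ρ, a, hρ, -, -, rfl⟩ := exists_polar hd
  let A : Set ℝ := {φ | 0 ≤ Real.sin (φ - a)}
  have hA : MeasurableSet A := (isClosed_le continuous_const (by fun_prop)).measurableSet
  have hper : ∀ φ, φ + 2 * Real.pi ∈ A ↔ φ ∈ A := by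
    intro φ
    simp only [A, Set.mem_ofPred_eq]
    rw [show φ + 2 * Real.pi - a = φ - a + 2 * Real.pi by ring, Real.sin_add_two_pi]
  have hsub : directions P v ⊆ A := by
    rintro φ ⟨ε, hε, hφ⟩
    set t := min ε r / 2 with ht
    have hm : 0 < min ε r := lt_min hε hr
    have ht0 : 0 < t := by positivity
    have h1 : t < ε := by have := min_le_left ε r; linarith
    have h2 : t < r := by have := min_le_right ε r; linarith
    have h3 := h (v + t • unitVec φ) (by
      rw [Metric.mem_ball, dist_eq_norm, add_sub_cancel_left, norm_smul, norm_unitVec, mul_one,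
        Real.norm_of_nonneg ht0.le]; exact h2) (hφ t ⟨ht0, h1⟩)
    rw [add_sub_cancel_left, det_smul_left, det_smul_right, det_unitVec] at h3
    by_contra hn
    have hn : Real.sin (φ - a) < 0 := not_le.1 hn
    have := mul_pos hρ (mul_pos ht0 (neg_pos.2 hn))
    nlinarith
  have hvol : MeasureTheory.volume (Set.Ioc (-Real.pi) Real.pi ∩ directions P v) ≤
      ENNReal.ofReal Real.pi := by
    calc _ ≤ MeasureTheory.volume (A ∩ Set.Ioc (-Real.pi) (-Real.pi + 2 * Real.pi)) := by
          apply MeasureTheory.measure_mono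
          rintro φ ⟨h1, h2⟩
          exact ⟨hsub h2, h1.1, by linarith [h1.2]⟩
      _ = MeasureTheory.volume (A ∩ Set.Ioc a (a + 2 * Real.pi)) := volume_periodic hA hper _ _
      _ ≤ MeasureTheory.volume (Set.Icc a (a + Real.pi) ∪ {a + 2 * Real.pi}) := by
          apply MeasureTheory.measure_mono
          rintro φ ⟨h1, h2, h3⟩
          by_contra hn
          simp only [Set.mem_union, Set.mem_Icc, Set.mem_singleton_iff, not_or, not_and,
            not_le] at hn
          have h4 := hn.1 h2.le
          have h5 : φ < a + 2 * Real.pi := lt_of_le_of_ne h3 hn.2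
          have h6 : Real.sin (φ - a - 2 * Real.pi) < 0 :=
            Real.sin_neg_of_neg_of_neg_pi_lt (by linarith) (by linarith)
          rw [Real.sin_sub_two_pi] at h6
          have h1 : 0 ≤ Real.sin (φ - a) := h1
          linarith
      _ ≤ MeasureTheory.volume (Set.Icc a (a + Real.pi)) +
            MeasureTheory.volume {a + 2 * Real.pi} := MeasureTheory.measure_union_le _ _
      _ = ENNReal.ofReal Real.pi := by
          rw [Real.volume_Icc, Real.volume_singleton, add_zero]; congr 1; ring
  rw [interiorAngle_eq]
  calc _ ≤ (ENNReal.ofReal Real.pi).toReal := ENNReal.toReal_mono (by simp) hvol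
    _ = Real.pi := ENNReal.toReal_ofReal Real.pi_pos.le

/-- If the complement of `P` lies locally in a proper cone, then the interior angle exceeds `π`. -/
theorem pi_lt_interiorAngle {P : Set Plane} {v d₁ d₂ : Plane} {r : ℝ} (hr : 0 < r)
    (hd : 0 < det d₁ d₂) (h : ∀ x ∈ Metric.ball v r, x ∉ openCone v d₁ d₂ → x ∈ P) :
    Real.pi < interiorAngle P v := by
  obtain ⟨ρ₁, ρ₂, a, ω, hρ₁, hρ₂, hω0, hωpi, rfl, rfl⟩ := exists_polar_pair hd
  have key : 2 * Real.pi - ω ≤ interiorAngle P v := by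
    apply le_interiorAngle (a := a + ω) (by linarith) (by linarith)
    rintro φ ⟨h1, h2⟩
    refine ⟨r, hr, fun t ht => h _ ?_ ?_⟩
    · rw [Metric.mem_ball, dist_eq_norm, add_sub_cancel_left, norm_smul, norm_unitVec, mul_one,
        Real.norm_of_nonneg ht.1.le]; exact ht.2
    · rintro ⟨h3, h4⟩
      rw [add_sub_cancel_left, det_smul_left, det_smul_right, det_unitVec] at h3
      rw [add_sub_cancel_left, det_smul_left, det_smul_right, det_unitVec] at h4
      have h5 : 0 < Real.sin (φ - a) := by
        by_contra hn
        have := mul_nonneg hρ₁.le (mul_nonneg ht.1.le (neg_nonneg.2 (not_lt.1 hn)))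
        nlinarith
      have h6 : 0 < Real.sin (a + ω - φ) := by
        by_contra hn
        have := mul_nonneg ht.1.le (mul_nonneg hρ₂.le (neg_nonneg.2 (not_lt.1 hn)))
        nlinarith
      rcases lt_or_ge (φ - a) Real.pi with h7 | h7
      · have := Real.sin_neg_of_neg_of_neg_pi_lt (x := a + ω - φ) (by linarith) (by linarith)
        linarith
      · have : Real.sin (φ - a - 2 * Real.pi) ≤ 0 :=
          Real.sin_nonpos_of_nonpos_of_neg_pi_le (by linarith) (by linarith)
        rw [Real.sin_sub_two_pi] at this
        linarith
  linarith

theorem mem_concaveVertices_iff {P : Set Plane} {v : Plane} :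
    v ∈ concaveVertices P ↔ v ∈ frontier P ∧ Real.pi < interiorAngle P v :=
  ⟨fun h => ⟨h.1.1, h.2⟩, fun h => ⟨⟨h.1, h.2.ne'⟩, h.2⟩⟩

theorem IsPolygon.exists_localRays {P : Set Plane} (hP : IsPolygon P) {e : Plane}
    (he : e ∈ frontier P) : ∃ d₁ d₂ r, LocalRays (frontier P) e d₁ d₂ r := by
  obtain ⟨n, f, h, rfl⟩ := hP.exists_chain
  rw [h.frontier_filled] at he ⊢
  exact h.exists_localRays he

theorem IsPolygon.subset_interior_or_compl {P : Set Plane} (hP : IsPolygon P) {S : Set Plane}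
    (hS : IsPreconnected S) (h : Disjoint S (frontier P)) : S ⊆ interior P ∨ S ⊆ Pᶜ := by
  apply hS.subset_or_subset isOpen_interior hP.isClosed.isOpen_compl
  · exact Set.disjoint_left.2 fun x hx hx' => hx' (interior_subset hx)
  · intro x hx
    by_cases hxP : x ∈ P
    · rcases hP.mem_interior_or_frontier hxP with h1 | h1
      · exact Or.inl h1
      · exact absurd h1 (Set.disjoint_left.1 h hx)
    · exact Or.inr hxP

/-- Near a boundary point, a polygon is either a convex cone or the complement of an open one. -/
theorem IsPolygon.localStructure {P : Set Plane} (hP : IsPolygon P) {e : Plane}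
    (he : e ∈ frontier P) : ∃ d₁ d₂ r, LocalRays (frontier P) e d₁ d₂ r ∧
      ((∀ x ∈ Metric.ball e r, x ∈ P ↔ x ∈ cone e d₁ d₂) ∨
        (∀ x ∈ Metric.ball e r, x ∈ P ↔ x ∉ openCone e d₁ d₂)) := by
  obtain ⟨d₁, d₂, r, h⟩ := hP.exists_localRays he
  refine ⟨d₁, d₂, r, h, ?_⟩
  have hr := h.1
  have hbd := h.ball_diff
  have hball : Metric.ball e r ∈ nhds e := Metric.ball_mem_nhds e hr
  have hS := hP.subset_interior_or_compl
    ((convex_ball e r).inter (convex_openCone e d₁ d₂)).isPreconnected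
    (Set.disjoint_left.2 fun x hx hx' =>
      (hbd.symm ▸ Or.inl hx : x ∈ Metric.ball e r \ frontier P).2 hx')
  have hT := hP.subset_interior_or_compl (isPreconnected_ball_diff_cone h.2.1 hr)
    (Set.disjoint_left.2 fun x hx hx' =>
      (hbd.symm ▸ Or.inr hx : x ∈ Metric.ball e r \ frontier P).2 hx')
  have hFP := hP.frontier_subset
  rcases hS with hS | hS
  · have hT' : Metric.ball e r \ cone e d₁ d₂ ⊆ Pᶜ := by
      rcases hT with hT | hT
      · exfalso
        apply he.2
        rw [mem_interior_iff_mem_nhds]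
        refine Filter.mem_of_superset hball fun x hx => ?_
        by_cases hxF : x ∈ frontier P
        · exact hFP hxF
        · have : x ∈ Metric.ball e r \ frontier P := ⟨hx, hxF⟩
          rw [hbd] at this
          rcases this with h1 | h1
          · exact interior_subset (hS h1)
          · exact interior_subset (hT h1)
      · exact hT
    left
    intro x hx
    constructor
    · intro hxP
      by_contra hc
      exact hT' ⟨hx, hc⟩ hxP
    · intro hc
      by_cases ho : x ∈ openCone e d₁ d₂
      · exact interior_subset (hS ⟨hx, ho⟩)
      · exact hFP ((h.2.2 x hx).2 ⟨hc, ho⟩)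
  · have hT' : Metric.ball e r \ cone e d₁ d₂ ⊆ interior P := by
      rcases hT with hT | hT
      · exact hT
      · exfalso
        obtain ⟨y, hy, hyi⟩ := mem_closure_iff_nhds.1 (hP.subset_closure_interior (hFP he)) _ hball
        have : y ∈ Metric.ball e r \ frontier P := ⟨hy, fun hF => hF.2 hyi⟩
        rw [hbd] at this
        rcases this with h1 | h1
        · exact hS h1 (interior_subset hyi)
        · exact hT h1 (interior_subset hyi)
    right
    intro x hx
    constructor
    · exact fun hxP ho => hS ⟨hx, ho⟩ hxP
    · intro ho
      by_cases hc : x ∈ cone e d₁ d₂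
      · exact hFP ((h.2.2 x hx).2 ⟨hc, ho⟩)
      · exact interior_subset (hT' ⟨hx, hc⟩)

/-- At a boundary point that is not a concave vertex, a polygon is locally convex. -/
theorem IsPolygon.exists_convex_inter_ball {P : Set Plane} (hP : IsPolygon P) {e : Plane}
    (he : e ∈ frontier P) (hec : e ∉ concaveVertices P) :
    ∃ r > 0, Convex ℝ (P ∩ Metric.ball e r) := by
  obtain ⟨d₁, d₂, r, h, h1 | h1⟩ := hP.localStructure he
  · refine ⟨r, h.1, ?_⟩
    have : P ∩ Metric.ball e r = cone e d₁ d₂ ∩ Metric.ball e r := by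
      ext x
      constructor
      · exact fun hx => ⟨(h1 x hx.2).1 hx.1, hx.2⟩
      · exact fun hx => ⟨(h1 x hx.2).2 hx.1, hx.2⟩
    rw [this]
    exact (convex_cone _ _ _).inter (convex_ball _ _)
  · refine ⟨r, h.1, ?_⟩
    rcases h.2.1 with h2 | ⟨h2, c, hc, h3⟩
    · exact absurd (mem_concaveVertices_iff.2 ⟨he, pi_lt_interiorAngle h.1 h2
        fun x hx hxo => (h1 x hx).2 hxo⟩) hec
    · have : P ∩ Metric.ball e r = cone e (-d₁) d₁ ∩ Metric.ball e r := by
        have key : ∀ x, x ∉ openCone e d₁ d₂ ↔ x ∈ cone e (-d₁) d₁ := by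
          intro x
          have e1 : det (x - e) d₂ = c * det d₁ (x - e) := by
            rw [h3, det_neg_right, det_smul_right, det_swap]; ring
          have e2 : det (x - e) d₁ = - det d₁ (x - e) := det_swap _ _
          simp only [openCone, cone, Set.mem_ofPred_eq, e1, det_neg_left, e2]
          constructor
          · intro h4
            by_contra h5
            have h6 : 0 < det d₁ (x - e) := by
              by_contra h7
              exact h5 ⟨by linarith, by linarith⟩
            exact h4 ⟨h6, by positivity⟩
          · rintro ⟨h4, -⟩ ⟨h5, -⟩
            linarith
        ext x
        constructor
        · exact fun hx => ⟨(key x).1 ((h1 x hx.2).1 hx.1), hx.2⟩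
        · exact fun hx => ⟨(h1 x hx.2).2 ((key x).2 hx.1), hx.2⟩
      rw [this]
      exact (convex_cone _ _ _).inter (convex_ball _ _)

open Filter Topology in
/-- If one can leave a boundary point along a line in both directions inside `P`, in one of them
through the interior, then it is a concave vertex. -/
theorem IsPolygon.mem_concaveVertices {P : Set Plane} (hP : IsPolygon P) {u τ : Plane}
    (hu : u ∈ frontier P) (h1 : ∀ᶠ s in 𝓝[>] (0 : ℝ), u + s • τ ∈ interior P)
    (h2 : ∀ᶠ s in 𝓝[>] (0 : ℝ), u - s • τ ∈ P) : u ∈ concaveVertices P := by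
  by_contra hc
  obtain ⟨r, hr, hconv⟩ := hP.exists_convex_inter_ball hu hc
  have hb : Metric.ball u r ∈ 𝓝 u := Metric.ball_mem_nhds u hr
  have h3 := (tendsto_add_smul_nhds u τ).eventually hb
  have h4 := (tendsto_add_smul_nhds u (-τ)).eventually hb
  obtain ⟨s, ⟨⟨hs1, hs2⟩, hs3, hs4⟩, hs⟩ :=
    (((h1.and h2).and (h3.and h4)).and self_mem_nhdsWithin).exists
  have hs : 0 < s := hs
  have hm : u + s • τ ∈ interior (P ∩ Metric.ball u r) := by
    rw [interior_inter, Metric.isOpen_ball.interior_eq]; exact ⟨hs1, hs3⟩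
  have hm' : u - s • τ ∈ closure (P ∩ Metric.ball u r) := subset_closure
    ⟨hs2, by simpa [sub_eq_add_neg] using hs4⟩
  have := hconv.openSegment_interior_closure_subset_interior hm hm'
    (⟨1 / 2, 1 / 2, by norm_num, by norm_num, by norm_num, by module⟩ :
      u ∈ openSegment ℝ (u + s • τ) (u - s • τ))
  exact hu.2 (interior_mono Set.inter_subset_left this)

open Filter Topology in
/-- If the boundary of a polygon contains a segment through `e`, then the cone at `e` is a
half-plane. -/
theorem LocalRays.straight {B : Set Plane} {e d₁ d₂ τ : Plane} {r : ℝ}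
    (h : LocalRays B e d₁ d₂ r) (hτ : τ ≠ 0) (h1 : ∀ᶠ s in 𝓝[>] (0 : ℝ), e + s • τ ∈ B)
    (h2 : ∀ᶠ s in 𝓝[>] (0 : ℝ), e - s • τ ∈ B) :
    (d₁ ≠ 0 ∧ ∃ c : ℝ, 0 < c ∧ d₂ = -(c • d₁)) ∧ det d₁ τ = 0 := by
  have hb : Metric.ball e r ∈ 𝓝 e := Metric.ball_mem_nhds e h.1
  have h3 := (tendsto_add_smul_nhds e τ).eventually hb
  have h4 := (tendsto_add_smul_nhds e (-τ)).eventually hb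
  obtain ⟨s, ⟨⟨hs1, hs2⟩, hs3, hs4⟩, hs⟩ :=
    (((h1.and h2).and (h3.and h4)).and self_mem_nhdsWithin).exists
  have hs : 0 < s := hs
  rw [smul_neg, ← sub_eq_add_neg] at hs4
  obtain ⟨⟨a1, a2⟩, -⟩ := (h.2.2 _ hs3).1 hs1
  obtain ⟨⟨b1, b2⟩, -⟩ := (h.2.2 _ hs4).1 hs2
  rw [add_sub_cancel_left, det_smul_right] at a1
  rw [add_sub_cancel_left, det_smul_left] at a2
  rw [sub_sub_cancel_left, det_neg_right, det_smul_right] at b1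
  rw [sub_sub_cancel_left, det_neg_left, det_smul_left] at b2
  have c1 : s * det d₁ τ = 0 := by linarith
  have c2 : s * det τ d₂ = 0 := by linarith
  have c1 := (mul_eq_zero.1 c1).resolve_left hs.ne'
  have c2 := (mul_eq_zero.1 c2).resolve_left hs.ne'
  refine ⟨?_, c1⟩
  rcases h.2.1 with h5 | h5
  · exfalso
    have hd : d₁ ≠ 0 := by rintro rfl; simp [det_zero_left] at h5
    obtain ⟨c, hc⟩ := exists_smul_of_det_eq_zero hd c1
    rw [hc, det_smul_left] at c2
    rcases mul_eq_zero.1 c2 with h6 | h6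
    · rw [h6, zero_smul] at hc; exact hτ hc
    · exact h5.ne' h6
  · exact h5

open Filter Topology in
theorem eventually_mem_of_openSegment {S : Set Plane} {v w e : Plane}
    (h : openSegment ℝ v w ⊆ S) (he : e ∈ openSegment ℝ v w) :
    (∀ᶠ s in 𝓝[>] (0 : ℝ), e + s • (w - v) ∈ S) ∧ ∀ᶠ s in 𝓝[>] (0 : ℝ), e - s • (w - v) ∈ S := by
  rw [openSegment_eq_image'] at he h
  obtain ⟨t, ⟨ht0, ht1⟩, rfl⟩ := he
  constructor
  · filter_upwards [Ioo_mem_nhdsGT (sub_pos.2 ht1)] with s hs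
    exact h ⟨t + s, ⟨by linarith [hs.1], by linarith [hs.2]⟩, by simp only; module⟩
  · filter_upwards [Ioo_mem_nhdsGT ht0] with s hs
    exact h ⟨t - s, ⟨by linarith [hs.2], by linarith [hs.1]⟩, by simp only; module⟩

/-- A polygon is a half-plane near a point inside a straight piece of its boundary. -/
theorem IsPolygon.halfPlane {Q : Set Plane} (hQ : IsPolygon Q) {v w e : Plane} (hvw : v ≠ w)
    (h : openSegment ℝ v w ⊆ frontier Q) (he : e ∈ openSegment ℝ v w) :
    ∃ r > 0, (∀ x ∈ Metric.ball e r, x ∈ Q ↔ 0 ≤ det (w - v) (x - e)) ∨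
      (∀ x ∈ Metric.ball e r, x ∈ Q ↔ det (w - v) (x - e) ≤ 0) := by
  obtain ⟨d₁, d₂, r, hl, hcase⟩ := hQ.localStructure (h he)
  obtain ⟨h1, h2⟩ := eventually_mem_of_openSegment h he
  have hτ : w - v ≠ 0 := sub_ne_zero.2 hvw.symm
  obtain ⟨⟨hd1, c, hc, hd2⟩, hdet⟩ := hl.straight hτ h1 h2
  obtain ⟨k, hk⟩ := exists_smul_of_det_eq_zero hd1 hdet
  have hk0 : k ≠ 0 := by rintro rfl; rw [zero_smul] at hk; exact hτ hk
  have e1 : ∀ x, det (x - e) d₂ = c * det d₁ (x - e) := by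
    intro x
    rw [hd2, det_neg_right, det_smul_right, det_swap]; ring
  refine ⟨r, hl.1, ?_⟩
  rw [hk]
  simp only [det_smul_left]
  rcases hcase with hcase | hcase
  · have key : ∀ x ∈ Metric.ball e r, x ∈ Q ↔ 0 ≤ det d₁ (x - e) := by
      intro x hx
      rw [hcase x hx]
      simp only [cone, Set.mem_ofPred_eq, e1]
      exact ⟨fun h => h.1, fun h => ⟨h, by positivity⟩⟩
    rcases lt_or_gt_of_ne hk0 with h4 | h4
    · right
      intro x hx
      rw [key x hx]
      constructor <;> intro h5 <;> nlinarith
    · left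
      intro x hx
      rw [key x hx]
      constructor <;> intro h5 <;> [positivity; exact nonneg_of_mul_nonneg_right h5 h4]
  · have key : ∀ x ∈ Metric.ball e r, x ∈ Q ↔ det d₁ (x - e) ≤ 0 := by
      intro x hx
      rw [hcase x hx]
      simp only [openCone, Set.mem_ofPred_eq, e1]
      constructor
      · intro h5
        by_contra h6
        have h6 := not_le.1 h6
        exact h5 ⟨h6, by positivity⟩
      · intro h5 h6
        linarith [h6.1]
    rcases lt_or_gt_of_ne hk0 with h4 | h4
    · left
      intro x hx
      rw [key x hx]
      constructor <;> intro h5 <;> nlinarith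
    · right
      intro x hx
      rw [key x hx]
      constructor <;> intro h5 <;> nlinarith

theorem IsPolygon.finite_concaveVertices {P : Set Plane} (hP : IsPolygon P) :
    (concaveVertices P).Finite := by
  obtain ⟨n, f, h, rfl⟩ := hP.exists_chain
  apply ((Set.finite_le_nat n).image f).subset
  intro v hv
  rw [mem_concaveVertices_iff] at hv
  have hvc := hv.1
  rw [h.frontier_filled] at hvc
  obtain ⟨i, hi, hvi⟩ := hvc
  by_contra hno
  have h1 : v ≠ f i := fun he => hno ⟨i, hi.le, he.symm⟩
  have h2 : v ≠ f (i + 1) := fun he => hno ⟨i + 1, hi, he.symm⟩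
  have hop := mem_openSegment_of_ne_left_right h1.symm h2.symm hvi
  have hsub : openSegment ℝ (f i) (f (i + 1)) ⊆
      frontier (chainSet n f ∪ innerRegion (chainSet n f)) := by
    rw [h.frontier_filled]
    exact fun x hx => ⟨i, hi, openSegment_subset_segment ℝ _ _ hx⟩
  have hne := h.succ_ne hi
  obtain ⟨r, hr, h4 | h4⟩ := hP.halfPlane hne hsub hop
  · have := interiorAngle_le_pi hr (sub_ne_zero.2 hne.symm) fun x hx hxP => (h4 x hx).1 hxP
    linarith [hv.2]
  · have := interiorAngle_le_pi (d := -(f (i + 1) - f i)) hr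
      (neg_ne_zero.2 (sub_ne_zero.2 hne.symm)) fun x hx hxP => by
        rw [det_neg_left]; linarith [(h4 x hx).1 hxP]
    linarith [hv.2]

/-- Near a boundary point, a polygon, its interior and its boundary are invariant under scaling. -/
theorem IsPolygon.conic {P : Set Plane} (hP : IsPolygon P) {e : Plane} (he : e ∈ frontier P) :
    ∃ r > 0, ∀ d : Plane, ∀ t : ℝ, ‖d‖ < r → 0 < t → t ≤ 1 →
      (e + t • d ∈ P ↔ e + d ∈ P) ∧ (e + t • d ∈ frontier P ↔ e + d ∈ frontier P) ∧
      (e + t • d ∈ interior P ↔ e + d ∈ interior P) := by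
  obtain ⟨d₁, d₂, r, hl, hcase⟩ := hP.localStructure he
  refine ⟨r, hl.1, fun d t hd ht0 ht1 => ?_⟩
  have hb : e + d ∈ Metric.ball e r := by
    rwa [Metric.mem_ball, dist_eq_norm, add_sub_cancel_left]
  have hb' : e + t • d ∈ Metric.ball e r := by
    rw [Metric.mem_ball, dist_eq_norm, add_sub_cancel_left, norm_smul, Real.norm_of_nonneg ht0.le]
    nlinarith [norm_nonneg d]
  have hc : e + t • d ∈ cone e d₁ d₂ ↔ e + d ∈ cone e d₁ d₂ := by
    simp only [cone, Set.mem_ofPred_eq, add_sub_cancel_left, det_smul_right, det_smul_left,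
      mul_nonneg_iff_of_pos_left ht0]
  have ho : e + t • d ∈ openCone e d₁ d₂ ↔ e + d ∈ openCone e d₁ d₂ := by
    simp only [openCone, Set.mem_ofPred_eq, add_sub_cancel_left, det_smul_right, det_smul_left,
      mul_pos_iff_of_pos_left ht0]
  have hF : e + t • d ∈ frontier P ↔ e + d ∈ frontier P := by
    rw [hl.2.2 _ hb, hl.2.2 _ hb', hc, ho]
  have hPP : e + t • d ∈ P ↔ e + d ∈ P := by
    rcases hcase with h1 | h1
    · rw [h1 _ hb, h1 _ hb', hc]
    · rw [h1 _ hb, h1 _ hb', ho]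
  refine ⟨hPP, hF, ?_⟩
  have hint : ∀ x, x ∈ interior P ↔ x ∈ P ∧ x ∉ frontier P := by
    intro x
    constructor
    · exact fun hx => ⟨interior_subset hx, fun hF => hF.2 hx⟩
    · exact fun hx => (hP.mem_interior_or_frontier hx.1).resolve_right hx.2
  rw [hint, hint, hPP, hF]

/-! ### Chords and partitions -/

/-- A chord of `P`: a nondegenerate segment between boundary points through the interior. -/
def IsChord (P : Set Plane) (p q : Plane) : Prop :=
  p ∈ frontier P ∧ q ∈ frontier P ∧ p ≠ q ∧ openSegment ℝ p q ⊆ interior P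

theorem IsChord.symm {P : Set Plane} {p q : Plane} (h : IsChord P p q) : IsChord P q p :=
  ⟨h.2.1, h.1, h.2.2.1.symm, by rw [openSegment_symm]; exact h.2.2.2⟩

theorem IsChord.segment_subset {P : Set Plane} {p q : Plane} (h : IsChord P p q)
    (hP : IsPolygon P) : segment ℝ p q ⊆ P := by
  rw [segment_eq_insert_openSegment]
  rintro x (rfl | rfl | hx)
  · exact hP.frontier_subset h.1
  · exact hP.frontier_subset h.2.1
  · exact interior_subset (h.2.2.2 hx)

namespace IsSimpleChain

variable {n : ℕ} {f : ℕ → Plane}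

/-- Any two points of a simple chain may be taken as vertices, the first one as the initial
vertex. -/
theorem exists_start_pair (h : IsSimpleChain n f) {p q : Plane} (hp : p ∈ chainSet n f)
    (hq : q ∈ chainSet n f) :
    ∃ (m : ℕ) (g : ℕ → Plane) (k : ℕ), IsSimpleChain m g ∧ chainSet m g = chainSet n f ∧ g 0 = p ∧
      k < m ∧ g k = q := by
  obtain ⟨m₁, g₁, h₁, hs₁, hp₁⟩ := h.exists_start hp
  rw [← hs₁] at hq
  by_cases hqi : ∃ k < m₁, g₁ k = q
  · obtain ⟨k, hk, hkq⟩ := hqi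
    exact ⟨m₁, g₁, k, h₁, hs₁, hp₁, hk, hkq⟩
  · push Not at hqi
    have h3 := h₁.three
    obtain ⟨i, hi, hx⟩ := hq
    have hop : q ∈ openSegment ℝ (g₁ i) (g₁ (i + 1)) := by
      refine mem_openSegment_of_ne_left_right (hqi i hi) ?_ hx
      rw [← h₁.mod_succ hi]
      exact hqi _ (Nat.mod_lt _ (by omega))
    have h4 := h₁.shift (i + 1)
    have e1 : (m₁ - 1 + (i + 1)) % m₁ = i := by
      rw [show m₁ - 1 + (i + 1) = i + m₁ by omega, Nat.add_mod_right, Nat.mod_eq_of_lt hi]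
    obtain ⟨g, hg, hgs, hgi, hgn⟩ := h4.insertLast (p := q) (by
      simp only [zero_add]
      rw [e1, h₁.mod_succ hi]; exact hop)
    -- the index of `p` after the renumbering
    have e2 : (m₁ - 1 - i + (i + 1)) % m₁ = 0 := by
      rw [show m₁ - 1 - i + (i + 1) = m₁ by omega, Nat.mod_self]
    have hgp : g (m₁ - 1 - i) = p := by
      rw [hgi _ (by omega), e2, hp₁]
    refine ⟨m₁ + 1, _, (m₁ + (m₁ + 1 - (m₁ - 1 - i))) % (m₁ + 1), hg.shift (m₁ - 1 - i),
      (hg.shift_chainSet _).trans (hgs.trans ((h₁.shift_chainSet _).trans hs₁)), ?_,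
      Nat.mod_lt _ (by omega), ?_⟩
    · simp only [zero_add]
      rw [Nat.mod_eq_of_lt (by omega), hgp]
    · rw [Nat.mod_add_mod, show m₁ + (m₁ + 1 - (m₁ - 1 - i)) + (m₁ - 1 - i) = m₁ + (m₁ + 1) by omega,
        Nat.add_mod_right, Nat.mod_eq_of_lt (by omega), hgn]

/-- Cutting off a simple chain along a segment from its initial vertex to another one. -/
theorem cut (h : IsSimpleChain n f) {k : ℕ} (hk2 : 2 ≤ k) (hkn : k < n)
    (hd : ∀ x ∈ openSegment ℝ (f 0) (f k), x ∉ chainSet n f) :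
    IsSimpleChain (k + 1) (fun i => if i ≤ k then f i else f 0) := by
  set g : ℕ → Plane := fun i => if i ≤ k then f i else f 0 with hg
  have g1 : ∀ i ≤ k, g i = f i := fun i hi => if_pos hi
  have g2 : g (k + 1) = f 0 := if_neg (by omega)
  refine ⟨by omega, by rw [g2, g1 0 (by omega)], ?_, ?_⟩
  · intro i j hi hj hij
    rw [g1 i (by omega), g1 j (by omega)] at hij
    exact h.inj i j (by omega) (by omega) hij
  · intro i j hij hj
    rcases Nat.lt_or_ge j k with h1 | h1
    · rw [g1 i (by omega), g1 (i + 1) (by omega), g1 j (by omega), g1 (j + 1) (by omega)]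
      exact h.edges i j hij (by omega)
    · obtain rfl : j = k := by omega
      rw [g1 i (by omega), g1 (i + 1) (by omega), g1 j le_rfl, g2]
      rintro x ⟨hx1, hx2⟩
      have hx3 : x = f 0 ∨ x = f j := by
        rw [segment_symm, segment_eq_insert_openSegment] at hx2
        rcases hx2 with hx2 | hx2 | hx2
        · exact Or.inl hx2
        · exact Or.inr hx2
        · exact absurd ⟨i, by omega, hx1⟩ (hd x hx2)
      refine ⟨?_, ?_⟩
      · rcases hx3 with rfl | rfl
        · rcases Nat.eq_zero_or_pos i with rfl | hi
          · exact Or.inl rfl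
          · have := (h.edges 0 i hi (by omega) ⟨left_mem_segment ℝ _ _, hx1⟩).2
            exact this
        · have := (h.edges i j hij (by omega) ⟨hx1, left_mem_segment ℝ _ _⟩).1
          exact this
      · rcases hx3 with rfl | rfl
        · exact Or.inr rfl
        · exact Or.inl rfl

/-- The same for the complementary part of the chain. -/
theorem cut' (h : IsSimpleChain n f) {k : ℕ} (hk : 0 < k) (hkn : k + 2 ≤ n)
    (hd : ∀ x ∈ openSegment ℝ (f 0) (f k), x ∉ chainSet n f) :
    IsSimpleChain (n - k + 1) (fun i => if i ≤ n - k then f (k + i) else f k) := by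
  have h1 := h.shift k
  have h2 : ∀ x ∈ openSegment ℝ (f ((0 + k) % n)) (f ((n - k + k) % n)),
      x ∉ chainSet n (fun i => f ((i + k) % n)) := by
    rw [h.shift_chainSet, zero_add, Nat.mod_eq_of_lt (by omega), Nat.sub_add_cancel (by omega),
      Nat.mod_self, openSegment_symm]
    exact hd
  have h3 := h1.cut (k := n - k) (by omega) (by omega) h2
  convert h3 using 2 with i
  split_ifs with hi
  · rcases Nat.lt_or_ge (i + k) n with h4 | h4
    · rw [Nat.mod_eq_of_lt h4, add_comm]
    · have : i + k = n := by omega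
      rw [this, Nat.mod_self, add_comm, this, h.closed]
  · rw [zero_add, Nat.mod_eq_of_lt (by omega)]

theorem outer_subset_outer {m : ℕ} {g : ℕ → Plane} (h : IsSimpleChain n f)
    (hd : Disjoint (outerRegion (chainSet n f)) (chainSet m g)) :
    outerRegion (chainSet n f) ⊆ outerRegion (chainSet m g) := by
  obtain ⟨i, o, -, ho, -, hoo, -⟩ := h.jordan
  intro x hx
  have hpc : IsPreconnected (outerRegion (chainSet n f)) := by
    rw [ho]; exact isPreconnected_connectedComponentIn
  have hsub := hpc.subset_connectedComponentIn hx (F := (chainSet m g)ᶜ)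
    fun y hy => Set.disjoint_left.1 hd hy
  refine ⟨Set.disjoint_left.1 hd hx, fun hb => ?_⟩
  have := hb.subset hsub
  rw [ho] at this
  exact hoo.2 this

end IsSimpleChain

/-- A chord cuts a polygon into two polygons. -/
theorem IsChord.exists_partition {P : Set Plane} (hP : IsPolygon P) {p q : Plane}
    (h : IsChord P p q) : ∃ Q₁ Q₂, InducesPartition P p q Q₁ Q₂ := by
  have hseg := h.segment_subset hP
  obtain ⟨hp, hq, hpq, hint⟩ := h
  obtain ⟨n₀, f₀, h₀, hPf⟩ := hP.exists_chain
  have hF₀ : frontier P = chainSet n₀ f₀ := by rw [hPf, h₀.frontier_filled]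
  obtain ⟨n, f, k, hf, hfs, rfl, hkn, rfl⟩ :=
    h₀.exists_start_pair (hF₀ ▸ hp) (hF₀ ▸ hq)
  rw [← hfs] at hPf hF₀
  clear hfs h₀
  have hI : interior P = innerRegion (chainSet n f) := by rw [hPf, hf.interior_filled]
  have h3 := hf.three
  have hd : ∀ x ∈ openSegment ℝ (f 0) (f k), x ∉ chainSet n f := by
    intro x hx hxc
    rw [← hF₀] at hxc
    exact hxc.2 (hint hx)
  have hmid : (openSegment ℝ (f 0) (f k)).Nonempty :=
    ⟨AffineMap.lineMap (f 0) (f k) (1 / 2 : ℝ), by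
      rw [openSegment_eq_lineMap]; exact ⟨1 / 2, ⟨by norm_num, by norm_num⟩, rfl⟩⟩
  obtain ⟨z, hz⟩ := hmid
  have hk0 : 0 < k := Nat.pos_of_ne_zero fun h0 => hpq (by rw [h0])
  have hk1 : k ≠ 1 := by
    rintro rfl
    exact hd z hz ⟨0, by omega, openSegment_subset_segment ℝ _ _ hz⟩
  have hkn1 : k ≠ n - 1 := by
    intro hkn1
    refine hd z hz ⟨n - 1, by omega, ?_⟩
    rw [show n - 1 + 1 = n by omega, hf.closed, segment_symm, ← hkn1]
    exact openSegment_subset_segment ℝ _ _ hz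
  have c₁ := hf.cut (k := k) (by omega) hkn hd
  have c₂ := hf.cut' (k := k) hk0 (by omega) hd
  set g₁ : ℕ → Plane := fun i => if i ≤ k then f i else f 0 with hg₁
  set g₂ : ℕ → Plane := fun i => if i ≤ n - k then f (k + i) else f k with hg₂
  have a1 : ∀ i ≤ k, g₁ i = f i := fun i hi => if_pos hi
  have a2 : g₁ (k + 1) = f 0 := if_neg (by omega)
  have b1 : ∀ i ≤ n - k, g₂ i = f (k + i) := fun i hi => if_pos hi
  have b2 : g₂ (n - k + 1) = f k := if_neg (by omega)
  have b3 : g₂ (n - k) = f 0 := by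
    rw [b1 _ le_rfl, show k + (n - k) = n by omega, hf.closed]
  set B := chainSet n f
  set B₁ := chainSet (k + 1) g₁
  set B₂ := chainSet (n - k + 1) g₂
  set c := segment ℝ (f 0) (f k)
  -- the two new chains consist of the chord and complementary parts of the old chain
  have hB₁ : ∀ x, x ∈ B₁ ↔ (∃ i < k, x ∈ segment ℝ (f i) (f (i + 1))) ∨ x ∈ c := by
    intro x
    constructor
    · rintro ⟨i, hi, hx⟩
      rcases Nat.lt_or_ge i k with h1 | h1
      · rw [a1 i (by omega), a1 (i + 1) (by omega)] at hx
        exact Or.inl ⟨i, h1, hx⟩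
      · obtain rfl : i = k := by omega
        rw [a1 i le_rfl, a2, segment_symm] at hx
        exact Or.inr hx
    · rintro (⟨i, hi, hx⟩ | hx)
      · exact ⟨i, by omega, by rwa [a1 i (by omega), a1 (i + 1) (by omega)]⟩
      · exact ⟨k, by omega, by rwa [a1 k le_rfl, a2, segment_symm]⟩
  have hB₂ : ∀ x, x ∈ B₂ ↔
      (∃ i, k ≤ i ∧ i < n ∧ x ∈ segment ℝ (f i) (f (i + 1))) ∨ x ∈ c := by
    intro x
    constructor
    · rintro ⟨i, hi, hx⟩
      rcases Nat.lt_or_ge i (n - k) with h1 | h1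
      · rw [b1 i (by omega), b1 (i + 1) (by omega)] at hx
        exact Or.inl ⟨k + i, by omega, by omega, hx⟩
      · obtain rfl : i = n - k := by omega
        rw [b3, b2] at hx
        exact Or.inr hx
    · rintro (⟨i, hi, hin, hx⟩ | hx)
      · refine ⟨i - k, by omega, ?_⟩
        rwa [b1 (i - k) (by omega), b1 (i - k + 1) (by omega), show k + (i - k) = i by omega,
          show k + (i - k + 1) = i + 1 by omega]
      · exact ⟨n - k, by omega, by rwa [b3, b2]⟩
  have hBB : B ⊆ B₁ ∪ B₂ := by
    rintro x ⟨i, hi, hx⟩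
    rcases Nat.lt_or_ge i k with h1 | h1
    · exact Or.inl ((hB₁ x).2 (Or.inl ⟨i, h1, hx⟩))
    · exact Or.inr ((hB₂ x).2 (Or.inl ⟨i, h1, hi, hx⟩))
  have hB₁' : B₁ ⊆ B ∪ c := by
    intro x hx
    rcases (hB₁ x).1 hx with ⟨i, hi, h1⟩ | h1
    · exact Or.inl ⟨i, by omega, h1⟩
    · exact Or.inr h1
  have hB₂' : B₂ ⊆ B ∪ c := by
    intro x hx
    rcases (hB₂ x).1 hx with ⟨i, -, hi, h1⟩ | h1
    · exact Or.inl ⟨i, by omega, h1⟩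
    · exact Or.inr h1
  have hBP : B ⊆ P := by rw [hPf]; exact Set.subset_union_left
  have hinter : ∀ x ∈ B₁, x ∈ B₂ → x ∈ c := by
    intro x hx1 hx2
    rcases (hB₁ x).1 hx1 with ⟨i, hi, h1⟩ | h1
    · rcases (hB₂ x).1 hx2 with ⟨j, hj, hjn, h2⟩ | h2
      · have := hf.edges i j (by omega) hjn ⟨h1, h2⟩
        -- the common vertex is `f 0` or `f k`
        rcases this.1 with e1 | e1 <;> rcases this.2 with e2 | e2
        · have := hf.inj i j (by omega) hjn (e1.symm.trans e2)
          omega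
        · have e3 : f ((j + 1) % n) = f i := by rw [hf.mod_succ hjn]; exact e2.symm.trans e1
          have := hf.inj _ _ (Nat.mod_lt _ (by omega)) (by omega) e3
          rcases Nat.lt_or_ge (j + 1) n with h5 | h5
          · rw [Nat.mod_eq_of_lt h5] at this; omega
          · have h6 : j + 1 = n := by omega
            rw [h6, Nat.mod_self] at this
            subst this
            rw [e1]
            exact left_mem_segment ℝ _ _
        · have := hf.inj (i + 1) j (by omega) hjn (e1.symm.trans e2)
          obtain rfl : i + 1 = k := by omega
          rw [e1]; exact right_mem_segment ℝ _ _
        · have e3 : f ((j + 1) % n) = f (i + 1) := by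
            rw [hf.mod_succ hjn]; exact e2.symm.trans e1
          have := hf.inj _ _ (Nat.mod_lt _ (by omega)) (by omega) e3
          rcases Nat.lt_or_ge (j + 1) n with h5 | h5
          · rw [Nat.mod_eq_of_lt h5] at this; omega
          · have h6 : j + 1 = n := by omega
            rw [h6, Nat.mod_self] at this
            omega
      · exact h2
    · exact h1
  have hwind : ∀ x, x ∉ c → wind n f x = wind (k + 1) g₁ x + wind (n - k + 1) g₂ x := by
    intro x hx
    have e1 : wind (k + 1) g₁ x =
        (∑ i ∈ Finset.range k, turn (f i) (f (i + 1)) x) + turn (f k) (f 0) x := by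
      unfold wind
      rw [Finset.sum_range_succ, a1 k le_rfl, a2]
      congr 1
      refine Finset.sum_congr rfl fun i hi => ?_
      rw [Finset.mem_range] at hi
      rw [a1 i (by omega), a1 (i + 1) (by omega)]
    have e2 : wind (n - k + 1) g₂ x =
        (∑ i ∈ Finset.range (n - k), turn (f (k + i)) (f (k + i + 1)) x) + turn (f 0) (f k) x := by
      unfold wind
      rw [Finset.sum_range_succ, b3, b2]
      congr 1
      refine Finset.sum_congr rfl fun i hi => ?_
      rw [Finset.mem_range] at hi
      rw [b1 i (by omega), b1 (i + 1) (by omega)]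
      rfl
    have e3 : wind n f x = (∑ i ∈ Finset.range k, turn (f i) (f (i + 1)) x) +
        ∑ i ∈ Finset.range (n - k), turn (f (k + i)) (f (k + i + 1)) x := by
      unfold wind
      rw [← Finset.sum_range_add (fun i => turn (f i) (f (i + 1)) x),
        show k + (n - k) = n by omega]
    rw [e1, e2, e3, turn_symm hx]
    ring
  obtain ⟨-, -, -, -, -, -, hcl, hw0, hw1⟩ := hf.jordan
  obtain ⟨-, -, -, -, -, -, -, hw10, hw11⟩ := c₁.jordan
  obtain ⟨-, -, -, -, -, -, -, hw20, hw21⟩ := c₂.jordan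
  have hOP : outerRegion B = Pᶜ := by rw [hPf, hf.compl_filled]
  have hO₁ : outerRegion B ⊆ outerRegion B₁ := hf.outer_subset_outer (Set.disjoint_left.2
    fun x hx hx1 => by
      rw [hOP] at hx
      rcases hB₁' hx1 with h1 | h1
      · exact hx (hBP h1)
      · exact hx (hseg h1))
  have hO₂ : outerRegion B ⊆ outerRegion B₂ := hf.outer_subset_outer (Set.disjoint_left.2
    fun x hx hx1 => by
      rw [hOP] at hx
      rcases hB₂' hx1 with h1 | h1
      · exact hx (hBP h1)
      · exact hx (hseg h1))
  have hpi := Real.pi_pos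
  have hcase : ∀ (D : Set Plane) (x : Plane), x ∈ D ∨ x ∈ innerRegion D ∨ x ∈ outerRegion D := by
    intro D x
    by_cases hx : x ∈ D
    · exact Or.inl hx
    · have : x ∈ Dᶜ := hx
      rw [compl_eq_inner_union_outer] at this
      exact Or.inr this
  have hdisj : ∀ (D : Set Plane) (x : Plane), x ∈ innerRegion D → x ∉ outerRegion D :=
    fun D x h1 h2 => h2.2 h1.2
  have hmix : ∀ x ∈ B, x ∉ innerRegion B₁ ∧ x ∉ innerRegion B₂ := by
    intro x hx
    constructor
    · intro hi
      obtain ⟨y, hy1, hy2⟩ := mem_closure_iff.1 (hcl x hx).2 _ c₁.isOpen_inner hi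
      exact hdisj _ _ hy1 (hO₁ hy2)
    · intro hi
      obtain ⟨y, hy1, hy2⟩ := mem_closure_iff.1 (hcl x hx).2 _ c₂.isOpen_inner hi
      exact hdisj _ _ hy1 (hO₂ hy2)
  have hc₁ : c ⊆ B₁ := fun x hx => (hB₁ x).2 (Or.inr hx)
  have hc₂ : c ⊆ B₂ := fun x hx => (hB₂ x).2 (Or.inr hx)
  refine ⟨B₁ ∪ innerRegion B₁, B₂ ∪ innerRegion B₂, hp, hq, hseg,
    isPolygon_iff.2 ⟨_, _, c₁, rfl⟩, isPolygon_iff.2 ⟨_, _, c₂, rfl⟩, ?_, ?_⟩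
  · apply Set.Subset.antisymm
    · intro x hx
      rcases hcase B₁ x with h1 | h1 | h1
      · exact Or.inl (Or.inl h1)
      · exact Or.inl (Or.inr h1)
      · rcases hcase B₂ x with h2 | h2 | h2
        · exact Or.inr (Or.inl h2)
        · exact Or.inr (Or.inr h2)
        · exfalso
          rw [hPf] at hx
          rcases hx with hx | hx
          · rcases hBB hx with h4 | h4
            · exact h1.1 h4
            · exact h2.1 h4
          · have e1 := hw1 x hx
            rw [hwind x fun hxc => h1.1 (hc₁ hxc), hw10 x h1, hw20 x h2] at e1
            simp at e1
    · have key : ∀ x, x ∉ P → x ∈ outerRegion B := fun x hx => by rw [hOP]; exact hx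
      rintro x ((hx | hx) | (hx | hx))
      · rcases hB₁' hx with h1 | h1
        · exact hBP h1
        · exact hseg h1
      · by_contra hxP
        exact hdisj _ _ hx (hO₁ (key x hxP))
      · rcases hB₂' hx with h1 | h1
        · exact hBP h1
        · exact hseg h1
      · by_contra hxP
        exact hdisj _ _ hx (hO₂ (key x hxP))
  · apply Set.Subset.antisymm
    · exact fun x hx => ⟨Or.inl (hc₁ hx), Or.inl (hc₂ hx)⟩
    · rintro x ⟨hx1 | hx1, hx2 | hx2⟩
      · exact hinter x hx1 hx2
      · rcases hB₁' hx1 with h1 | h1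
        · exact absurd hx2 (hmix x h1).2
        · exact h1
      · rcases hB₂' hx2 with h1 | h1
        · exact absurd hx1 (hmix x h1).1
        · exact h1
      · exfalso
        -- the winding numbers `±1` of the two parts cannot add up to `0` or `±1`
        have hxB : x ∉ B := fun hxB => (hmix x hxB).1 hx1
        have e0 := hwind x fun hxc => hx1.1 (hc₁ hxc)
        have e1 := hw11 x hx1
        have e2 := hw21 x hx2
        rcases hcase B x with h1 | h1 | h1
        · exact hxB h1
        · have e3 := hw1 x h1
          rcases abs_eq (by positivity : (0:ℝ) ≤ 2 * Real.pi) |>.1 e1 with s1 | s1 <;>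
          rcases abs_eq (by positivity : (0:ℝ) ≤ 2 * Real.pi) |>.1 e2 with s2 | s2 <;>
          rcases abs_eq (by positivity : (0:ℝ) ≤ 2 * Real.pi) |>.1 e3 with s3 | s3 <;>
          rw [s1, s2, s3] at e0 <;> linarith
        · exact hdisj _ _ hx1 (hO₁ h1)

/-! ### Converse: partitions come from chords -/

theorem interior_segment_eq_empty (v w : Plane) : interior (segment ℝ v w) = ∅ := by
  obtain ⟨d, hd, hdv⟩ : ∃ d : Plane, d ≠ 0 ∧ ∀ x ∈ segment ℝ v w, det d (x - v) = 0 := by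
    by_cases h : w - v = 0
    · refine ⟨!₂[1, 0], fun h0 => ?_, fun x hx => ?_⟩
      · have := congrArg (fun y : Plane => y 0) h0
        simp at this
      · rw [sub_eq_zero.1 h, segment_same] at hx
        rw [hx, sub_self, det_zero_right]
    · exact ⟨w - v, h, fun x hx => det_of_mem_segment hx⟩
  rw [Set.eq_empty_iff_forall_notMem]
  intro x hx
  have h1 := (tendsto_add_smul_nhds x (rot d)).eventually (isOpen_interior.mem_nhds hx)
  obtain ⟨s, hs1, hs⟩ := (h1.and self_mem_nhdsWithin).exists
  have hs : 0 < s := hs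
  have h2 := hdv _ (interior_subset hs1)
  rw [add_sub_right_comm, det_add_right, hdv x (interior_subset hx), det_smul_right] at h2
  have := mul_pos hs (det_rot_pos hd)
  linarith

namespace InducesPartition

variable {P Q₁ Q₂ : Set Plane} {v w : Plane}

theorem symm (h : InducesPartition P v w Q₁ Q₂) : InducesPartition P v w Q₂ Q₁ :=
  ⟨h.1, h.2.1, h.2.2.1, h.2.2.2.2.1, h.2.2.2.1, by rw [Set.union_comm]; exact h.2.2.2.2.2.1,
    by rw [Set.inter_comm]; exact h.2.2.2.2.2.2⟩

theorem left (h : InducesPartition P v w Q₁ Q₂) : IsPolygon Q₁ := h.2.2.2.1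
theorem right (h : InducesPartition P v w Q₁ Q₂) : IsPolygon Q₂ := h.2.2.2.2.1
theorem union_eq (h : InducesPartition P v w Q₁ Q₂) : P = Q₁ ∪ Q₂ := h.2.2.2.2.2.1
theorem inter_eq (h : InducesPartition P v w Q₁ Q₂) : segment ℝ v w = Q₁ ∩ Q₂ := h.2.2.2.2.2.2
theorem left_subset (h : InducesPartition P v w Q₁ Q₂) : Q₁ ⊆ P :=
  h.union_eq ▸ Set.subset_union_left
theorem seg_left (h : InducesPartition P v w Q₁ Q₂) : segment ℝ v w ⊆ Q₁ :=
  h.inter_eq ▸ Set.inter_subset_left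

theorem segment_subset_frontier (h : InducesPartition P v w Q₁ Q₂) :
    segment ℝ v w ⊆ frontier Q₁ := by
  intro x hx
  rcases h.left.mem_interior_or_frontier (h.seg_left hx) with h1 | h1
  · exfalso
    have h2 := h.right.subset_closure_interior (h.symm.seg_left hx)
    obtain ⟨y, hy1, hy2⟩ := mem_closure_iff.1 h2 _ isOpen_interior h1
    have : y ∈ interior (segment ℝ v w) := by
      rw [h.inter_eq, interior_inter]; exact ⟨hy1, hy2⟩
    rw [interior_segment_eq_empty] at this
    exact this
  · exact h1

theorem isPreconnected_diff (h : InducesPartition P v w Q₁ Q₂) :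
    IsPreconnected (Q₁ \ segment ℝ v w) := by
  apply h.left.isPreconnected_interior.subset_closure
  · intro x hx
    exact ⟨interior_subset hx, fun hc => (h.segment_subset_frontier hc).2 hx⟩
  · exact fun x hx => h.left.subset_closure_interior hx.1

theorem mem_interior_of_notMem (h : InducesPartition P v w Q₁ Q₂) {x : Plane}
    (hx : x ∈ interior P) (hx2 : x ∉ Q₂) : x ∈ interior Q₁ := by
  have hop : IsOpen (interior P ∩ Q₂ᶜ) := isOpen_interior.inter h.right.isClosed.isOpen_compl
  refine interior_maximal ?_ hop ⟨hx, hx2⟩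
  rintro y ⟨hy1, hy2⟩
  have := interior_subset hy1
  rw [h.union_eq] at this
  exact this.resolve_right hy2

theorem ne (hP : IsPolygon P) (h : InducesPartition P v w Q₁ Q₂) : v ≠ w := by
  rintro rfl
  have hc := h.inter_eq
  rw [segment_same] at hc
  have key : ∀ {A B : Set Plane}, InducesPartition P v v A B → ¬ interior P ⊆ A := by
    intro A B hAB hsub
    have h1 : P ⊆ A := hP.subset_closure_interior.trans
      ((closure_mono hsub).trans hAB.left.isClosed.closure_eq.subset)
    have h2 : B ⊆ A ∩ B := fun x hx => ⟨h1 (hAB.symm.left_subset hx), hx⟩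
    rw [← hAB.inter_eq] at h2
    obtain ⟨x, hx⟩ := hAB.right.interior_nonempty
    have := interior_mono h2 hx
    rw [interior_segment_eq_empty] at this
    exact this
  rcases isPreconnected_iff_subset_of_disjoint_closed.1 hP.isPreconnected_interior Q₁ Q₂
    h.left.isClosed h.right.isClosed (h.union_eq ▸ interior_subset) (by
      rw [← hc, Set.eq_empty_iff_forall_notMem]
      rintro x ⟨hx, rfl⟩
      exact h.1.2 hx) with h1 | h1
  · exact key h h1
  · exact key h.symm h1

/-- Near an interior point of the cut, each of the two parts is a half-disc. -/
theorem halfPlane (hP : IsPolygon P) (h : InducesPartition P v w Q₁ Q₂) {e : Plane}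
    (he : e ∈ openSegment ℝ v w) :
    ∃ r > 0, ((∀ x ∈ Metric.ball e r, x ∈ Q₁ ↔ 0 ≤ det (w - v) (x - e)) ∧
        ∀ x ∈ Metric.ball e r, x ∈ Q₂ ↔ det (w - v) (x - e) ≤ 0) ∨
      ((∀ x ∈ Metric.ball e r, x ∈ Q₁ ↔ det (w - v) (x - e) ≤ 0) ∧
        ∀ x ∈ Metric.ball e r, x ∈ Q₂ ↔ 0 ≤ det (w - v) (x - e)) := by
  have hvw := h.ne hP
  have hd : w - v ≠ 0 := sub_ne_zero.2 hvw.symm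
  have hos := openSegment_subset_segment ℝ v w
  obtain ⟨r₁, hr₁, c₁⟩ := h.left.halfPlane hvw (hos.trans h.segment_subset_frontier) he
  obtain ⟨r₂, hr₂, c₂⟩ := h.right.halfPlane hvw (hos.trans h.symm.segment_subset_frontier) he
  have hb₁ : Metric.ball e (min r₁ r₂) ⊆ Metric.ball e r₁ :=
    Metric.ball_subset_ball (min_le_left _ _)
  have hb₂ : Metric.ball e (min r₁ r₂) ⊆ Metric.ball e r₂ :=
    Metric.ball_subset_ball (min_le_right _ _)
  have hr : 0 < min r₁ r₂ := lt_min hr₁ hr₂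
  refine ⟨min r₁ r₂, hr, ?_⟩
  have hside : ∀ s : ℝ, det (w - v) (e + s • rot (w - v) - e) = s * det (w - v) (rot (w - v)) := by
    intro s; rw [add_sub_cancel_left, det_smul_right]
  have hne : ∀ s : ℝ, s ≠ 0 → e + s • rot (w - v) ∉ segment ℝ v w := by
    intro s hs hmem
    have h1 := det_of_mem_segment hmem
    have h2 := det_of_mem_segment (hos he)
    rw [add_sub_right_comm, det_add_right, h2, zero_add, det_smul_right] at h1
    exact (mul_ne_zero hs (det_rot_pos hd).ne') h1
  have hev := (tendsto_add_smul_nhds e (rot (w - v))).eventually (Metric.ball_mem_nhds e hr)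
  have hev' := (tendsto_add_smul_nhds e (-rot (w - v))).eventually (Metric.ball_mem_nhds e hr)
  obtain ⟨s, ⟨hs1, hs2⟩, hs⟩ := ((hev.and hev').and self_mem_nhdsWithin).exists
  have hs : 0 < s := hs
  have hpos := mul_pos hs (det_rot_pos hd)
  have hs2' : e + (-s) • rot (w - v) ∈ Metric.ball e (min r₁ r₂) := by
    rwa [neg_smul, ← smul_neg]
  rcases c₁ with c₁ | c₁ <;> rcases c₂ with c₂ | c₂
  · exfalso
    apply hne s hs.ne'
    rw [h.inter_eq]
    exact ⟨(c₁ _ (hb₁ hs1)).2 (by rw [hside]; exact hpos.le),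
      (c₂ _ (hb₂ hs1)).2 (by rw [hside]; exact hpos.le)⟩
  · exact Or.inl ⟨fun x hx => c₁ x (hb₁ hx), fun x hx => c₂ x (hb₂ hx)⟩
  · exact Or.inr ⟨fun x hx => c₁ x (hb₁ hx), fun x hx => c₂ x (hb₂ hx)⟩
  · exfalso
    apply hne (-s) (by linarith)
    rw [h.inter_eq]
    exact ⟨(c₁ _ (hb₁ hs2')).2 (by rw [hside]; linarith),
      (c₂ _ (hb₂ hs2')).2 (by rw [hside]; linarith)⟩

theorem isChord (hP : IsPolygon P) (h : InducesPartition P v w Q₁ Q₂) : IsChord P v w := by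
  refine ⟨h.1, h.2.1, h.ne hP, fun e he => ?_⟩
  obtain ⟨r, hr, hc⟩ := h.halfPlane hP he
  rw [mem_interior_iff_mem_nhds]
  refine Filter.mem_of_superset (Metric.ball_mem_nhds e hr) fun x hx => ?_
  rw [h.union_eq]
  rcases le_total 0 (det (w - v) (x - e)) with h1 | h1
  · rcases hc with ⟨h2, h3⟩ | ⟨h2, h3⟩
    · exact Or.inl ((h2 x hx).2 h1)
    · exact Or.inr ((h3 x hx).2 h1)
  · rcases hc with ⟨h2, h3⟩ | ⟨h2, h3⟩
    · exact Or.inr ((h3 x hx).2 h1)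
    · exact Or.inl ((h2 x hx).2 h1)

end InducesPartition

/-! ### Separation -/

/-- The set `c` separates `x` from `y` in `P`. -/
def Separates (P c : Set Plane) (x y : Plane) : Prop :=
  ∀ S : Set Plane, IsPreconnected S → S ⊆ P → x ∈ S → y ∈ S → (S ∩ c).Nonempty

theorem Separates.symm {P c : Set Plane} {x y : Plane} (h : Separates P c x y) :
    Separates P c y x := fun S hS hSP hy hx => h S hS hSP hx hy

theorem separates_of_isClosed {P c A B : Set Plane} {x y : Plane} (hA : IsClosed A)
    (hB : IsClosed B) (hP : P ⊆ A ∪ B) (hc : A ∩ B ⊆ c) (hx : x ∈ A) (hy : y ∈ B) :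
    Separates P c x y := by
  intro S hS hSP hxS hyS
  obtain ⟨z, hzS, hz⟩ := isPreconnected_closed_iff.1 hS A B hA hB (hSP.trans hP) ⟨x, hxS, hx⟩
    ⟨y, hyS, hy⟩
  exact ⟨z, hzS, hc hz⟩

namespace InducesPartition

variable {P Q₁ Q₂ : Set Plane} {v w x y : Plane}

theorem separates (h : InducesPartition P v w Q₁ Q₂) (hx : x ∈ Q₁) (hy : y ∈ Q₂) :
    Separates P (segment ℝ v w) x y :=
  separates_of_isClosed h.left.isClosed h.right.isClosed h.union_eq.subset h.inter_eq.symm.subset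
    hx hy

theorem mem_of_separates (h : InducesPartition P v w Q₁ Q₂)
    (hs : Separates P (segment ℝ v w) x y) (hx : x ∈ P) (hy : y ∈ P)
    (hxc : x ∉ segment ℝ v w) (hyc : y ∉ segment ℝ v w) :
    (x ∈ Q₁ ∧ y ∈ Q₂) ∨ (x ∈ Q₂ ∧ y ∈ Q₁) := by
  have key : ∀ {A B : Set Plane}, InducesPartition P v w A B → x ∈ A → y ∈ A → False := by
    intro A B hAB hxA hyA
    obtain ⟨z, hz1, hz2⟩ := hs _ hAB.isPreconnected_diff (fun z hz => hAB.left_subset hz.1)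
      ⟨hxA, hxc⟩ ⟨hyA, hyc⟩
    exact hz1.2 hz2
  rw [h.union_eq] at hx hy
  rcases hx with hx | hx <;> rcases hy with hy | hy
  · exact (key h hx hy).elim
  · exact Or.inl ⟨hx, hy⟩
  · exact Or.inr ⟨hx, hy⟩
  · exact (key h.symm hx hy).elim

end InducesPartition

/-! ### Triangles -/

/-- The closed triangle with the given vertices (possibly degenerate). -/
def tri (a b c : Plane) : Set Plane := convexHull ℝ {a, b, c}

theorem convex_tri (a b c : Plane) : Convex ℝ (tri a b c) := convex_convexHull ℝ _

theorem tri_swap (a b c : Plane) : tri a b c = tri b a c := by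
  unfold tri; rw [Set.insert_comm]

theorem tri_swap' (a b c : Plane) : tri a b c = tri a c b := by
  unfold tri; rw [Set.pair_comm]

theorem left_mem_tri (a b c : Plane) : a ∈ tri a b c := subset_convexHull ℝ _ (by simp)
theorem mid_mem_tri (a b c : Plane) : b ∈ tri a b c := subset_convexHull ℝ _ (by simp)
theorem right_mem_tri (a b c : Plane) : c ∈ tri a b c := subset_convexHull ℝ _ (by simp)

theorem tri_subset {S : Set Plane} (hS : Convex ℝ S) {a b c : Plane} (ha : a ∈ S) (hb : b ∈ S)
    (hc : c ∈ S) : tri a b c ⊆ S := by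
  apply convexHull_min _ hS
  rintro x (rfl | rfl | rfl) <;> assumption

theorem isCompact_tri (a b c : Plane) : IsCompact (tri a b c) :=
  (Set.toFinite _).isCompact_convexHull ℝ

theorem mem_tri_iff {a b c x : Plane} : x ∈ tri a b c ↔
    ∃ s t : ℝ, 0 ≤ s ∧ 0 ≤ t ∧ s + t ≤ 1 ∧ x = a + s • (b - a) + t • (c - a) := by
  constructor
  · have hconv : Convex ℝ {x : Plane | ∃ s t : ℝ, 0 ≤ s ∧ 0 ≤ t ∧ s + t ≤ 1 ∧
        x = a + s • (b - a) + t • (c - a)} := by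
      rintro x ⟨s, t, hs, ht, hst, rfl⟩ y ⟨s', t', hs', ht', hst', rfl⟩ α β hα hβ hαβ
      refine ⟨α * s + β * s', α * t + β * t', by positivity, by positivity, ?_, ?_⟩
      · nlinarith
      · obtain rfl : α = 1 - β := by linarith
        module
    refine fun hx => tri_subset hconv ⟨0, 0, ?_⟩ ⟨1, 0, ?_⟩ ⟨0, 1, ?_⟩ hx <;> simp
  · rintro ⟨s, t, hs, ht, hst, rfl⟩
    have h1 := (convex_tri a b c).sum_mem (t := Finset.univ) (w := ![1 - s - t, s, t])
      (z := ![a, b, c]) (by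
        intro i _; fin_cases i
        · show (0:ℝ) ≤ 1 - s - t; linarith
        · exact hs
        · exact ht) (by simp [Fin.sum_univ_three]; ring) (by
        intro i _; fin_cases i
        · exact left_mem_tri a b c
        · exact mid_mem_tri a b c
        · exact right_mem_tri a b c)
    have e : a + s • (b - a) + t • (c - a) =
        ∑ i, (![1 - s - t, s, t] : Fin 3 → ℝ) i • (![a, b, c] : Fin 3 → Plane) i := by
      rw [Fin.sum_univ_three]
      show _ = (1 - s - t) • a + s • b + t • c
      module
    rw [e]
    exact h1

/-- The coefficient of `b - a` when `x - a` is written in terms of `b - a` and `c - a`. -/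
noncomputable def coordB (a b c x : Plane) : ℝ := det (x - a) (c - a) / det (b - a) (c - a)

/-- The coefficient of `c - a` when `x - a` is written in terms of `b - a` and `c - a`. -/
noncomputable def coordC (a b c x : Plane) : ℝ := det (b - a) (x - a) / det (b - a) (c - a)

section coord

variable {a b c : Plane}

theorem eq_coord (h : det (b - a) (c - a) ≠ 0) (x : Plane) :
    x = a + coordB a b c x • (b - a) + coordC a b c x • (c - a) := by
  have := cramer h (x - a)
  unfold coordB coordC
  rw [add_assoc, ← this]; abel

theorem coordB_eq (h : det (b - a) (c - a) ≠ 0) (s t : ℝ) :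
    coordB a b c (a + s • (b - a) + t • (c - a)) = s := by
  unfold coordB
  rw [add_assoc, add_sub_cancel_left, det_add_left, det_smul_left, det_smul_left, det_self]
  field_simp; ring

theorem coordC_eq (h : det (b - a) (c - a) ≠ 0) (s t : ℝ) :
    coordC a b c (a + s • (b - a) + t • (c - a)) = t := by
  unfold coordC
  rw [add_assoc, add_sub_cancel_left, det_add_right, det_smul_right, det_smul_right, det_self]
  field_simp; ring

@[fun_prop]
theorem continuous_coordB : Continuous (coordB a b c) := by
  unfold coordB; fun_prop

@[fun_prop]
theorem continuous_coordC : Continuous (coordC a b c) := by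
  unfold coordC; fun_prop

theorem mem_tri_coord (h : det (b - a) (c - a) ≠ 0) {x : Plane} : x ∈ tri a b c ↔
    0 ≤ coordB a b c x ∧ 0 ≤ coordC a b c x ∧ coordB a b c x + coordC a b c x ≤ 1 := by
  rw [mem_tri_iff]
  constructor
  · rintro ⟨s, t, hs, ht, hst, rfl⟩
    rw [coordB_eq h, coordC_eq h]; exact ⟨hs, ht, hst⟩
  · rintro ⟨h1, h2, h3⟩
    exact ⟨_, _, h1, h2, h3, eq_coord h x⟩

/-- The open triangle. -/
def openTri (a b c : Plane) : Set Plane :=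
  {x | 0 < coordB a b c x ∧ 0 < coordC a b c x ∧ coordB a b c x + coordC a b c x < 1}

theorem isOpen_openTri : IsOpen (openTri a b c) := by
  have h1 : IsOpen {x | 0 < coordB a b c x} := isOpen_lt (by fun_prop) (by fun_prop)
  have h2 : IsOpen {x | 0 < coordC a b c x} := isOpen_lt (by fun_prop) (by fun_prop)
  have h3 : IsOpen {x | coordB a b c x + coordC a b c x < 1} :=
    isOpen_lt (by fun_prop) (by fun_prop)
  exact h1.inter (h2.inter h3)

theorem openTri_subset (h : det (b - a) (c - a) ≠ 0) : openTri a b c ⊆ tri a b c := fun _ hx =>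
  (mem_tri_coord h).2 ⟨hx.1.le, hx.2.1.le, hx.2.2.le⟩

theorem mem_openTri (h : det (b - a) (c - a) ≠ 0) {s t : ℝ} (hs : 0 < s) (ht : 0 < t)
    (hst : s + t < 1) : a + s • (b - a) + t • (c - a) ∈ openTri a b c := by
  refine ⟨?_, ?_, ?_⟩
  · rwa [coordB_eq h]
  · rwa [coordC_eq h]
  · rwa [coordB_eq h, coordC_eq h]

theorem mem_sides_of_notMem_openTri (h : det (b - a) (c - a) ≠ 0) {x : Plane} (hx : x ∈ tri a b c)
    (hxo : x ∉ openTri a b c) : x ∈ segment ℝ a b ∨ x ∈ segment ℝ a c ∨ x ∈ segment ℝ c b := by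
  obtain ⟨h1, h2, h3⟩ := (mem_tri_coord h).1 hx
  have he := eq_coord h x
  set s := coordB a b c x
  set t := coordC a b c x
  rcases h1.eq_or_lt with h4 | h4
  · right; left
    rw [segment_eq_image']
    refine ⟨t, ⟨h2, by linarith⟩, ?_⟩
    simp only
    rw [he, ← h4]; module
  · rcases h2.eq_or_lt with h5 | h5
    · left
      rw [segment_eq_image']
      refine ⟨s, ⟨h1, by linarith⟩, ?_⟩
      simp only
      rw [he, ← h5]; module
    · right; right
      have h6 : s + t = 1 := by
        by_contra hne
        exact hxo ⟨h4, h5, lt_of_le_of_ne h3 hne⟩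
      rw [segment_eq_image']
      refine ⟨s, ⟨h1, by linarith⟩, ?_⟩
      simp only
      obtain h7 : t = 1 - s := by linarith
      rw [he, h7]; module

theorem segment_subset_tri_left : segment ℝ a b ⊆ tri a b c :=
  (convex_tri a b c).segment_subset (left_mem_tri a b c) (mid_mem_tri a b c)

theorem det_ne_zero_of_openSegment (h : det (b - a) (c - a) ≠ 0) {x : Plane}
    (hx : x ∈ openSegment ℝ a c) : det (b - a) (x - a) ≠ 0 := by
  rw [openSegment_eq_image'] at hx
  obtain ⟨m, ⟨hm0, hm1⟩, rfl⟩ := hx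
  simp only
  rw [add_sub_cancel_left, det_smul_right]
  exact mul_ne_zero hm0.ne' h

theorem det_cyc (a b c : Plane) : det (b - a) (c - a) = det (c - b) (a - b) := by
  simp [det]; ring

theorem det_swap_base (a b c : Plane) : det (a - b) (c - b) = -det (b - a) (c - a) := by
  simp [det]; ring

end coord

/-! ### Passing from one chord to another across a triangle -/

/-- The segment from `a` to `b` either passes through the interior of `P` or is contained in its
boundary. -/
def SideOK (P : Set Plane) (a b : Plane) : Prop :=
  openSegment ℝ a b ⊆ interior P ∨ segment ℝ a b ⊆ frontier P

/-- The triangle on the chord from `v` to `w` with apex `u` is contained in `P`, and its other two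
sides are chords or parts of the boundary. -/
def NiceTri (P : Set Plane) (v w u : Plane) : Prop :=
  det (w - v) (u - v) ≠ 0 ∧ tri v w u ⊆ P ∧ SideOK P v u ∧ SideOK P u w

/-- A triangle that is contained in one side of a partition, except for the cut. -/
theorem InducesPartition.tri_subset {P Q₁ Q₂ : Set Plane} {a b c : Plane}
    (h : InducesPartition P a b Q₁ Q₂) (hd : det (b - a) (c - a) ≠ 0) (hT : tri a b c ⊆ P) :
    tri a b c ⊆ Q₁ ∨ tri a b c ⊆ Q₂ := by
  set S : Set Plane := tri a b c \ segment ℝ a b with hS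
  have hSeq : S = tri a b c ∩ {x | 0 < coordC a b c x} := by
    ext x
    constructor
    · rintro ⟨h1, h2⟩
      refine ⟨h1, lt_of_le_of_ne ((mem_tri_coord hd).1 h1).2.1 fun h0 => h2 ?_⟩
      rw [segment_eq_image']
      have he := eq_coord hd x
      rw [← h0] at he
      obtain ⟨h3, h4, h5⟩ := (mem_tri_coord hd).1 h1
      refine ⟨_, ⟨h3, by linarith⟩, ?_⟩
      simp only
      rw [zero_smul, add_zero] at he
      exact he.symm
    · rintro ⟨h1, h2⟩
      refine ⟨h1, fun h3 => ?_⟩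
      have h2 : 0 < coordC a b c x := h2
      rw [coordC, det_of_mem_segment h3, zero_div] at h2
      exact lt_irrefl _ h2
  have hconv : Convex ℝ S := by
    rw [hSeq]
    apply (convex_tri a b c).inter
    intro x hx y hy α β hα hβ hαβ
    have hx : 0 < coordC a b c x := hx
    have hy : 0 < coordC a b c y := hy
    show 0 < coordC a b c (α • x + β • y)
    have : coordC a b c (α • x + β • y) = α * coordC a b c x + β * coordC a b c y := by
      unfold coordC
      have e : α • x + β • y - a = α • (x - a) + β • (y - a) := by
        obtain rfl : α = 1 - β := by linarith
        module
      rw [e, det_add_right, det_smul_right, det_smul_right]; ring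
    rw [this]
    rcases hα.eq_or_lt with rfl | hα
    · have : β = 1 := by linarith
      rw [this]; linarith
    · have := mul_pos hα hx
      have := mul_nonneg hβ hy.le
      linarith
  have key : ∀ {A B : Set Plane}, InducesPartition P a b A B → S ⊆ A → tri a b c ⊆ A := by
    intro A B hAB hSA x hx
    by_cases hxs : x ∈ segment ℝ a b
    · exact hAB.seg_left hxs
    · exact hSA ⟨hx, hxs⟩
  rcases isPreconnected_iff_subset_of_disjoint_closed.1 hconv.isPreconnected Q₁ Q₂
    h.left.isClosed h.right.isClosed (h.union_eq ▸ fun x hx => hT hx.1) (by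
      rw [← h.inter_eq, Set.eq_empty_iff_forall_notMem]
      rintro x ⟨hx, hxs⟩
      exact hx.2 hxs) with h1 | h1
  · exact Or.inl (key h h1)
  · exact Or.inr (key h.symm h1)

/-- Cutting off the part of a polygon `Q` behind a side of a triangle contained in `Q`. -/
theorem exists_cut {Q : Set Plane} (hQ : IsPolygon Q) {a b c : Plane}
    (hd : det (b - a) (c - a) ≠ 0) (hT : tri a b c ⊆ Q) (ha : a ∈ frontier Q)
    (hb : b ∈ frontier Q) (hs : SideOK Q a b) :
    ∃ A Q' : Set Plane, IsClosed A ∧ IsPolygon Q' ∧ Q = A ∪ Q' ∧ A ∩ Q' ⊆ segment ℝ a b ∧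
      tri a b c ⊆ Q' ∧ segment ℝ a b ⊆ frontier Q' ∧
      (∀ z ∈ interior Q, z ∉ A → z ∈ interior Q') ∧ (A \ segment ℝ a b ≠ ∅ → IsChord Q a b) := by
  have hab : a ≠ b := by
    rintro rfl
    rw [sub_self, det_zero_left] at hd
    exact hd rfl
  rcases hs with hs | hs
  · have hch : IsChord Q a b := ⟨ha, hb, hab, hs⟩
    have key : ∀ {A B : Set Plane}, InducesPartition Q a b A B → tri a b c ⊆ B →
        ∃ A Q' : Set Plane, IsClosed A ∧ IsPolygon Q' ∧ Q = A ∪ Q' ∧ A ∩ Q' ⊆ segment ℝ a b ∧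
          tri a b c ⊆ Q' ∧ segment ℝ a b ⊆ frontier Q' ∧
          (∀ z ∈ interior Q, z ∉ A → z ∈ interior Q') ∧
          (A \ segment ℝ a b ≠ ∅ → IsChord Q a b) := by
      intro A B hAB hTB
      exact ⟨A, B, hAB.left.isClosed, hAB.right, hAB.union_eq, hAB.inter_eq.symm.subset, hTB,
        hAB.symm.segment_subset_frontier, fun z hz hzA => hAB.symm.mem_interior_of_notMem hz hzA,
        fun _ => hch⟩
    obtain ⟨Q₁, Q₂, hpart⟩ := hch.exists_partition hQ
    rcases hpart.tri_subset hd hT with h1 | h1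
    · exact key hpart.symm h1
    · exact key hpart h1
  · refine ⟨segment ℝ a b, Q, isClosed_segment a b, hQ, ?_, Set.inter_subset_left, hT, hs,
      fun z hz _ => hz, fun h => absurd (Set.sdiff_self) h⟩
    exact (Set.union_eq_self_of_subset_left (hs.trans hQ.frontier_subset)).symm

theorem mem_frontier_of_subset {Q Q' : Set Plane} (hQ' : IsPolygon Q') (h : Q' ⊆ Q) {z : Plane}
    (hz : z ∈ Q') (hzF : z ∈ frontier Q) : z ∈ frontier Q' := by
  rcases hQ'.mem_interior_or_frontier hz with h1 | h1
  · exact absurd (interior_mono h h1) hzF.2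
  · exact h1

theorem sideOK_of_subset {Q Q' : Set Plane} {a b : Plane} (hQ' : IsPolygon Q') (h : Q' ⊆ Q)
    (hs : SideOK Q a b) (hab : segment ℝ a b ⊆ Q')
    (hint : ∀ z ∈ openSegment ℝ a b, z ∈ interior Q → z ∈ interior Q') : SideOK Q' a b := by
  rcases hs with hs | hs
  · exact Or.inl fun z hz => hint z hz (hs hz)
  · exact Or.inr fun z hz => mem_frontier_of_subset hQ' h (hab hz) (hs hz)

/-- A polygon that contains a triangle and has the sides of the triangle in its boundary is equal
to the triangle. -/
theorem subset_tri_of_sides {Q : Set Plane} (hQ : IsPolygon Q) {a b c : Plane}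
    (hd : det (b - a) (c - a) ≠ 0) (hT : tri a b c ⊆ Q) (hab : segment ℝ a b ⊆ frontier Q)
    (hac : segment ℝ a c ⊆ frontier Q) (hcb : segment ℝ c b ⊆ frontier Q) : Q ⊆ tri a b c := by
  have hcl := (isCompact_tri a b c).isClosed
  have h1 : interior Q ⊆ openTri a b c ∨ interior Q ⊆ (tri a b c)ᶜ := by
    apply hQ.isPreconnected_interior.subset_or_subset isOpen_openTri hcl.isOpen_compl
    · exact Set.disjoint_left.2 fun x hx hx' => hx' (openTri_subset hd hx)
    · intro x hx
      by_cases hxT : x ∈ tri a b c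
      · left
        by_contra hxo
        rcases mem_sides_of_notMem_openTri hd hxT hxo with h2 | h2 | h2
        · exact (hab h2).2 hx
        · exact (hac h2).2 hx
        · exact (hcb h2).2 hx
      · exact Or.inr hxT
  rcases h1 with h1 | h1
  · exact hQ.subset_closure_interior.trans
      ((closure_mono (h1.trans (openTri_subset hd))).trans hcl.closure_eq.subset)
  · exfalso
    have h2 : openTri a b c ⊆ interior Q :=
      interior_maximal ((openTri_subset hd).trans hT) isOpen_openTri
    have h3 := mem_openTri hd (s := 1 / 3) (t := 1 / 3) (by norm_num) (by norm_num) (by norm_num)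
    exact h1 (h2 h3) (openTri_subset hd h3)

/-- One part of `P` is cut along the two other sides of the triangle successively. What then remains
of it is the triangle itself, so that `x` lies behind one of these sides. -/
theorem transition_aux {P Q₁ Q₂ : Set Plane} {v w u x y : Plane}
    (h : InducesPartition P v w Q₁ Q₂) (hu : u ∈ frontier P)
    (hn : NiceTri P v w u) (hT : tri v w u ⊆ Q₁) (hx : x ∈ Q₁) (hy : y ∈ Q₂)
    (hxT : x ∉ tri v w u) :
    (IsChord P v u ∧ Separates P (segment ℝ v u) x y) ∨
      (IsChord P u w ∧ Separates P (segment ℝ u w) x y) := by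
  obtain ⟨hd, -, hs₁, hs₂⟩ := hn
  have hQ₁P := h.left_subset
  have hTQ₂ : ∀ z ∈ tri v w u, z ∈ Q₂ → z ∈ segment ℝ v w := fun z hz hz2 => by
    rw [h.inter_eq]; exact ⟨hT hz, hz2⟩
  have hdet0 : ∀ z ∈ segment ℝ v w, det (w - v) (z - v) = 0 := fun z hz => det_of_mem_segment hz
  have hd' : det (u - v) (w - v) ≠ 0 := by rw [det_swap]; exact neg_ne_zero.2 hd
  have hd'' : det (w - u) (v - u) ≠ 0 := by rw [← det_cyc]; exact hd'
  have hsvu : segment ℝ v u ⊆ tri v w u :=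
    (convex_tri _ _ _).segment_subset (left_mem_tri _ _ _) (right_mem_tri _ _ _)
  have hsuw : segment ℝ u w ⊆ tri v w u :=
    (convex_tri _ _ _).segment_subset (right_mem_tri _ _ _) (mid_mem_tri _ _ _)
  have hsvw : segment ℝ v w ⊆ tri v w u := segment_subset_tri_left
  have hvF : v ∈ frontier Q₁ := h.segment_subset_frontier (left_mem_segment ℝ _ _)
  have hwF : w ∈ frontier Q₁ := h.segment_subset_frontier (right_mem_segment ℝ _ _)
  have huF : u ∈ frontier Q₁ := mem_frontier_of_subset h.left hQ₁P (hT (right_mem_tri _ _ _)) hu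
  have hopen₁ : ∀ z ∈ openSegment ℝ v u, det (w - v) (z - v) ≠ 0 := fun z hz =>
    det_ne_zero_of_openSegment hd hz
  have hopen₂ : ∀ z ∈ openSegment ℝ u w, z ∉ segment ℝ v w ∧ z ∉ segment ℝ v u := by
    intro z hz
    rw [openSegment_eq_image'] at hz
    obtain ⟨m, ⟨hm0, hm1⟩, rfl⟩ := hz
    have e1 : u + m • (w - u) - v = (1 - m) • (u - v) + m • (w - v) := by module
    constructor
    · intro hmem
      have := hdet0 _ hmem
      rw [e1, det_add_right, det_smul_right, det_smul_right, det_self, mul_zero, add_zero] at this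
      exact mul_ne_zero (by linarith) hd this
    · intro hmem
      have := det_of_mem_segment hmem
      rw [e1, det_add_right, det_smul_right, det_smul_right, det_self, mul_zero, zero_add] at this
      exact mul_ne_zero hm0.ne' hd' this
  have hs₁' : SideOK Q₁ v u := sideOK_of_subset h.left hQ₁P hs₁ (hsvu.trans hT) fun z hz hzi =>
    h.mem_interior_of_notMem hzi fun hz2 =>
      hopen₁ z hz (hdet0 z (hTQ₂ z (hsvu (openSegment_subset_segment ℝ _ _ hz)) hz2))
  have hs₂' : SideOK Q₁ u w := sideOK_of_subset h.left hQ₁P hs₂ (hsuw.trans hT) fun z hz hzi =>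
    h.mem_interior_of_notMem hzi fun hz2 =>
      (hopen₂ z hz).1 (hTQ₂ z (hsuw (openSegment_subset_segment ℝ _ _ hz)) hz2)
  obtain ⟨A, Q', hA, hQ', hAQ', hAint, hTQ', hF', hint', hAch⟩ := exists_cut h.left hd'
    (by rw [tri_swap']; exact hT) hvF huF hs₁'
  rw [tri_swap'] at hTQ'
  have hQ'Q₁ : Q' ⊆ Q₁ := hAQ' ▸ Set.subset_union_right
  have huF' : u ∈ frontier Q' := hF' (right_mem_segment ℝ _ _)
  have hwF' : w ∈ frontier Q' := mem_frontier_of_subset hQ' hQ'Q₁ (hTQ' (mid_mem_tri _ _ _)) hwF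
  have hs₂'' : SideOK Q' u w := sideOK_of_subset hQ' hQ'Q₁ hs₂' (hsuw.trans hTQ')
    fun z hz hzi => hint' z hzi fun hzA => (hopen₂ z hz).2
      (hAint ⟨hzA, hTQ' (hsuw (openSegment_subset_segment ℝ _ _ hz))⟩)
  have hTuw : tri u w v = tri v w u := by rw [tri_swap, tri_swap', tri_swap]
  obtain ⟨B, Q'', hB, hQ'', hBQ'', hBint, hTQ'', hF'', hint'', hBch⟩ := exists_cut hQ' hd''
    (by rw [hTuw]; exact hTQ') huF' hwF' hs₂''
  rw [hTuw] at hTQ''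
  have hQ''Q' : Q'' ⊆ Q' := hBQ'' ▸ Set.subset_union_right
  have hfin : Q'' ⊆ tri v w u := by
    apply subset_tri_of_sides hQ'' hd hTQ''
    · exact fun z hz => mem_frontier_of_subset hQ'' (hQ''Q'.trans hQ'Q₁) (hTQ'' (hsvw hz))
        (h.segment_subset_frontier hz)
    · exact fun z hz => mem_frontier_of_subset hQ'' hQ''Q' (hTQ'' (hsvu hz)) (hF' hz)
    · exact hF''
  have hAP : A ⊆ Q₁ := hAQ' ▸ Set.subset_union_left
  have hBQ' : B ⊆ Q' := hBQ'' ▸ Set.subset_union_left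
  have hAQ₂ : A ∩ Q₂ ⊆ segment ℝ v u := fun z hz => by
    have h1 : z ∈ segment ℝ v w := by rw [h.inter_eq]; exact ⟨hAP hz.1, hz.2⟩
    exact hAint ⟨hz.1, hTQ' (hsvw h1)⟩
  have hBQ₂ : B ∩ Q₂ ⊆ segment ℝ u w := fun z hz => by
    have h1 : z ∈ segment ℝ v w := by rw [h.inter_eq]; exact ⟨hQ'Q₁ (hBQ' hz.1), hz.2⟩
    exact hBint ⟨hz.1, hTQ'' (hsvw h1)⟩
  have hBA : B ∩ A ⊆ segment ℝ u w := fun z hz =>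
    hBint ⟨hz.1, hTQ'' (hsvu (hAint ⟨hz.2, hBQ' hz.1⟩))⟩
  have hvu : v ≠ u := by
    rintro rfl
    rw [sub_self, det_zero_right] at hd
    exact hd rfl
  have huw : u ≠ w := by
    rintro rfl
    rw [det_self] at hd
    exact hd rfl
  rw [hAQ'] at hx
  rcases hx with hx | hx
  · left
    refine ⟨?_, ?_⟩
    · obtain ⟨-, -, -, h1⟩ := hAch (Set.nonempty_iff_ne_empty.1 ⟨x, hx, fun hs => hxT (hsvu hs)⟩)
      exact ⟨h.1, hu, hvu, h1.trans (interior_mono hQ₁P)⟩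
    · refine separates_of_isClosed hA (hQ'.isClosed.union h.right.isClosed) ?_ ?_ hx
        (Or.inr hy)
      · rw [h.union_eq, hAQ', Set.union_assoc]
      · rw [Set.inter_union_distrib_left]
        exact Set.union_subset hAint hAQ₂
  · rw [hBQ''] at hx
    rcases hx with hx | hx
    · right
      refine ⟨?_, ?_⟩
      · obtain ⟨-, -, -, h1⟩ := hBch
          (Set.nonempty_iff_ne_empty.1 ⟨x, hx, fun hs => hxT (hsuw hs)⟩)
        exact ⟨hu, h.2.1, huw, h1.trans ((interior_mono hQ'Q₁).trans (interior_mono hQ₁P))⟩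
      · refine separates_of_isClosed hB ((hQ''.isClosed.union hA).union h.right.isClosed) ?_ ?_ hx
          (Or.inr hy)
        · rw [h.union_eq, hAQ', hBQ'']
          rintro z ((hz | hz | hz) | hz)
          · exact Or.inr (Or.inl (Or.inr hz))
          · exact Or.inl hz
          · exact Or.inr (Or.inl (Or.inl hz))
          · exact Or.inr (Or.inr hz)
        · rw [Set.inter_union_distrib_left, Set.inter_union_distrib_left]
          exact Set.union_subset (Set.union_subset hBint hBA) hBQ₂
    · exact absurd (hfin hx) hxT

/-- If a chord separates `x` and `y`, then so does one of the other sides of a nice triangle. -/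
theorem IsChord.transition {P : Set Plane} (hP : IsPolygon P) {v w u x y : Plane}
    (hc : IsChord P v w) (hs : Separates P (segment ℝ v w) x y) (hx : x ∈ P) (hy : y ∈ P)
    (hu : u ∈ frontier P) (hn : NiceTri P v w u) (hxT : x ∉ tri v w u) (hyT : y ∉ tri v w u) :
    (IsChord P v u ∧ Separates P (segment ℝ v u) x y) ∨
      (IsChord P u w ∧ Separates P (segment ℝ u w) x y) := by
  obtain ⟨Q₁, Q₂, hpart⟩ := hc.exists_partition hP
  have key : ∀ {A B : Set Plane}, InducesPartition P v w A B → tri v w u ⊆ A →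
      (IsChord P v u ∧ Separates P (segment ℝ v u) x y) ∨
      (IsChord P u w ∧ Separates P (segment ℝ u w) x y) := by
    intro A B hAB hTA
    rcases hAB.mem_of_separates hs hx hy (fun h => hxT (segment_subset_tri_left h))
      (fun h => hyT (segment_subset_tri_left h)) with ⟨h1, h2⟩ | ⟨h1, h2⟩
    · exact transition_aux hAB hu hn hTA h1 h2 hxT
    · rcases transition_aux hAB hu hn hTA h2 h1 hyT with h3 | h3
      · exact Or.inl ⟨h3.1, h3.2.symm⟩
      · exact Or.inr ⟨h3.1, h3.2.symm⟩
  rcases hpart.tri_subset hn.1 hn.2.1 with h1 | h1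
  · exact key hpart h1
  · exact key hpart.symm h1

/-! ### Contacts of segments with the boundary -/

open Filter Topology in
/-- A continuous path that starts in a closed set and ends outside of it has a last time in it. -/
theorem exists_last_mem {F : Set Plane} (hF : IsClosed F) {g : ℝ → Plane} (hg : Continuous g)
    {s t : ℝ} (hst : s ≤ t) (hs : g s ∈ F) (ht : g t ∉ F) :
    ∃ r, s ≤ r ∧ r < t ∧ g r ∈ F ∧ ∀ r' ∈ Set.Ioc r t, g r' ∉ F := by
  have hcomp : IsCompact (Set.Icc s t ∩ g ⁻¹' F) := isCompact_Icc.inter_right (hF.preimage hg)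
  obtain ⟨r, ⟨⟨h1, h2⟩, h3⟩, h4⟩ := hcomp.exists_isGreatest ⟨s, ⟨le_rfl, hst⟩, hs⟩
  refine ⟨r, h1, lt_of_le_of_ne h2 ?_, h3, fun r' hr' hmem => ?_⟩
  · rintro rfl
    exact ht h3
  · exact absurd (h4 ⟨⟨h1.trans hr'.1.le, hr'.2⟩, hmem⟩) (not_le.2 hr'.1)

open Filter Topology in
/-- The last point at which the segment touches the boundary before entering the interior is a concave
vertex. -/
theorem IsPolygon.exists_concave_aux {P : Set Plane} (hP : IsPolygon P) {a b : Plane}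
    (h : segment ℝ a b ⊆ P) {s t : ℝ} (hs0 : 0 < s) (hst : s ≤ t) (ht1 : t < 1)
    (hs : AffineMap.lineMap a b s ∈ frontier P) (ht : AffineMap.lineMap a b t ∉ frontier P) :
    ∃ e ∈ concaveVertices P, e ∈ openSegment ℝ a b := by
  have hg : Continuous (fun t : ℝ => (AffineMap.lineMap a b t : Plane)) :=
    AffineMap.lineMap_continuous
  obtain ⟨r, h1, h2, h3, h4⟩ := exists_last_mem isClosed_frontier hg hst hs ht
  have hmem : ∀ q : ℝ, 0 ≤ q → q ≤ 1 → (AffineMap.lineMap a b q : Plane) ∈ P := fun q hq0 hq1 =>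
    h (by rw [segment_eq_image_lineMap]; exact ⟨q, ⟨hq0, hq1⟩, rfl⟩)
  have e : ∀ q : ℝ, (AffineMap.lineMap a b r : Plane) + q • (b - a) = AffineMap.lineMap a b (r + q) :=
    fun q => by simp only [AffineMap.lineMap_apply_module']; module
  refine ⟨_, hP.mem_concaveVertices (τ := b - a) h3 ?_ ?_, ?_⟩
  · filter_upwards [Ioo_mem_nhdsGT (sub_pos.2 h2)] with q hq
    rw [e]
    rcases hP.mem_interior_or_frontier (hmem (r + q) (by linarith [hq.1]) (by linarith [hq.2])) with
      h5 | h5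
    · exact h5
    · exact absurd h5 (h4 _ ⟨by linarith [hq.1], by linarith [hq.2]⟩)
  · filter_upwards [Ioo_mem_nhdsGT (hs0.trans_le h1)] with q hq
    rw [sub_eq_add_neg, ← neg_smul, e]
    exact hmem _ (by linarith [hq.2]) (by linarith [hq.1])
  · rw [openSegment_eq_image_lineMap]
    exact ⟨r, ⟨hs0.trans_le h1, h2.trans ht1⟩, rfl⟩

/-- A segment in a polygon that meets both the interior and the boundary between its endpoints
passes through a concave vertex. -/
theorem IsPolygon.sideOK_or {P : Set Plane} (hP : IsPolygon P) {a b : Plane}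
    (h : segment ℝ a b ⊆ P) :
    SideOK P a b ∨ ∃ e ∈ concaveVertices P, e ∈ openSegment ℝ a b := by
  by_cases h1 : ∃ x ∈ openSegment ℝ a b, x ∈ frontier P
  · by_cases h2 : ∃ x ∈ openSegment ℝ a b, x ∉ frontier P
    · right
      obtain ⟨x, hx, hxF⟩ := h1
      obtain ⟨y, hy, hyF⟩ := h2
      have hx' := hx
      have hy' := hy
      rw [openSegment_eq_image_lineMap] at hx' hy'
      obtain ⟨s, ⟨hs0, hs1⟩, rfl⟩ := hx'
      obtain ⟨t, ⟨ht0, ht1⟩, rfl⟩ := hy'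
      rcases le_total s t with hst | hst
      · exact hP.exists_concave_aux h hs0 hst ht1 hxF hyF
      · rw [openSegment_symm]
        rw [← AffineMap.lineMap_apply_one_sub] at hxF hyF
        rw [segment_symm] at h
        exact hP.exists_concave_aux h (by linarith) (by linarith) (by linarith) hxF hyF
    · push Not at h2
      left; right
      rw [← closure_openSegment]
      exact closure_minimal h2 isClosed_frontier
  · left; left
    push Not at h1
    intro x hx
    rcases hP.mem_interior_or_frontier (h (openSegment_subset_segment ℝ _ _ hx)) with h2 | h2
    · exact h2
    · exact absurd h2 (h1 x hx)

/-- The contacts of the segment from `p` to an interior point are concave vertices. -/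
theorem IsPolygon.openSegment_subset_or {P : Set Plane} (hP : IsPolygon P) {a b : Plane}
    (h : segment ℝ a b ⊆ P) (hb : b ∉ frontier P) :
    openSegment ℝ a b ⊆ interior P ∨ ∃ e ∈ concaveVertices P, e ∈ openSegment ℝ a b := by
  rcases hP.sideOK_or h with (h1 | h1) | h1
  · exact Or.inl h1
  · exact absurd (h1 (right_mem_segment ℝ _ _)) hb
  · exact Or.inr h1

/-! ### Visible concave vertices in triangles -/

theorem eventually_add_smul_mem {S : Set Plane} {u τ : Plane} (h : S ∈ nhds u) :
    ∀ᶠ s in nhdsWithin (0 : ℝ) (Set.Ioi 0), u + s • τ ∈ S :=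
  (tendsto_add_smul_nhds u τ).eventually h

theorem notMem_closure_diff_of_eventually {T P : Set Plane} {u : Plane}
    (h : ∀ᶠ x in nhds u, x ∈ T → x ∈ P) : u ∉ closure (T \ P) := by
  intro hu
  obtain ⟨x, hx1, hx2⟩ := (mem_closure_iff_frequently.1 hu |>.and_eventually h).exists
  exact hx1.2 (hx2 hx1.1)

/-- If both directions `d`, `-d` and a direction `d'` lead from a boundary point `u` into `P` and if
`u` is not a concave vertex, then `P` contains a half-disc around `u`. -/
theorem IsPolygon.eventually_halfDisc {P : Set Plane} (hP : IsPolygon P) {u d d' : Plane}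
    (hu : u ∈ frontier P) (huc : u ∉ concaveVertices P)
    (h1 : ∀ᶠ s in nhdsWithin (0 : ℝ) (Set.Ioi 0), u + s • d ∈ P)
    (h2 : ∀ᶠ s in nhdsWithin (0 : ℝ) (Set.Ioi 0), u - s • d ∈ P)
    (h3 : ∀ᶠ s in nhdsWithin (0 : ℝ) (Set.Ioi 0), u + s • d' ∈ P) :
    ∃ ε > 0, ∀ α β : ℝ, 0 ≤ β → |α| + β ≤ ε → u + α • d + β • d' ∈ P := by
  obtain ⟨r, hr, hconv⟩ := hP.exists_convex_inter_ball hu huc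
  have hb : Metric.ball u r ∈ nhds u := Metric.ball_mem_nhds u hr
  have h4 := eventually_add_smul_mem (τ := d) hb
  have h5 := eventually_add_smul_mem (τ := -d) hb
  have h6 := eventually_add_smul_mem (τ := d') hb
  obtain ⟨ε, ⟨⟨⟨e1, e2⟩, e3⟩, e4, e5, e6⟩, hε⟩ :=
    ((((h1.and h2).and h3).and (h4.and (h5.and h6))).and self_mem_nhdsWithin).exists
  have hε : 0 < ε := hε
  rw [smul_neg, ← sub_eq_add_neg] at e5
  have hT : tri (u + ε • d) (u - ε • d) (u + ε • d') ⊆ P ∩ Metric.ball u r :=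
    tri_subset hconv ⟨e1, e4⟩ ⟨e2, e5⟩ ⟨e3, e6⟩
  refine ⟨ε, hε, fun α β hβ hαβ => (hT ?_).1⟩
  have h7 := abs_nonneg α
  have h8 := le_abs_self α
  have h9 := neg_abs_le α
  refine mem_tri_iff.2 ⟨(1 - β / ε - α / ε) / 2, β / ε, ?_, by positivity, ?_, ?_⟩
  · have : 0 ≤ 1 - β / ε - α / ε := by
      rw [sub_sub, ← add_div, sub_nonneg, div_le_one hε]; linarith
    linarith
  · have : β / ε - α / ε ≤ 1 := by
      rw [← sub_div, div_le_one hε]; linarith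
    linarith
  · have e1 : u + ε • d + ((1 - β / ε - α / ε) / 2) • (u - ε • d - (u + ε • d)) +
        (β / ε) • (u + ε • d' - (u + ε • d)) = u + (α / ε * ε) • d + (β / ε * ε) • d' := by
      module
    rw [e1, div_mul_cancel₀ _ hε.ne', div_mul_cancel₀ _ hε.ne']

/-- Let `[v; p]` be a part of a chord, and let `z` be visible from `p`. If the triangle
`v p z` is not contained in `P`, consider the points in the closure of the missing part that are
farthest from the line through `v` and `z`. Among these, the one closest to `[v; p]` is a concave
vertex, and it is visible from `p`. -/
theorem IsPolygon.exists_concave_of_not_tri_subset {P : Set Plane} (hP : IsPolygon P) {v p z : Plane}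
    (hvp : openSegment ℝ v p ⊆ interior P) (hpz : segment ℝ p z ⊆ P)
    (hd : det (p - v) (z - v) ≠ 0) (hloc : ∀ᶠ x in nhds p, x ∈ tri v p z → x ∈ P)
    (hnot : ¬ tri v p z ⊆ P) :
    ∃ u ∈ concaveVertices P, segment ℝ p u ⊆ P ∧
      ∃ m t : ℝ, 0 < m ∧ 0 < t ∧ m + t ≤ 1 ∧ u = v + m • (p - v) + t • (z - v) := by
  set T := tri v p z with hTdef
  set K := closure (T \ P) with hK
  have hKT : K ⊆ T := closure_minimal Set.sdiff_subset (isCompact_tri _ _ _).isClosed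
  have hKc : IsCompact K := (isCompact_tri v p z).of_isClosed_subset isClosed_closure hKT
  obtain ⟨x₀, hx₀T, hx₀P⟩ := Set.not_subset.1 hnot
  have hconvT : Convex ℝ T := convex_tri _ _ _
  -- the point of `K` with largest first coordinate, and then smallest second coordinate
  obtain ⟨y₁, hy₁, hmax⟩ := hKc.exists_isMaxOn ⟨x₀, subset_closure ⟨hx₀T, hx₀P⟩⟩
    (continuous_coordB (a := v) (b := p) (c := z)).continuousOn
  set m := coordB v p z y₁ with hm
  have hK₂ : IsCompact (K ∩ {x | coordB v p z x = m}) :=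
    hKc.inter_right (isClosed_eq continuous_coordB continuous_const)
  obtain ⟨u, ⟨huK, hus⟩, hmin⟩ := hK₂.exists_isMinOn ⟨y₁, hy₁, rfl⟩
    (continuous_coordC (a := v) (b := p) (c := z)).continuousOn
  have hus : coordB v p z u = m := hus
  set t' := coordC v p z u with ht'
  have huT := hKT huK
  obtain ⟨hm0, ht0, hmt⟩ := (mem_tri_coord hd).1 huT
  have hu := eq_coord hd u
  rw [hus] at hm0 hmt hu
  rw [← ht'] at ht0 hmt hu
  have hpT : p ∈ T := mid_mem_tri _ _ _
  have hpcoord : coordB v p z p = 1 := by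
    have := coordB_eq hd 1 0
    rwa [one_smul, zero_smul, add_zero, add_sub_cancel] at this
  have hlin : ∀ x y : Plane, ∀ c : ℝ, coordB v p z (x + c • (y - x)) =
      coordB v p z x + c * (coordB v p z y - coordB v p z x) := by
    intro x y c
    unfold coordB
    rw [show x + c • (y - x) - v = (x - v) + c • ((y - v) - (x - v)) by module]
    simp only [det_add_left, det_smul_left, det_sub_left]
    ring
  have hmem : ∀ x ∈ T, ∀ c : ℝ, 0 < c → c < 1 → x + c • (p - x) ∈ T := fun x hx c h0 h1 =>
    hconvT.segment_subset hx hpT (by rw [segment_eq_image']; exact ⟨c, ⟨h0.le, h1.le⟩, rfl⟩)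
  have hA : ∀ x ∈ T, m < coordB v p z x → x ∈ P := by
    intro x hx hxm
    by_contra hxP
    exact absurd (hmax (subset_closure ⟨hx, hxP⟩)) (not_le.2 hxm)
  have hm1 : m < 1 := by
    by_contra hge
    have h1 : m = 1 := by linarith
    have h2 : t' = 0 := by linarith
    rw [h1, h2, one_smul, zero_smul, add_zero, add_sub_cancel] at hu
    exact notMem_closure_diff_of_eventually hloc (hu ▸ huK)
  have h01 : ∀ᶠ c in nhdsWithin (0 : ℝ) (Set.Ioi 0), c ∈ Set.Ioo (0 : ℝ) 1 :=
    Ioo_mem_nhdsGT one_pos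
  have hB : ∀ x ∈ T, m ≤ coordB v p z x → x ∈ P := by
    intro x hx hxm
    refine hP.isClosed.mem_of_tendsto (tendsto_add_smul_nhds x (p - x)) ?_
    filter_upwards [h01] with c hc
    refine hA _ (hmem x hx c hc.1 hc.2) ?_
    rw [hlin, hpcoord]
    have := hc.1
    nlinarith [hc.2]
  have hmpos : 0 < m := by
    have h1 := eventually_add_smul_mem (τ := p - x₀) (hP.isClosed.isOpen_compl.mem_nhds hx₀P)
    obtain ⟨c, hc, hcP⟩ := (h01.and h1).exists
    have h2 : coordB v p z (x₀ + c • (p - x₀)) ≤ m :=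
      hmax (subset_closure ⟨hmem x₀ hx₀T c hc.1 hc.2, hcP⟩)
    rw [hlin, hpcoord] at h2
    have h3 := ((mem_tri_coord hd).1 hx₀T).1
    nlinarith [hc.1, hc.2]
  have hInt : ∀ x ∈ openTri v p z, x ∉ K → x ∈ interior P := by
    intro x hx hxK
    rw [mem_interior_iff_mem_nhds]
    filter_upwards [isOpen_openTri.mem_nhds hx, isClosed_closure.isOpen_compl.mem_nhds hxK] with
      y hy hyK
    by_contra hyP
    exact hyK (subset_closure ⟨openTri_subset hd hy, hyP⟩)
  have huI : u ∉ interior P := fun h =>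
    notMem_closure_diff_of_eventually ((isOpen_interior.mem_nhds h : interior P ∈ nhds u) |>
      Filter.mem_of_superset <| fun x hx _ => interior_subset hx) huK
  have htpos : 0 < t' := by
    refine lt_of_le_of_ne ht0 fun h0 => huI (hvp ?_)
    rw [← h0, zero_smul, add_zero] at hu
    rw [openSegment_eq_image']
    exact ⟨m, ⟨hmpos, hm1⟩, hu.symm⟩
  have huP : u ∈ P := hB u huT hus.ge
  have huF : u ∈ frontier P := (hP.mem_interior_or_frontier huP).resolve_left huI
  have hdown : ∀ᶠ s in nhdsWithin (0 : ℝ) (Set.Ioi 0), u + s • (v - z) ∈ interior P := by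
    filter_upwards [Ioo_mem_nhdsGT htpos] with s hs
    have e : u + s • (v - z) = v + m • (p - v) + (t' - s) • (z - v) := by rw [hu]; module
    rw [e]
    refine hInt _ (mem_openTri hd hmpos (by linarith [hs.2]) (by linarith [hs.1])) fun h => ?_
    have h1 : t' ≤ coordC v p z (v + m • (p - v) + (t' - s) • (z - v)) :=
      hmin ⟨h, coordB_eq hd _ _⟩
    rw [coordC_eq hd] at h1
    linarith [hs.1]
  have huC : u ∈ concaveVertices P := by
    rcases hmt.lt_or_eq with hlt | heq
    · refine hP.mem_concaveVertices (τ := v - z) huF hdown ?_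
      filter_upwards [Ioo_mem_nhdsGT (sub_pos.2 hlt)] with s hs
      have e : u - s • (v - z) = v + m • (p - v) + (t' + s) • (z - v) := by rw [hu]; module
      rw [e]
      refine hB _ ((mem_tri_coord hd).2 ?_) (coordB_eq hd _ _).ge
      rw [coordB_eq hd, coordC_eq hd]
      exact ⟨hm0, by linarith [hs.1], by linarith [hs.2]⟩
    · by_contra huc
      -- here `u` is on the side from `p` to `z`, and `P` contains a half-disc around `u`
      have hup : u ∈ openSegment ℝ p z := by
        rw [openSegment_eq_image']
        refine ⟨t', ⟨htpos, by linarith⟩, ?_⟩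
        simp only
        have h7 : m = 1 - t' := by linarith
        rw [hu, h7]; module
      obtain ⟨h1, h2⟩ := eventually_mem_of_openSegment
        ((openSegment_subset_segment ℝ _ _).trans hpz) hup
      obtain ⟨ε, hε, hhalf⟩ := hP.eventually_halfDisc huF huc h1 h2
        (hdown.mono fun s hs => interior_subset hs)
      refine notMem_closure_diff_of_eventually (T := T) (P := P) (u := u) ?_ huK
      have hcont : Continuous fun x => |m - coordB v p z x| +
          (1 - coordB v p z x - coordC v p z x) := by fun_prop
      have h0 : |m - coordB v p z u| + (1 - coordB v p z u - coordC v p z u) < ε := by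
        rw [hus, ← ht', sub_self, abs_zero]; linarith
      filter_upwards [hcont.continuousAt.eventually_lt continuousAt_const h0] with x hx hxT
      obtain ⟨h3, h4, h5⟩ := (mem_tri_coord hd).1 hxT
      have h6 := hhalf (m - coordB v p z x) (1 - coordB v p z x - coordC v p z x) (by linarith)
        hx.le
      convert h6 using 1
      obtain h7 : t' = 1 - m := by linarith
      conv_lhs => rw [eq_coord hd x]
      rw [hu, h7]; module
  refine ⟨u, huC, ?_, m, t', hmpos, htpos, hmt, hu⟩
  intro x hx
  rw [segment_symm, segment_eq_image'] at hx
  obtain ⟨c, ⟨hc0, hc1⟩, rfl⟩ := hx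
  refine hB _ (hconvT.segment_subset huT hpT (by
    rw [segment_eq_image']; exact ⟨c, ⟨hc0, hc1⟩, rfl⟩)) ?_
  rw [hlin, hpcoord, hus]
  nlinarith

theorem mem_tri_iff_segment {a b c x : Plane} :
    x ∈ tri a b c ↔ ∃ y ∈ segment ℝ a b, x ∈ segment ℝ c y := by
  have h : ({a, b, c} : Set Plane) = insert c {a, b} := by
    rw [Set.pair_comm b c, Set.insert_comm]
  unfold tri
  rw [h, convexHull_insert (Set.insert_nonempty _ _), convexHull_pair, mem_convexJoin]
  simp

theorem tri_subset_of_split {S : Set Plane} {v w p u : Plane} (hp : p ∈ segment ℝ v w)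
    (h₁ : tri v p u ⊆ S) (h₂ : tri p w u ⊆ S) : tri v w u ⊆ S := by
  intro x hx
  obtain ⟨y, hy, hx⟩ := mem_tri_iff_segment.1 hx
  rw [segment_split hp] at hy
  rcases hy with hy | hy
  · exact h₁ (mem_tri_iff_segment.2 ⟨y, hy, hx⟩)
  · exact h₂ (mem_tri_iff_segment.2 ⟨y, hy, hx⟩)

theorem tri_mono {a b c a' b' c' : Plane} (ha : a ∈ tri a' b' c') (hb : b ∈ tri a' b' c')
    (hc : c ∈ tri a' b' c') : tri a b c ⊆ tri a' b' c' :=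
  tri_subset (convex_tri _ _ _) ha hb hc

theorem openSegment_subset_openSegment_left {v w p : Plane} (hp : p ∈ segment ℝ v w)
    (hpv : p ≠ v) : openSegment ℝ v p ⊆ openSegment ℝ v w := by
  rw [segment_eq_image'] at hp
  obtain ⟨c, ⟨hc0, hc1⟩, rfl⟩ := hp
  have hc : 0 < c := lt_of_le_of_ne hc0 (by rintro rfl; simp at hpv)
  rw [openSegment_eq_image', openSegment_eq_image']
  rintro x ⟨s, ⟨hs0, hs1⟩, rfl⟩
  exact ⟨s * c, ⟨by positivity, by nlinarith⟩, by simp only; module⟩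

/-- One half of the descent step for the height of a visible concave vertex. -/
theorem IsPolygon.exists_lower_aux {P : Set Plane} (hP : IsPolygon P) {v w p u : Plane}
    (hc : IsChord P v w) (hp : p ∈ segment ℝ v w) (hd : det (w - v) (u - v) ≠ 0)
    (hpu : segment ℝ p u ⊆ P) (hloc : ∀ᶠ x in nhds p, x ∈ tri v w u → x ∈ P)
    (hnot : ¬ tri v p u ⊆ P) :
    ∃ u' ∈ concaveVertices P, u' ∈ tri v w u ∧ segment ℝ p u' ⊆ P ∧
      ∃ t : ℝ, 0 < t ∧ t < 1 ∧ det (w - v) (u' - v) = t * det (w - v) (u - v) := by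
  have hpT : p ∈ tri v w u := segment_subset_tri_left hp
  have hsub : tri v p u ⊆ tri v w u :=
    tri_mono (left_mem_tri _ _ _) hpT (right_mem_tri _ _ _)
  have hpv : p ≠ v := by
    rintro rfl
    apply hnot
    unfold tri
    rw [Set.insert_eq_of_mem (by simp), convexHull_pair]
    exact hpu
  have hpv' := hp
  rw [segment_eq_image'] at hpv'
  obtain ⟨c, ⟨hc0, hc1⟩, hpc⟩ := hpv'
  have hpc : p - v = c • (w - v) := by rw [← hpc]; simp
  have hc' : c ≠ 0 := by
    rintro rfl
    rw [zero_smul, sub_eq_zero] at hpc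
    exact hpv hpc
  obtain ⟨u', hu'C, hpu', m, t, hm, ht, hmt, rfl⟩ := hP.exists_concave_of_not_tri_subset
    ((openSegment_subset_openSegment_left hp hpv).trans hc.2.2.2) hpu
    (by rw [hpc, det_smul_left]; exact mul_ne_zero hc' hd)
    (hloc.mono fun x hx hxT => hx (hsub hxT)) hnot
  refine ⟨_, hu'C, hsub (mem_tri_iff.2 ⟨m, t, hm.le, ht.le, hmt, rfl⟩), hpu', t, ht,
    by linarith, ?_⟩
  rw [show v + m • (p - v) + t • (u - v) - v = m • (p - v) + t • (u - v) by abel, det_add_right,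
    det_smul_right, det_smul_right, hpc, det_smul_right, det_self]
  ring

/-- If `u` is visible from the point `p` of a chord but the triangle on the chord with apex `u` is
not contained in `P`, then a concave vertex closer to the chord is visible from `p`. -/
theorem IsPolygon.exists_lower {P : Set Plane} (hP : IsPolygon P) {v w p u : Plane}
    (hc : IsChord P v w) (hp : p ∈ segment ℝ v w) (hd : det (w - v) (u - v) ≠ 0)
    (hpu : segment ℝ p u ⊆ P) (hloc : ∀ᶠ x in nhds p, x ∈ tri v w u → x ∈ P)
    (hnot : ¬ tri v w u ⊆ P) :
    ∃ u' ∈ concaveVertices P, u' ∈ tri v w u ∧ segment ℝ p u' ⊆ P ∧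
      ∃ t : ℝ, 0 < t ∧ t < 1 ∧ det (w - v) (u' - v) = t * det (w - v) (u - v) := by
  by_cases h1 : tri v p u ⊆ P
  · have h2 : ¬ tri w p u ⊆ P := fun h2 => hnot (tri_subset_of_split hp h1 (by rwa [tri_swap]))
    obtain ⟨u', h3, h4, h5, t, h6, h7, h8⟩ := hP.exists_lower_aux hc.symm
      (by rwa [segment_symm]) (by rw [det_swap_base]; exact neg_ne_zero.2 hd) hpu
      (by rwa [tri_swap]) h2
    refine ⟨u', h3, by rwa [tri_swap], h5, t, h6, h7, ?_⟩
    rw [det_swap_base v w u', det_swap_base v w u] at h8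
    linarith
  · exact hP.exists_lower_aux hc hp hd hpu hloc h1

/-- Let `z` be visible from the point `p` of a chord. Then the triangle on the chord with
apex `z`, or with some concave vertex in this triangle as its apex, is contained in the polygon. -/
theorem IsPolygon.exists_niceTri {P : Set Plane} (hP : IsPolygon P) {v w p z : Plane}
    (hc : IsChord P v w) (hp : p ∈ segment ℝ v w) (hd : det (w - v) (z - v) ≠ 0)
    (hpz : segment ℝ p z ⊆ P) (hloc : ∀ᶠ x in nhds p, x ∈ tri v w z → x ∈ P) :
    NiceTri P v w z ∨ ∃ u ∈ concaveVertices P, u ∈ tri v w z ∧ NiceTri P v w u := by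
  set S : Set Plane := {u | u ∈ insert z (concaveVertices P) ∧ u ∈ tri v w z ∧
    det (w - v) (u - v) ≠ 0 ∧ segment ℝ p u ⊆ P} with hS
  have hfin : S.Finite := (hP.finite_concaveVertices.insert z).subset fun u hu => hu.1
  obtain ⟨u, ⟨hu1, hu2, hu3, hu4⟩, hmin⟩ := Set.exists_min_image S
    (fun u => |det (w - v) (u - v)|) hfin ⟨z, Set.mem_insert _ _, right_mem_tri _ _ _, hd, hpz⟩
  have hsub : tri v w u ⊆ tri v w z := tri_mono (left_mem_tri _ _ _) (mid_mem_tri _ _ _) hu2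
  have hno : ∀ u' ∈ concaveVertices P, u' ∈ tri v w u → segment ℝ p u' ⊆ P → ∀ t : ℝ, 0 < t →
      t < 1 → det (w - v) (u' - v) = t * det (w - v) (u - v) → False := by
    intro u' h1 h2 h3 t ht0 ht1 h4
    have h5 := hmin u' ⟨Set.mem_insert_of_mem _ h1, hsub h2,
      by rw [h4]; exact mul_ne_zero ht0.ne' hu3, h3⟩
    rw [h4, abs_mul, abs_of_pos ht0] at h5
    have := abs_pos.2 hu3
    nlinarith
  have hT : tri v w u ⊆ P := by
    by_contra hnot
    obtain ⟨u', h1, h2, h3, t, ht0, ht1, h4⟩ := hP.exists_lower hc hp hu3 hu4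
      (hloc.mono fun x hx hxT => hx (hsub hxT)) hnot
    exact hno u' h1 h2 h3 t ht0 ht1 h4
  have hpT : p ∈ tri v w u := segment_subset_tri_left hp
  have hvis : ∀ e ∈ tri v w u, segment ℝ p e ⊆ P := fun e he =>
    ((convex_tri v w u).segment_subset hpT he).trans hT
  have hnice : NiceTri P v w u := by
    refine ⟨hu3, hT, ?_, ?_⟩
    · have h1 : segment ℝ v u ⊆ tri v w u :=
        (convex_tri _ _ _).segment_subset (left_mem_tri _ _ _) (right_mem_tri _ _ _)
      refine (hP.sideOK_or (h1.trans hT)).resolve_right ?_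
      rintro ⟨e, he, heo⟩
      have heT := h1 (openSegment_subset_segment ℝ _ _ heo)
      rw [openSegment_eq_image'] at heo
      obtain ⟨t, ⟨ht0, ht1⟩, rfl⟩ := heo
      refine hno _ he heT (hvis _ heT) t ht0 ht1 ?_
      rw [add_sub_cancel_left, det_smul_right]
    · have h1 : segment ℝ u w ⊆ tri v w u :=
        (convex_tri _ _ _).segment_subset (right_mem_tri _ _ _) (mid_mem_tri _ _ _)
      refine (hP.sideOK_or (h1.trans hT)).resolve_right ?_
      rintro ⟨e, he, heo⟩
      have heT := h1 (openSegment_subset_segment ℝ _ _ heo)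
      rw [openSegment_eq_image'] at heo
      obtain ⟨t, ⟨ht0, ht1⟩, rfl⟩ := heo
      refine hno _ he heT (hvis _ heT) (1 - t) (by linarith) (by linarith) ?_
      simp only
      rw [show u + t • (w - u) - v = (1 - t) • (u - v) + t • (w - v) by module, det_add_right,
        det_smul_right, det_smul_right, det_self]
      ring
  rcases hu1 with rfl | hu1
  · exact Or.inl hnice
  · exact Or.inr ⟨u, hu1, hu2, hnice⟩

theorem IsPolygon.exists_niceTri_of_subset {P : Set Plane} (hP : IsPolygon P) {v w z : Plane}
    (hc : IsChord P v w) (hd : det (w - v) (z - v) ≠ 0) (hT : tri v w z ⊆ P) :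
    NiceTri P v w z ∨ ∃ u ∈ concaveVertices P, u ∈ tri v w z ∧ NiceTri P v w u :=
  hP.exists_niceTri hc (left_mem_segment ℝ v w) hd
    (((convex_tri _ _ _).segment_subset (left_mem_tri _ _ _) (right_mem_tri _ _ _)).trans hT)
    (Filter.Eventually.of_forall fun _ hx => hT hx)

/-! ### Local cones and boundary directions -/

/-- All short nonzero combinations of the directions `a` and `d` at `e` lead into `S`. -/
def LocalCone (S : Set Plane) (e a d : Plane) : Prop :=
  ∃ ε > 0, ∀ α β : ℝ, 0 ≤ α → 0 ≤ β → 0 < α + β → α + β ≤ ε → e + α • a + β • d ∈ S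

/-- The boundary of `P` leaves `e` in direction `d`. -/
def EdgeDir (P : Set Plane) (e d : Plane) : Prop :=
  ∃ ε > 0, ∀ s : ℝ, 0 < s → s ≤ ε → e + s • d ∈ frontier P

theorem EdgeDir.smul {P : Set Plane} {e d : Plane} (h : EdgeDir P e d) {c : ℝ} (hc : 0 < c) :
    EdgeDir P e (c • d) := by
  obtain ⟨ε, hε, h⟩ := h
  refine ⟨ε / c, by positivity, fun s hs0 hs => ?_⟩
  rw [smul_smul]
  exact h _ (by positivity) (by rwa [le_div_iff₀ hc] at hs)

theorem LocalCone.mono {S S' : Set Plane} {e a d : Plane} (h : LocalCone S e a d) (hS : S ⊆ S') :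
    LocalCone S' e a d := by
  obtain ⟨ε, hε, h⟩ := h
  exact ⟨ε, hε, fun α β h1 h2 h3 h4 => hS (h α β h1 h2 h3 h4)⟩

/-- Directions between directions of a local cone span a local cone. -/
theorem LocalCone.comb {S : Set Plane} {e a d : Plane} (h : LocalCone S e a d) {α₁ β₁ α₂ β₂ : ℝ}
    (h₁ : 0 ≤ α₁) (h₂ : 0 ≤ β₁) (h₃ : 0 ≤ α₂) (h₄ : 0 ≤ β₂) (h₅ : 0 < α₁ + β₁)
    (h₆ : 0 < α₂ + β₂) : LocalCone S e (α₁ • a + β₁ • d) (α₂ • a + β₂ • d) := by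
  obtain ⟨ε, hε, h⟩ := h
  set M := (α₁ + β₁) + (α₂ + β₂) with hM
  have hMpos : 0 < M := by linarith
  refine ⟨ε / M, by positivity, fun α β hα hβ h0 h1 => ?_⟩
  rw [le_div_iff₀ hMpos] at h1
  have e1 : e + α • (α₁ • a + β₁ • d) + β • (α₂ • a + β₂ • d) =
      e + (α * α₁ + β * α₂) • a + (α * β₁ + β * β₂) • d := by module
  rw [e1]
  have e2 : α * α₁ + β * α₂ + (α * β₁ + β * β₂) = α * (α₁ + β₁) + β * (α₂ + β₂) := by ring
  apply h
  · positivity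
  · positivity
  · rw [e2]
    rcases hα.eq_or_lt with rfl | hα'
    · have hβ' : 0 < β := by linarith
      have := mul_pos hβ' h₆
      linarith
    · have := mul_pos hα' h₅
      have := mul_nonneg hβ h₆.le
      linarith
  · rw [e2]
    have := mul_nonneg hα h₆.le
    have := mul_nonneg hβ h₅.le
    nlinarith

theorem LocalCone.eventually_tri {P : Set Plane} {e b c : Plane} (he : e ∈ P)
    (hd : det (b - e) (c - e) ≠ 0) (h : LocalCone P e (b - e) (c - e)) :
    ∀ᶠ x in nhds e, x ∈ tri e b c → x ∈ P := by
  obtain ⟨ε, hε, h⟩ := h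
  have hcont : Continuous fun x => coordB e b c x + coordC e b c x := by fun_prop
  have h0 : coordB e b c e + coordC e b c e < ε := by
    simp [coordB, coordC, det_zero_left, det_zero_right, hε]
  filter_upwards [hcont.continuousAt.eventually_lt continuousAt_const h0] with x hx hxT
  obtain ⟨h1, h2, h3⟩ := (mem_tri_coord hd).1 hxT
  have hxe := eq_coord hd x
  rcases (add_nonneg h1 h2).eq_or_lt with h4 | h4
  · have h5 : coordB e b c x = 0 := by linarith
    have h6 : coordC e b c x = 0 := by linarith
    rw [h5, h6, zero_smul, zero_smul, add_zero, add_zero] at hxe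
    rwa [hxe]
  · rw [hxe]
    exact h _ _ h1 h2 h4 hx.le

/-- Turning from an interior direction `a` at a boundary point `e` towards a direction `q`, either
all the directions are interior, or a first boundary direction is met. -/
theorem IsPolygon.localCone_or_edgeDir {P : Set Plane} (hP : IsPolygon P) {e a q : Plane}
    (he : e ∈ frontier P) (ha : ∃ ε > 0, ∀ s : ℝ, 0 < s → s ≤ ε → e + s • a ∈ interior P) :
    LocalCone (interior P) e a q ∨
      ∃ t : ℝ, 0 < t ∧ t ≤ 1 ∧ EdgeDir P e (a + t • (q - a)) ∧ LocalCone P e a (a + t • (q - a)) := by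
  obtain ⟨r, hr, hcon⟩ := hP.conic he
  obtain ⟨ε₀, hε₀, ha⟩ := ha
  set ε := min ε₀ (r / (‖a‖ + ‖q‖ + 1)) with hεdef
  have hM : 0 < ‖a‖ + ‖q‖ + 1 := by positivity
  have hε : 0 < ε := lt_min hε₀ (by positivity)
  have hnorm : ∀ t : ℝ, 0 ≤ t → t ≤ 1 → ‖ε • (a + t • (q - a))‖ < r := by
    intro t ht0 ht1
    have h1 : ‖a + t • (q - a)‖ ≤ ‖a‖ + ‖q‖ := by
      rw [show a + t • (q - a) = (1 - t) • a + t • q by module]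
      refine (norm_add_le _ _).trans ?_
      rw [norm_smul, norm_smul, Real.norm_of_nonneg ht0, Real.norm_of_nonneg (sub_nonneg.2 ht1)]
      nlinarith [norm_nonneg a, norm_nonneg q]
    rw [norm_smul, Real.norm_of_nonneg hε.le]
    have h2 : ε * (‖a‖ + ‖q‖ + 1) ≤ r := by
      rw [← le_div_iff₀ hM]; exact min_le_right _ _
    nlinarith
  have hscale : ∀ t : ℝ, 0 ≤ t → t ≤ 1 → ∀ s : ℝ, 0 < s → s ≤ ε →
      (e + s • (a + t • (q - a)) ∈ P ↔ e + ε • (a + t • (q - a)) ∈ P) ∧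
      (e + s • (a + t • (q - a)) ∈ frontier P ↔ e + ε • (a + t • (q - a)) ∈ frontier P) ∧
      (e + s • (a + t • (q - a)) ∈ interior P ↔ e + ε • (a + t • (q - a)) ∈ interior P) := by
    intro t ht0 ht1 s hs0 hs
    have := hcon (ε • (a + t • (q - a))) (s / ε) (hnorm t ht0 ht1) (by positivity)
      (by rwa [div_le_one hε])
    rwa [smul_smul, div_mul_cancel₀ _ hε.ne'] at this
  have hcomb : ∀ t₀ : ℝ, 0 < t₀ → t₀ ≤ 1 → ∀ S : Set Plane,
      (∀ t s : ℝ, 0 ≤ t → t ≤ t₀ → 0 < s → s ≤ ε → e + s • (a + t • (q - a)) ∈ S) →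
      LocalCone S e a (a + t₀ • (q - a)) := by
    intro t₀ ht₀ ht₁ S hS
    refine ⟨ε, hε, fun α β hα hβ h0 h1 => ?_⟩
    have h2 := hS (β / (α + β) * t₀) (α + β) (by positivity)
      (by
        have : β / (α + β) ≤ 1 := by rw [div_le_one h0]; linarith
        nlinarith) h0 h1
    have e1 : e + (α + β) • (a + (β / (α + β) * t₀) • (q - a)) =
        e + (α + β) • a + ((α + β) * (β / (α + β)) * t₀) • (q - a) := by module
    rw [e1, mul_div_cancel₀ _ h0.ne'] at h2
    convert h2 using 1
    module
  have hg : Continuous fun t : ℝ => e + ε • (a + t • (q - a)) := by fun_prop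
  by_cases hall : ∀ t : ℝ, 0 ≤ t → t ≤ 1 → e + ε • (a + t • (q - a)) ∈ interior P
  · left
    have := hcomb 1 one_pos le_rfl (interior P) fun t s ht0 ht1 hs0 hs =>
      (hscale t ht0 ht1 s hs0 hs).2.2.2 (hall t ht0 ht1)
    rwa [one_smul, add_sub_cancel] at this
  · right
    push Not at hall
    obtain ⟨t₁, ht₁0, ht₁1, ht₁⟩ := hall
    have hcomp : IsCompact (Set.Icc (0:ℝ) 1 ∩
        (fun t : ℝ => e + ε • (a + t • (q - a))) ⁻¹' (interior P)ᶜ) :=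
      isCompact_Icc.inter_right (isOpen_interior.isClosed_compl.preimage hg)
    obtain ⟨t₀, ⟨⟨h1, h2⟩, h3⟩, h4⟩ := hcomp.exists_isLeast ⟨t₁, ⟨ht₁0, ht₁1⟩, ht₁⟩
    have h3 : e + ε • (a + t₀ • (q - a)) ∉ interior P := h3
    have hlt : ∀ t, 0 ≤ t → t < t₀ → e + ε • (a + t • (q - a)) ∈ interior P := by
      intro t ht0 htt
      by_contra h
      exact absurd (h4 ⟨⟨ht0, by linarith⟩, h⟩) (not_le.2 htt)
    have h0 : 0 < t₀ := by
      refine lt_of_le_of_ne h1 ?_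
      rintro rfl
      apply h3
      rw [zero_smul, add_zero]
      exact ha ε hε (min_le_left _ _)
    have h5 : e + ε • (a + t₀ • (q - a)) ∈ P := by
      refine hP.isClosed.mem_of_tendsto (b := nhdsWithin t₀ (Set.Iio t₀))
        (hg.tendsto t₀ |>.mono_left nhdsWithin_le_nhds) ?_
      filter_upwards [Ioo_mem_nhdsLT h0] with t ht
      exact interior_subset (hlt t ht.1.le ht.2)
    have h6 := (hP.mem_interior_or_frontier h5).resolve_left h3
    refine ⟨t₀, h0, h2, ⟨ε, hε, fun s hs0 hs => (hscale t₀ h1 h2 s hs0 hs).2.1.2 h6⟩,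
      hcomb t₀ h0 h2 P fun t s ht0 ht hs0 hs => (hscale t ht0 (ht.trans h2) s hs0 hs).1.2 ?_⟩
    rcases ht.lt_or_eq with h7 | rfl
    · exact interior_subset (hlt t ht0 h7)
    · exact h5

/-! ### Ears -/

/-- A segment in `P` from `v` towards `a` cannot end in the interior of `P` unless it passes through
a concave vertex. -/
def EndCond (P : Set Plane) (v a : Plane) : Prop :=
  ∀ z ∈ segment ℝ v a, z ≠ v → segment ℝ v z ⊆ P →
    z ∈ frontier P ∨ ∃ s ∈ concaveVertices P, s ∈ openSegment ℝ v z

/-- A segment whose initial piece lies in the boundary can enter the interior only at a concave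
vertex. -/
theorem IsPolygon.endCond_of_edgeDir {P : Set Plane} (hP : IsPolygon P) {v a : Plane}
    (h : EdgeDir P v (a - v)) : EndCond P v a := by
  obtain ⟨ε, hε, h⟩ := h
  intro z hz hzv hzP
  by_cases hzF : z ∈ frontier P
  · exact Or.inl hzF
  · right
    refine (hP.openSegment_subset_or hzP hzF).resolve_left fun hI => ?_
    rw [segment_eq_image'] at hz
    obtain ⟨c, ⟨hc0, hc1⟩, rfl⟩ := hz
    have hc : 0 < c := lt_of_le_of_ne hc0 (by rintro rfl; simp at hzv)
    have hεc : ε < c := by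
      by_contra hle
      exact hzF (h c hc (not_lt.1 hle))
    have h1 := h ε hε le_rfl
    refine h1.2 (hI ?_)
    rw [openSegment_eq_image']
    refine ⟨ε / c, ⟨by positivity, by rwa [div_lt_one hc]⟩, ?_⟩
    simp only
    rw [add_sub_cancel_left, smul_smul, div_mul_cancel₀ _ hc.ne']

/-- At a point that is not a concave vertex, no segment in `P` starts opposite to an interior
direction. -/
theorem IsPolygon.endCond_of_opposite {P : Set Plane} (hP : IsPolygon P) {v a : Plane}
    (hv : v ∈ frontier P) (hvc : v ∉ concaveVertices P)
    (h : ∃ ε > 0, ∀ s : ℝ, 0 < s → s ≤ ε → v + s • (v - a) ∈ interior P) : EndCond P v a := by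
  obtain ⟨ε, hε, h⟩ := h
  intro z hz hzv hzP
  exfalso
  rw [segment_eq_image'] at hz
  obtain ⟨c, ⟨hc0, hc1⟩, rfl⟩ := hz
  have hc : 0 < c := lt_of_le_of_ne hc0 (by rintro rfl; simp at hzv)
  refine hvc (hP.mem_concaveVertices (τ := v - a) hv ?_ ?_)
  · filter_upwards [Ioo_mem_nhdsGT hε] with s hs
    exact h s hs.1 hs.2.le
  · filter_upwards [Ioo_mem_nhdsGT hc] with s hs
    apply hzP
    rw [segment_eq_image']
    refine ⟨s / c, ⟨by have := hs.1; positivity, by rw [div_le_one hc]; exact hs.2.le⟩, ?_⟩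
    simp only
    rw [add_sub_cancel_left, smul_smul, div_mul_cancel₀ _ hc.ne']
    module

theorem eventually_segment_subset {U : Set Plane} (hU : IsOpen U) {p z : Plane}
    (h : segment ℝ p z ⊆ U) : ∀ᶠ z' in nhds z, segment ℝ p z' ⊆ U := by
  obtain ⟨δ, hδ, hsub⟩ := (isCompact_segment p z).exists_thickening_subset_open hU h
  filter_upwards [Metric.ball_mem_nhds z hδ] with z' hz' x hx
  apply hsub
  rw [Metric.mem_thickening_iff]
  rw [segment_eq_image'] at hx
  obtain ⟨t, ⟨ht0, ht1⟩, rfl⟩ := hx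
  refine ⟨p + t • (z - p), by rw [segment_eq_image']; exact ⟨t, ⟨ht0, ht1⟩, rfl⟩, ?_⟩
  rw [Metric.mem_ball, dist_eq_norm] at hz'
  simp only
  rw [dist_eq_norm, show p + t • (z' - p) - (p + t • (z - p)) = t • (z' - z) by module, norm_smul,
    Real.norm_of_nonneg ht0]
  have := norm_nonneg (z' - z)
  nlinarith

/-- If the triangle on a chord with apex `a` has no concave vertex that is the apex of a nice
triangle, and if the polygon does not continue past the other two sides, then one of the parts
into which the chord cuts the polygon is contained in the triangle. -/
theorem IsPolygon.exists_ear {P : Set Plane} (hP : IsPolygon P) {v w a : Plane}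
    (hc : IsChord P v w) (hd : det (w - v) (a - v) ≠ 0) (hv : EndCond P v a) (hw : EndCond P w a)
    (hno : ∀ u ∈ concaveVertices P, u ∈ tri v w a → ¬ NiceTri P v w u) :
    ∃ Q₁ Q₂, InducesPartition P v w Q₁ Q₂ ∧ ∀ q ∈ Q₁, q ∈ tri v w a ∧ tri v w q ⊆ P := by
  obtain ⟨A, B, hAB⟩ := hc.exists_partition hP
  set O : Set Plane := {z | z ∈ openTri v w a ∧ z ∈ interior P ∧ tri v w z ⊆ P} with hO
  have hvT := left_mem_tri v w a
  have hwT := mid_mem_tri v w a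
  have hOT : ∀ z ∈ openTri v w a, tri v w z ⊆ tri v w a := fun z hz =>
    tri_mono hvT hwT (openTri_subset hd hz)
  -- no concave vertex can occur below a point of `O` or of its closure
  have hnoC : ∀ z ∈ tri v w a, tri v w z ⊆ P → ∀ s ∈ concaveVertices P, s ∈ tri v w z →
      det (w - v) (s - v) = 0 := by
    intro z hz hzP s hs hsT
    by_contra h0
    have hsub : tri v w s ⊆ tri v w z := tri_mono (left_mem_tri _ _ _) (mid_mem_tri _ _ _) hsT
    have hsub' : tri v w z ⊆ tri v w a := tri_mono hvT hwT hz
    rcases hP.exists_niceTri_of_subset hc h0 (hsub.trans hzP) with h1 | ⟨u, h1, h2, h3⟩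
    · exact hno s hs (hsub' hsT) h1
    · exact hno u h1 (hsub' (hsub h2)) h3
  set p : Plane := v + (1 / 2 : ℝ) • (w - v) with hp
  have hpo : p ∈ openSegment ℝ v w := by
    rw [openSegment_eq_image']; exact ⟨1 / 2, by norm_num, rfl⟩
  have hps := openSegment_subset_segment ℝ v w hpo
  have hpI := hc.2.2.2 hpo
  have hdo : ∀ z ∈ openTri v w a, det (w - v) (z - v) ≠ 0 := by
    intro z hz h0
    have h1 : 0 < coordC v w a z := hz.2.1
    rw [coordC, h0, zero_div] at h1
    exact lt_irrefl _ h1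
  have hploc : ∀ᶠ x in nhds p, x ∈ P :=
    Filter.mem_of_superset (isOpen_interior.mem_nhds hpI) interior_subset
  have hstep : ∀ z ∈ openTri v w a, z ∈ interior P → segment ℝ p z ⊆ P → z ∈ O := by
    intro z hz hzI hpz
    refine ⟨hz, hzI, ?_⟩
    rcases hP.exists_niceTri hc hps (hdo z hz) hpz (hploc.mono fun x hx _ => hx) with
      h1 | ⟨u, h1, h2, h3⟩
    · exact h1.2.1
    · exact absurd h3 (hno u h1 (hOT z hz h2))
  have hOopen : IsOpen O := by
    rw [isOpen_iff_mem_nhds]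
    rintro z ⟨hz1, hz2, hz3⟩
    have hpzP : segment ℝ p z ⊆ tri v w z :=
      (convex_tri v w z).segment_subset (segment_subset_tri_left hps) (right_mem_tri _ _ _)
    have hpz : segment ℝ p z ⊆ interior P := by
      rcases hP.openSegment_subset_or (hpzP.trans hz3) (fun h => h.2 hz2) with h1 | ⟨e, h1, h2⟩
      · rw [segment_eq_insert_openSegment]
        rintro x (rfl | rfl | hx)
        · exact hpI
        · exact hz2
        · exact h1 hx
      · exfalso
        have h3 := hnoC z (openTri_subset hd hz1) hz3 e h1
          (hpzP (openSegment_subset_segment ℝ _ _ h2))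
        rw [openSegment_eq_image'] at h2
        obtain ⟨t, ⟨ht0, ht1⟩, rfl⟩ := h2
        simp only at h3
        rw [show p + t • (z - p) - v = ((1 - t) / 2) • (w - v) + t • (z - v) by
          rw [hp]; module, det_add_right, det_smul_right, det_smul_right, det_self, mul_zero,
          zero_add] at h3
        exact mul_ne_zero ht0.ne' (hdo z hz1) h3
    filter_upwards [eventually_segment_subset isOpen_interior hpz, isOpen_openTri.mem_nhds hz1,
      isOpen_interior.mem_nhds hz2] with z' h1 h2 h3
    exact hstep z' h2 h3 (h1.trans interior_subset)
  have hOne : O.Nonempty := by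
    obtain ⟨r, hr, hball⟩ := Metric.isOpen_iff.1 isOpen_interior p hpI
    have h1 := eventually_add_smul_mem (τ := a - p) (Metric.ball_mem_nhds p hr)
    have h01 : ∀ᶠ c in nhdsWithin (0 : ℝ) (Set.Ioi 0), c ∈ Set.Ioo (0 : ℝ) 1 :=
      Ioo_mem_nhdsGT one_pos
    obtain ⟨c, hcb, hc01⟩ := (h1.and h01).exists
    refine ⟨_, hstep (p + c • (a - p)) ?_ (hball hcb) ?_⟩
    · have e : p + c • (a - p) = v + ((1 - c) / 2) • (w - v) + c • (a - v) := by
        rw [hp]; module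
      rw [e]
      exact mem_openTri hd (by linarith [hc01.2]) hc01.1 (by linarith [hc01.2])
    · exact ((convex_ball p r).segment_subset (Metric.mem_ball_self hr) hcb).trans
        (hball.trans interior_subset)
  have hclosedTri : ∀ z ∈ closure O, z ∈ tri v w a ∧ tri v w z ⊆ P := by
    intro z hz
    refine ⟨closure_minimal (fun x hx => openTri_subset hd hx.1) (isCompact_tri v w a).isClosed hz,
      ?_⟩
    intro x hx
    obtain ⟨s, t, hs, ht, hst, rfl⟩ := mem_tri_iff.1 hx
    have hcont : Continuous fun z : Plane => v + s • (w - v) + t • (z - v) := by fun_prop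
    have hcl : IsClosed {z : Plane | v + s • (w - v) + t • (z - v) ∈ P} :=
      hP.isClosed.preimage hcont
    exact closure_minimal (fun y hy => hy.2.2 (mem_tri_iff.2 ⟨s, t, hs, ht, hst, rfl⟩)) hcl hz
  have hedge : ∀ z ∈ closure O, z ∈ interior P → z ∉ segment ℝ v w → z ∈ O := by
    intro z hz hzI hzs
    obtain ⟨hzT, hzP⟩ := hclosedTri z hz
    refine ⟨?_, hzI, hzP⟩
    by_contra hzo
    have hzF : z ∉ frontier P := fun h => h.2 hzI
    have hdz : det (w - v) (z - v) ≠ 0 := by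
      intro h0
      obtain ⟨k1, k2, k3⟩ := (mem_tri_coord hd).1 hzT
      have he := eq_coord hd z
      have : coordC v w a z = 0 := by rw [coordC, h0, zero_div]
      rw [this, zero_smul, add_zero] at he
      apply hzs
      rw [segment_eq_image']
      exact ⟨_, ⟨k1, by linarith⟩, he.symm⟩
    rcases mem_sides_of_notMem_openTri hd hzT hzo with h1 | h1 | h1
    · exact hzs h1
    · have hvz : segment ℝ v z ⊆ tri v w z :=
        (convex_tri _ _ _).segment_subset (left_mem_tri _ _ _) (right_mem_tri _ _ _)
      rcases hv z h1 (by rintro rfl; exact hzs (left_mem_segment ℝ _ _)) (hvz.trans hzP) with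
        h2 | ⟨s, h2, h3⟩
      · exact hzF h2
      · refine det_ne_zero_of_openSegment hdz h3 (hnoC z hzT hzP s h2 ?_)
        exact hvz (openSegment_subset_segment ℝ _ _ h3)
    · rw [segment_symm] at h1
      have hwz : segment ℝ w z ⊆ tri v w z :=
        (convex_tri _ _ _).segment_subset (mid_mem_tri _ _ _) (right_mem_tri _ _ _)
      rcases hw z h1 (by rintro rfl; exact hzs (right_mem_segment ℝ _ _)) (hwz.trans hzP) with
        h2 | ⟨s, h2, h3⟩
      · exact hzF h2
      · have h4 := hnoC z hzT hzP s h2 (hwz (openSegment_subset_segment ℝ _ _ h3))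
        have hdz' : det (v - w) (z - w) ≠ 0 := by rw [det_swap_base]; exact neg_ne_zero.2 hdz
        have h5 := det_ne_zero_of_openSegment hdz' h3
        rw [det_swap_base, h4, neg_zero] at h5
        exact h5 rfl
  have key : ∀ {Q₁ Q₂ : Set Plane}, InducesPartition P v w Q₁ Q₂ → (interior Q₁ ∩ O).Nonempty →
      ∀ q ∈ Q₁, q ∈ tri v w a ∧ tri v w q ⊆ P := by
    intro Q₁ Q₂ hQ hne q hq
    have h1 : interior Q₁ ⊆ O := by
      refine hQ.left.isPreconnected_interior.subset_of_closure_inter_subset hOopen hne ?_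
      rintro z ⟨hz1, hz2⟩
      exact hedge z hz1 (interior_mono hQ.left_subset hz2) fun h =>
        (hQ.segment_subset_frontier h).2 hz2
    exact hclosedTri q (closure_mono h1 (hQ.left.subset_closure_interior hq))
  obtain ⟨z, hz⟩ := hOne
  have hzs : z ∉ segment ℝ v w := fun h => hdo z hz.1 (det_of_mem_segment h)
  have hzP : z ∈ A ∪ B := hAB.union_eq ▸ interior_subset hz.2.1
  rcases hzP with h1 | h1
  · have h2 : z ∉ B := fun h2 => hzs (by rw [hAB.inter_eq]; exact ⟨h1, h2⟩)
    have h3 := hAB.mem_interior_of_notMem hz.2.1 h2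
    exact ⟨A, B, hAB, key hAB ⟨z, h3, hz⟩⟩
  · have h2 : z ∉ A := fun h2 => hzs (by rw [hAB.inter_eq]; exact ⟨h2, h1⟩)
    have h3 := hAB.symm.mem_interior_of_notMem hz.2.1 h2
    exact ⟨B, A, hAB.symm, key hAB.symm ⟨z, h3, hz⟩⟩

/-! ### Curves and intrinsic distances -/

/-- There is a curve in `P` of length `l` from `p` to `q`, parametrized by arc length. -/
def Reach (P : Set Plane) (p q : Plane) (l : ℝ) : Prop :=
  0 ≤ l ∧ ∃ γ : ℝ → Plane, HasUnitSpeedOn γ (Set.Icc 0 l) ∧ Set.MapsTo γ (Set.Icc 0 l) P ∧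
    γ 0 = p ∧ γ l = q

theorem hasUnitSpeedOn_Icc_iff {γ : ℝ → Plane} {a b : ℝ} :
    HasUnitSpeedOn γ (Set.Icc a b) ↔ ∀ x y, a ≤ x → x ≤ y → y ≤ b →
      eVariationOn γ (Set.Icc x y) = ENNReal.ofReal (y - x) := by
  unfold HasUnitSpeedOn
  rw [hasConstantSpeedOnWith_iff_ordered]
  constructor
  · intro h x y hx hxy hy
    have := h ⟨hx, hxy.trans hy⟩ ⟨hx.trans hxy, hy⟩ hxy
    rwa [Set.inter_eq_right.2 (Set.Icc_subset_Icc hx hy), NNReal.coe_one, one_mul] at this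
  · rintro h x ⟨hx, -⟩ y ⟨-, hy⟩ hxy
    rw [Set.inter_eq_right.2 (Set.Icc_subset_Icc hx hy), NNReal.coe_one, one_mul]
    exact h x y hx hxy hy

theorem HasUnitSpeedOn.dist_le {γ : ℝ → Plane} {a b : ℝ} (h : HasUnitSpeedOn γ (Set.Icc a b))
    {x y : ℝ} (hx : a ≤ x) (hxy : x ≤ y) (hy : y ≤ b) : dist (γ x) (γ y) ≤ y - x := by
  rw [hasUnitSpeedOn_Icc_iff] at h
  have h1 := eVariationOn.edist_le γ (Set.left_mem_Icc.2 hxy) (Set.right_mem_Icc.2 hxy)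
  rw [h x y hx hxy hy, edist_dist] at h1
  exact (ENNReal.ofReal_le_ofReal_iff (sub_nonneg.2 hxy)).1 h1

theorem HasUnitSpeedOn.continuousOn {γ : ℝ → Plane} {a b : ℝ} (h : HasUnitSpeedOn γ (Set.Icc a b)) :
    ContinuousOn γ (Set.Icc a b) := by
  have : LipschitzOnWith 1 γ (Set.Icc a b) := by
    refine LipschitzOnWith.of_dist_le_mul fun x hx y hy => ?_
    rw [NNReal.coe_one, one_mul, Real.dist_eq]
    rcases le_total x y with hxy | hxy
    · rw [abs_sub_comm, abs_of_nonneg (sub_nonneg.2 hxy)]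
      exact h.dist_le hx.1 hxy hy.2
    · rw [abs_of_nonneg (sub_nonneg.2 hxy), dist_comm]
      exact h.dist_le hy.1 hxy hx.2
  exact this.continuousOn

namespace Reach

variable {P : Set Plane} {p q r : Plane} {l m : ℝ}

theorem mono {P' : Set Plane} (h : Reach P p q l) (hP : P ⊆ P') : Reach P' p q l := by
  obtain ⟨hl, γ, h1, h2, h3⟩ := h
  exact ⟨hl, γ, h1, fun t ht => hP (h2 ht), h3⟩

theorem symm (h : Reach P p q l) : Reach P q p l := by
  obtain ⟨hl, γ, h1, h2, h3, h4⟩ := h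
  refine ⟨hl, fun t => γ (l - t), ?_, fun t ht => h2 ⟨by linarith [ht.2], by linarith [ht.1]⟩,
    by simpa using h4, by simpa using h3⟩
  rw [hasUnitSpeedOn_Icc_iff] at h1 ⊢
  intro x y hx hxy hy
  have h5 := eVariationOn.comp_eq_of_antitoneOn γ (t := Set.Icc x y) (fun t => l - t)
    fun a _ b _ hab => sub_le_sub_left hab l
  rw [Set.image_const_sub_Icc, h1 _ _ (by linarith) (by linarith) (by linarith)] at h5
  rw [show y - x = l - x - (l - y) by ring]
  exact h5

theorem trans (h : Reach P p q l) (h' : Reach P q r m) : Reach P p r (l + m) := by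
  obtain ⟨hl, γ, h1, h2, h3, h4⟩ := h
  obtain ⟨hm, δ, k1, k2, k3, k4⟩ := h'
  set ρ : ℝ → Plane := fun t => if t ≤ l then γ t else δ (t - l) with hρ
  have hρ1 : ∀ t ≤ l, ρ t = γ t := fun t ht => if_pos ht
  have hρ2 : ∀ t, l ≤ t → ρ t = δ (t - l) := by
    intro t ht
    rcases ht.eq_or_lt with rfl | ht
    · rw [hρ1 _ le_rfl, sub_self, h4, k3]
    · exact if_neg (not_le.2 ht)
  refine ⟨add_nonneg hl hm, ρ, ?_, ?_, by rw [hρ1 _ hl, h3],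
    by rw [hρ2 _ (by linarith), add_sub_cancel_left, k4]⟩
  · refine HasUnitSpeedOn.Icc_Icc (y := l) ?_ ?_
    · rw [hasUnitSpeedOn_Icc_iff] at h1 ⊢
      intro x y hx hxy hy
      rw [← h1 x y hx hxy hy]
      exact eVariationOn.eq_of_eqOn fun t ht => hρ1 t (ht.2.trans hy)
    · rw [hasUnitSpeedOn_Icc_iff] at k1 ⊢
      intro x y hx hxy hy
      have h5 := eVariationOn.comp_eq_of_monotoneOn δ (t := Set.Icc x y) (fun t => t - l)
        fun a _ b _ hab => sub_le_sub_right hab l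
      rw [Set.image_sub_const_Icc, k1 _ _ (by linarith) (by linarith) (by linarith)] at h5
      rw [show y - x = y - l - (x - l) by ring, ← h5]
      exact eVariationOn.eq_of_eqOn fun t ht => hρ2 t (hx.trans ht.1)
  · intro t ht
    rcases le_total t l with h5 | h5
    · rw [hρ1 t h5]; exact h2 ⟨ht.1, h5⟩
    · rw [hρ2 t h5]; exact k2 ⟨by linarith, by linarith [ht.2]⟩

theorem of_segment (h : segment ℝ p q ⊆ P) : Reach P p q (dist p q) := by
  rcases eq_or_ne p q with rfl | hpq
  · refine ⟨dist_nonneg, fun _ => p, ?_, fun t _ => h (left_mem_segment ℝ _ _), rfl, rfl⟩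
    rw [dist_self]
    exact hasConstantSpeedOnWith_of_subsingleton _ (by simp) _
  have hd : 0 < dist p q := dist_pos.2 hpq
  set u : Plane := (1 / dist p q) • (q - p) with hu
  have hun : ‖u‖ = 1 := by
    rw [hu, norm_smul, Real.norm_of_nonneg (by positivity), ← dist_eq_norm, dist_comm q p]
    field_simp
  have hdist : ∀ s t : ℝ, dist (p + s • u) (p + t • u) = |s - t| := by
    intro s t
    rw [dist_eq_norm, show p + s • u - (p + t • u) = (s - t) • u by module, norm_smul, hun,
      mul_one, Real.norm_eq_abs]
  refine ⟨dist_nonneg, fun t => p + t • u, ?_, ?_, by simp, ?_⟩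
  · rw [hasUnitSpeedOn_Icc_iff]
    intro x y hx hxy hy
    apply le_antisymm
    · have h1 : LipschitzOnWith 1 (fun t : ℝ => p + t • u) Set.univ :=
        LipschitzOnWith.of_dist_le_mul fun s _ t _ => by
          rw [hdist, NNReal.coe_one, one_mul, Real.dist_eq]
      have h2 := h1.comp_eVariationOn_le (g := id) (s := Set.Icc x y) (Set.mapsTo_univ _ _)
      have h3 := ((monotone_id (α := ℝ)).monotoneOn (Set.Icc x y)).eVariationOn_eq (Set.left_mem_Icc.2 hxy)
        (Set.right_mem_Icc.2 hxy)
      rw [Set.inter_self] at h3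
      refine h2.trans ?_
      rw [ENNReal.coe_one, one_mul]
      exact h3.le
    · have h1 := eVariationOn.edist_le (fun t : ℝ => p + t • u) (Set.left_mem_Icc.2 hxy)
        (Set.right_mem_Icc.2 hxy)
      rw [edist_dist, hdist, abs_sub_comm, abs_of_nonneg (sub_nonneg.2 hxy)] at h1
      exact h1
  · intro t ht
    apply h
    rw [segment_eq_image']
    refine ⟨t / dist p q, ⟨div_nonneg ht.1 hd.le, by rw [div_le_one hd]; exact ht.2⟩, ?_⟩
    simp only [hu, smul_smul]
    ring_nf
  · simp only [hu, smul_smul]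
    rw [mul_one_div_cancel hd.ne', one_smul, add_sub_cancel]

theorem intrinsicDist_le (h : Reach P p q l) : intrinsicDist P p q ≤ ENNReal.ofReal l := by
  obtain ⟨hl, γ, h1, h2, h3, h4⟩ := h
  lift l to ℝ≥0 using hl
  exact sInf_le ⟨l, γ, by rw [ENNReal.ofReal_coe_nnreal], h1, h2, h3, h4⟩

end Reach

/-- Every curve in `P` from `x` to a point of `c` has length at least `L`. -/
def Far (P : Set Plane) (x : Plane) (c : Set Plane) (L : ℝ) : Prop :=
  ∀ p ∈ c, ∀ l, Reach P x p l → L ≤ l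

namespace Far

variable {P c : Set Plane} {x : Plane} {L : ℝ}

theorem mono_set {P' : Set Plane} (h : Far P x c L) (hP : P' ⊆ P) : Far P' x c L :=
  fun p hp l hl => h p hp l (hl.mono hP)

theorem mono {L' : ℝ} (h : Far P x c L) (hL : L' ≤ L) : Far P x c L' :=
  fun p hp l hl => hL.trans (h p hp l hl)

theorem le_dist (h : Far P x c L) {p : Plane} (hp : p ∈ c) (hs : segment ℝ p x ⊆ P) :
    L ≤ dist p x := h p hp _ (Reach.of_segment hs).symm

theorem le_intrinsicDist (h : Far P x c L) {p : Plane} (hp : p ∈ c) :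
    ENNReal.ofReal L ≤ intrinsicDist P x p := by
  refine le_sInf ?_
  rintro _ ⟨l, γ, rfl, h1, h2, h3, h4⟩
  rw [← ENNReal.ofReal_coe_nnreal]
  exact ENNReal.ofReal_le_ofReal (h p hp l ⟨l.2, γ, h1, h2, h3, h4⟩)

theorem le_intrinsicDiam (h : Far P x c L) (hx : x ∈ P) {p : Plane} (hp : p ∈ c) (hpP : p ∈ P) :
    ENNReal.ofReal L ≤ intrinsicDiam P :=
  (h.le_intrinsicDist hp).trans
    ((le_iSup₂_of_le p hpP le_rfl).trans (le_iSup₂_of_le (f := fun p _ => ⨆ q ∈ P,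
      intrinsicDist P p q) x hx le_rfl))

/-- The side `[v; u]` of a triangle in `P` is at most `|u - u₀|` closer than the side `[v; w]`
with the point `u₀`. -/
theorem side {v w u u₀ : Plane} (h : Far P x (segment ℝ v w) L) (hT : tri v w u ⊆ P)
    (hu₀ : u₀ ∈ segment ℝ v w) : Far P x (segment ℝ v u) (L - dist u u₀) := by
  intro p hp l hl
  rw [segment_eq_image'] at hp
  obtain ⟨t, ⟨ht0, ht1⟩, rfl⟩ := hp
  have hv : v ∈ segment ℝ v w := left_mem_segment ℝ v w
  have hq : v + t • (u₀ - v) ∈ segment ℝ v w :=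
    (convex_segment v w).segment_subset hv hu₀ (by
      rw [segment_eq_image']; exact ⟨t, ⟨ht0, ht1⟩, rfl⟩)
  have hpT : v + t • (u - v) ∈ tri v w u :=
    (convex_tri v w u).segment_subset (left_mem_tri _ _ _) (right_mem_tri _ _ _) (by
      rw [segment_eq_image']; exact ⟨t, ⟨ht0, ht1⟩, rfl⟩)
  have hs : segment ℝ (v + t • (u - v)) (v + t • (u₀ - v)) ⊆ P :=
    ((convex_tri v w u).segment_subset hpT (segment_subset_tri_left hq)).trans hT
  have h1 := h _ hq _ (hl.trans (Reach.of_segment hs))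
  have h2 : dist (v + t • (u - v)) (v + t • (u₀ - v)) ≤ dist u u₀ := by
    rw [dist_eq_norm, dist_eq_norm,
      show v + t • (u - v) - (v + t • (u₀ - v)) = t • (u - u₀) by module, norm_smul,
      Real.norm_of_nonneg ht0]
    nlinarith [norm_nonneg (u - u₀)]
  linarith

theorem side' {v w u u₀ : Plane} (h : Far P x (segment ℝ v w) L) (hT : tri v w u ⊆ P)
    (hu₀ : u₀ ∈ segment ℝ v w) : Far P x (segment ℝ u w) (L - dist u u₀) := by
  rw [segment_symm]
  rw [segment_symm] at h hu₀
  rw [tri_swap] at hT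
  exact h.side hT hu₀

end Far

/-- If one part of a partition has a large intrinsic diameter, then it contains a point
that is far from the cut, and remains so in the whole polygon. -/
theorem InducesPartition.exists_far {P Q₁ Q₂ : Set Plane} {v w : Plane}
    (h : InducesPartition P v w Q₁ Q₂) {M : ℝ} (hM : ENNReal.ofReal M < intrinsicDiam Q₁) :
    ∃ x ∈ Q₁, Far P x (segment ℝ v w) ((M - dist v w) / 2) := by
  unfold intrinsicDiam at hM
  simp only [lt_iSup_iff] at hM
  obtain ⟨p, hp, q, hq, hpq⟩ := hM
  set L := (M - dist v w) / 2 with hL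
  have h1 : ∃ x ∈ Q₁, Far Q₁ x (segment ℝ v w) L := by
    by_contra hno
    push Not at hno
    have hp' := hno p hp
    have hq' := hno q hq
    unfold Far at hp' hq'
    push Not at hp' hq'
    obtain ⟨a, ha, l, hl, hlL⟩ := hp'
    obtain ⟨b, hb, m, hm, hmL⟩ := hq'
    have hab : segment ℝ a b ⊆ segment ℝ v w := (convex_segment v w).segment_subset ha hb
    have h2 := (hl.trans (Reach.of_segment (hab.trans h.seg_left))).trans hm.symm
    have h3 : dist a b ≤ dist v w := by
      rw [segment_eq_image'] at ha hb
      obtain ⟨s, ⟨hs0, hs1⟩, rfl⟩ := ha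
      obtain ⟨t, ⟨ht0, ht1⟩, rfl⟩ := hb
      simp only
      rw [dist_eq_norm, dist_comm, dist_eq_norm,
        show v + s • (w - v) - (v + t • (w - v)) = (s - t) • (w - v) by module, norm_smul,
        Real.norm_eq_abs]
      have : |s - t| ≤ 1 := abs_sub_le_iff.2 ⟨by linarith, by linarith⟩
      nlinarith [norm_nonneg (w - v)]
    refine absurd (hpq.trans_le (h2.intrinsicDist_le.trans (ENNReal.ofReal_le_ofReal ?_)))
      (lt_irrefl _)
    linarith
  obtain ⟨x, hx, hfar⟩ := h1
  refine ⟨x, hx, fun p hp l hl => ?_⟩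
  obtain ⟨hl0, γ, k1, k2, k3, k4⟩ := hl
  -- the part of the curve up to its first point on the cut stays in `Q₁`
  have hcont := k1.continuousOn
  have hcomp : IsCompact (Set.Icc 0 l ∩ γ ⁻¹' segment ℝ v w) :=
    isCompact_Icc.of_isClosed_subset
      (hcont.preimage_isClosed_of_isClosed isClosed_Icc (isClosed_segment v w))
      Set.inter_subset_left
  obtain ⟨t, ⟨⟨ht0, htl⟩, htc⟩, hmin⟩ := hcomp.exists_isLeast ⟨l, ⟨hl0, le_rfl⟩, by
    show γ l ∈ segment ℝ v w
    rw [k4]; exact hp⟩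
  have hmaps : Set.MapsTo γ (Set.Icc 0 t) Q₁ := by
    intro s hs
    rcases hs.2.eq_or_lt with rfl | hst
    · exact h.seg_left htc
    · by_contra hsQ
      have hsP : γ s ∈ P := k2 ⟨hs.1, hs.2.trans htl⟩
      rw [h.union_eq] at hsP
      have hsub : Set.Icc 0 s ⊆ Set.Icc 0 l := Set.Icc_subset_Icc le_rfl (hs.2.trans htl)
      obtain ⟨y, ⟨r, hr, rfl⟩, hy2⟩ := h.separates hx (hsP.resolve_left hsQ)
        (γ '' Set.Icc 0 s) (isPreconnected_Icc.image γ (hcont.mono hsub))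
        (Set.image_subset_iff.2 fun r hr => k2 (hsub hr)) ⟨0, ⟨le_rfl, hs.1⟩, k3⟩
        ⟨s, ⟨hs.1, le_rfl⟩, rfl⟩
      exact absurd (hmin ⟨hsub hr, hy2⟩) (not_le.2 (hr.2.trans_lt hst))
  refine (hfar (γ t) htc t ⟨ht0, γ, ?_, hmaps, k3, rfl⟩).trans htl
  rw [hasUnitSpeedOn_Icc_iff] at k1 ⊢
  exact fun x y hx hxy hy => k1 x y hx hxy (hy.trans htl)

/-! ### Coordinates adapted to a segment -/

/-- The point with coordinates `x`, `y` in the frame with origin `v`, in which `w` is the first unit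
vector. -/
noncomputable def pt (v w : Plane) (x y : ℝ) : Plane := v + x • (w - v) + y • rot (w - v)

theorem rot_neg (d : Plane) : rot (-d) = -rot d := by
  apply plane_ext <;> simp [rot_zero, rot_one]

theorem norm_comb_rot_sq (d : Plane) (x y : ℝ) :
    ‖x • d + y • rot d‖ ^ 2 = (x ^ 2 + y ^ 2) * ‖d‖ ^ 2 := by
  rw [EuclideanSpace.norm_sq_eq, EuclideanSpace.norm_sq_eq]
  simp [Fin.sum_univ_two, rot_zero, rot_one]
  ring

section frame

variable {v w : Plane} {x y x' y' : ℝ}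

theorem pt_zero : pt v w 0 0 = v := by simp [pt]

theorem pt_one : pt v w 1 0 = w := by simp [pt]

theorem pt_swap (v w : Plane) (x y : ℝ) : pt w v x y = pt v w (1 - x) (-y) := by
  unfold pt
  rw [← neg_sub w v, rot_neg]
  module

theorem dist_pt_le {c : ℝ} (hc : 0 ≤ c) (h : (x - x') ^ 2 + (y - y') ^ 2 ≤ c ^ 2) :
    dist (pt v w x y) (pt v w x' y') ≤ c * dist v w := by
  have e : pt v w x y - pt v w x' y' = (x - x') • (w - v) + (y - y') • rot (w - v) := by
    unfold pt; module
  rw [dist_comm v w, dist_eq_norm, dist_eq_norm, e]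
  refine (pow_le_pow_iff_left₀ (norm_nonneg _) (by positivity) two_ne_zero).1 ?_
  rw [norm_comb_rot_sq, mul_pow]
  exact mul_le_mul_of_nonneg_right h (by positivity)

theorem dist_pt_left_le {c : ℝ} (hc : 0 ≤ c) (h : x ^ 2 + y ^ 2 ≤ c ^ 2) :
    dist (pt v w x y) v ≤ c * dist v w := by
  have h1 := dist_pt_le (v := v) (w := w) (x := x) (y := y) (x' := 0) (y' := 0) hc (by simpa using h)
  rwa [pt_zero] at h1

theorem dist_pt_right_le {c : ℝ} (hc : 0 ≤ c) (h : (1 - x) ^ 2 + y ^ 2 ≤ c ^ 2) :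
    dist (pt v w x y) w ≤ c * dist v w := by
  have h1 := dist_pt_le (v := v) (w := w) (x := x) (y := y) (x' := 1) (y' := 0) hc
    (by rw [sub_zero]; linarith [sq_nonneg (x - 1), (by ring : (x - 1) ^ 2 = (1 - x) ^ 2)])
  rwa [pt_one] at h1

theorem sq_le_of_dist_pt_le {c : ℝ} (hvw : v ≠ w)
    (h : dist (pt v w x y) (pt v w x' y') ≤ c * dist v w) :
    (x - x') ^ 2 + (y - y') ^ 2 ≤ c ^ 2 := by
  have e : pt v w x y - pt v w x' y' = (x - x') • (w - v) + (y - y') • rot (w - v) := by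
    unfold pt; module
  rw [dist_comm v w, dist_eq_norm, dist_eq_norm, e] at h
  have h1 := pow_le_pow_left₀ (norm_nonneg _) h 2
  rw [norm_comb_rot_sq, mul_pow] at h1
  have : 0 < ‖w - v‖ := norm_pos_iff.2 (sub_ne_zero.2 hvw.symm)
  exact le_of_mul_le_mul_right h1 (by positivity)

theorem det_pt : det (w - v) (pt v w x y - v) = y * det (w - v) (rot (w - v)) := by
  unfold pt
  rw [add_assoc, add_sub_cancel_left, det_add_right, det_smul_right, det_smul_right, det_self]
  ring

theorem det_pt_ne_zero (hvw : v ≠ w) (hy : y ≠ 0) : det (w - v) (pt v w x y - v) ≠ 0 := by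
  rw [det_pt]
  exact mul_ne_zero hy (det_rot_pos (sub_ne_zero.2 hvw.symm)).ne'

theorem exists_pt (hvw : v ≠ w) (u : Plane) : ∃ x y, u = pt v w x y := by
  have hd := (det_rot_pos (sub_ne_zero.2 hvw.symm)).ne'
  have h := cramer hd (u - v)
  refine ⟨det (u - v) (rot (w - v)) / det (w - v) (rot (w - v)),
    det (w - v) (u - v) / det (w - v) (rot (w - v)), ?_⟩
  unfold pt
  rw [add_assoc, ← h, add_sub_cancel]

theorem pt_comb (s t : ℝ) :
    v + s • (w - v) + t • (pt v w x y - v) = pt v w (s + t * x) (t * y) := by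
  unfold pt; module

theorem pt_mem_segment (h0 : 0 ≤ x) (h1 : x ≤ 1) : pt v w x 0 ∈ segment ℝ v w := by
  rw [segment_eq_image']
  exact ⟨x, ⟨h0, h1⟩, by simp [pt]⟩

/-- The points at which the segment from `v` to `w` is seen with slopes at most `σ` from both of
its endpoints. -/
def region (σ : ℝ) (v w : Plane) : Set Plane :=
  {u | ∃ x y : ℝ, u = pt v w x y ∧ |y| ≤ σ * x ∧ |y| ≤ σ * (1 - x)}

theorem tri_subset_region {σ : ℝ} (hσ : 0 ≤ σ) {b : Plane} (hb : b ∈ region σ v w) :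
    tri v w b ⊆ region σ v w := by
  obtain ⟨x, y, rfl, h1, h2⟩ := hb
  intro u hu
  obtain ⟨s, t, hs, ht, hst, rfl⟩ := mem_tri_iff.1 hu
  refine ⟨s + t * x, t * y, pt_comb s t, ?_, ?_⟩
  · rw [abs_mul, abs_of_nonneg ht]
    nlinarith [mul_le_mul_of_nonneg_left h1 ht, mul_nonneg hσ hs]
  · rw [abs_mul, abs_of_nonneg ht]
    nlinarith [mul_le_mul_of_nonneg_left h2 ht, mul_nonneg hσ (by linarith : 0 ≤ 1 - s - t)]

theorem tri_subset_closedBall {a b c : Plane} {r : ℝ} (hb : dist a b ≤ r) (hc : dist a c ≤ r) :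
    tri a b c ⊆ Metric.closedBall a r :=
  tri_subset (convex_closedBall a r) (Metric.mem_closedBall_self (dist_nonneg.trans hb))
    (by rwa [Metric.mem_closedBall, dist_comm]) (by rwa [Metric.mem_closedBall, dist_comm])

end frame

/-! ### Admissible and extremal chords -/

open Classical in
/-- The weight of the endpoint `b` of a chord. It is larger unless `b` is a concave vertex, so that a
chord between two concave vertices counts as short even if it is slightly longer than another one
with an endpoint that is not a concave vertex. -/
noncomputable def weight (P : Set Plane) (b : Plane) : ℝ := if b ∈ concaveVertices P then 1 else 5 / 4

/-- The weighted length of a chord. -/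
noncomputable def wlen (P : Set Plane) (a b : Plane) : ℝ := weight P b * dist a b

/-- The set `c` separates `x` and `y` and is far from both of them. -/
def FarSep (P : Set Plane) (x y : Plane) (c : Set Plane) (L : ℝ) : Prop :=
  Separates P c x y ∧ Far P x c L ∧ Far P y c L

/-- A chord that separates `x` and `y` and is far from them. The required distance increases with the
length of the chord: in passing to a shorter chord nearby, the distance from `x` or `y` may decrease,
and the factor `10` makes up for this. -/
def Admissible (P : Set Plane) (x y : Plane) (K : ℝ) (a b : Plane) : Prop :=
  IsChord P a b ∧ FarSep P x y (segment ℝ a b) (K + 10 * wlen P a b)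

theorem one_le_weight (P : Set Plane) (b : Plane) : 1 ≤ weight P b := by
  unfold weight; split_ifs <;> norm_num

theorem weight_le (P : Set Plane) (b : Plane) : weight P b ≤ 5 / 4 := by
  unfold weight; split_ifs <;> norm_num

theorem weight_of_mem {P : Set Plane} {b : Plane} (h : b ∈ concaveVertices P) : weight P b = 1 :=
  if_pos h

theorem weight_of_notMem {P : Set Plane} {b : Plane} (h : b ∉ concaveVertices P) :
    weight P b = 5 / 4 := if_neg h

theorem dist_le_wlen (P : Set Plane) (a b : Plane) : dist a b ≤ wlen P a b := by
  have := one_le_weight P b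
  have := dist_nonneg (x := a) (y := b)
  unfold wlen; nlinarith

theorem wlen_le (P : Set Plane) (a b : Plane) : wlen P a b ≤ 5 / 4 * dist a b :=
  mul_le_mul_of_nonneg_right (weight_le P b) dist_nonneg

theorem FarSep.mono {P c : Set Plane} {x y : Plane} {L L' : ℝ} (h : FarSep P x y c L)
    (hL : L' ≤ L) : FarSep P x y c L' := ⟨h.1, h.2.1.mono hL, h.2.2.mono hL⟩

/-- A chord that separates two far points does not cut off a part of a small triangle. -/
theorem FarSep.false_of_ear {P : Set Plane} {x y v w a : Plane} {L : ℝ} {Q₁ Q₂ : Set Plane}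
    (h : FarSep P x y (segment ℝ v w) L) (hx : x ∈ P) (hy : y ∈ P)
    (hpart : InducesPartition P v w Q₁ Q₂) (hQ : ∀ q ∈ Q₁, q ∈ tri v w a ∧ tri v w q ⊆ P) {r : ℝ}
    (hr0 : 0 ≤ r) (hr : r < L) (hw : dist v w ≤ r) (ha : dist v a ≤ r) : False := by
  obtain ⟨hs, hfx, hfy⟩ := h
  have key : ∀ z, Far P z (segment ℝ v w) L → z ∉ Q₁ := by
    intro z hz hzQ
    obtain ⟨h1, h2⟩ := hQ z hzQ
    have h3 := hz.le_dist (left_mem_segment ℝ v w)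
      (((convex_tri v w z).segment_subset (left_mem_tri _ _ _) (right_mem_tri _ _ _)).trans h2)
    have h4 := tri_subset_closedBall hw ha h1
    rw [Metric.mem_closedBall, dist_comm] at h4
    linarith
  have hnot : ∀ z ∈ P, Far P z (segment ℝ v w) L → z ∉ segment ℝ v w := by
    intro z hzP hz hzc
    have h3 := hz.le_dist hzc (by rw [segment_same]; exact Set.singleton_subset_iff.2 hzP)
    rw [dist_self] at h3
    linarith
  rcases hpart.mem_of_separates hs hx hy (hnot x hx hfx) (hnot y hy hfy) with h1 | h1
  · exact key x hfx h1.1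
  · exact key y hfy h1.2

/-- A step from a chord to one of the other sides of a nice triangle. -/
theorem FarSep.transition {P : Set Plane} (hP : IsPolygon P) {x y v w u u₀ : Plane} {L : ℝ}
    (hc : IsChord P v w) (h : FarSep P x y (segment ℝ v w) L) (hx : x ∈ P) (hy : y ∈ P)
    (hu : u ∈ frontier P) (hn : NiceTri P v w u) (hu₀ : u₀ ∈ segment ℝ v w)
    {r : ℝ} (hr : r < L) (hw : dist v w ≤ r) (hur : dist v u ≤ r) :
    (IsChord P v u ∧ FarSep P x y (segment ℝ v u) (L - dist u u₀)) ∨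
      (IsChord P u w ∧ FarSep P x y (segment ℝ u w) (L - dist u u₀)) := by
  obtain ⟨hs, hfx, hfy⟩ := h
  have key : ∀ z, Far P z (segment ℝ v w) L → z ∉ tri v w u := by
    intro z hz hzT
    have h3 := hz.le_dist (left_mem_segment ℝ v w)
      (((convex_tri v w u).segment_subset (left_mem_tri _ _ _) hzT).trans hn.2.1)
    have h4 := tri_subset_closedBall hw hur hzT
    rw [Metric.mem_closedBall, dist_comm] at h4
    linarith
  rcases hc.transition hP hs hx hy hu hn (key x hfx) (key y hfy) with h1 | h1
  · exact Or.inl ⟨h1.1, h1.2, hfx.side hn.2.1 hu₀, hfy.side hn.2.1 hu₀⟩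
  · exact Or.inr ⟨h1.1, h1.2, hfx.side' hn.2.1 hu₀, hfy.side' hn.2.1 hu₀⟩

/-- An admissible chord from a concave vertex whose weighted length is minimal among the admissible
chords between concave vertices or with the same second endpoint, and almost minimal among all the
admissible chords from concave vertices. -/
structure Extremal (P : Set Plane) (x y : Plane) (K : ℝ) (v w : Plane) : Prop where
  polygon : IsPolygon P
  hx : x ∈ P
  hy : y ∈ P
  hK : 0 ≤ K
  concave : v ∈ concaveVertices P
  adm : Admissible P x y K v w
  min_concave : ∀ a ∈ concaveVertices P, ∀ b ∈ concaveVertices P, Admissible P x y K a b →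
    wlen P v w ≤ wlen P a b
  min_right : ∀ a ∈ concaveVertices P, Admissible P x y K a w → wlen P v w ≤ wlen P a w
  min_all : ∀ a ∈ concaveVertices P, ∀ b ∈ frontier P, Admissible P x y K a b →
    wlen P v w ≤ 11 / 10 * wlen P a b

namespace Extremal

variable {P : Set Plane} {x y v w : Plane} {K : ℝ}

theorem chord (E : Extremal P x y K v w) : IsChord P v w := E.adm.1

theorem ne (E : Extremal P x y K v w) : v ≠ w := E.adm.1.2.2.1

theorem dist_pos (E : Extremal P x y K v w) : 0 < dist v w := _root_.dist_pos.2 E.ne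

theorem symm (E : Extremal P x y K v w) (hw : w ∈ concaveVertices P) : Extremal P x y K w v := by
  have hlen : wlen P w v = wlen P v w := by
    unfold wlen; rw [weight_of_mem hw, weight_of_mem E.concave, dist_comm]
  refine ⟨E.polygon, E.hx, E.hy, E.hK, hw, ⟨E.chord.symm, ?_⟩, ?_, ?_, ?_⟩
  · rw [hlen, segment_symm]; exact E.adm.2
  · rw [hlen]; exact E.min_concave
  · rw [hlen]; exact fun a ha h => E.min_concave a ha v E.concave h
  · rw [hlen]; exact E.min_all

theorem interior_left (E : Extremal P x y K v w) :
    ∃ ε > 0, ∀ s : ℝ, 0 < s → s ≤ ε → v + s • (w - v) ∈ interior P := by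
  refine ⟨1 / 2, by norm_num, fun s hs0 hs => E.chord.2.2.2 ?_⟩
  rw [openSegment_eq_image']
  exact ⟨s, ⟨hs0, by linarith⟩, rfl⟩

theorem interior_right (E : Extremal P x y K v w) :
    ∃ ε > 0, ∀ s : ℝ, 0 < s → s ≤ ε → w + s • (v - w) ∈ interior P := by
  refine ⟨1 / 2, by norm_num, fun s hs0 hs => E.chord.2.2.2 ?_⟩
  rw [openSegment_symm, openSegment_eq_image']
  exact ⟨s, ⟨hs0, by linarith⟩, rfl⟩

/-- A nice triangle whose apex is a concave vertex seen under small slopes would lead to a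
shorter chord. -/
theorem not_niceTri (E : Extremal P x y K v w) {u : Plane} (hu : u ∈ concaveVertices P)
    (hreg : u ∈ region 1 v w) (hn : NiceTri P v w u) : False := by
  obtain ⟨X, Y, rfl, h1, h2⟩ := hreg
  rw [one_mul] at h1 h2
  have hl := E.dist_pos
  have hY : 0 < |Y| := by
    rw [abs_pos]
    rintro rfl
    have := hn.1
    rw [det_pt, zero_mul] at this
    exact this rfl
  have hY2 : Y ^ 2 = |Y| ^ 2 := (sq_abs Y).symm
  have d1 : dist v (pt v w X Y) ≤ (1 - |Y| / 2) * dist v w := by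
    rw [dist_comm v]
    exact dist_pt_left_le (by linarith) (by nlinarith)
  have d2 : dist (pt v w X Y) w ≤ (1 - |Y| / 2) * dist v w :=
    dist_pt_right_le (by linarith) (by nlinarith)
  have d3 : dist (pt v w X Y) (pt v w X 0) ≤ |Y| * dist v w :=
    dist_pt_le hY.le (by simp)
  have hwl := dist_le_wlen P v w
  have hYl := mul_pos hY hl
  have hwt := one_le_weight P w
  rcases E.adm.2.transition E.polygon E.chord E.hx E.hy hu.1.1 hn
    (pt_mem_segment (v := v) (w := w) (x := X) (by linarith) (by linarith)) (r := dist v w)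
    (by linarith [E.hK]) le_rfl (d1.trans (by nlinarith)) with ⟨h3, h4⟩ | ⟨h3, h4⟩
  · have e : wlen P v (pt v w X Y) = dist v (pt v w X Y) := by
      unfold wlen; rw [weight_of_mem hu, one_mul]
    have := E.min_concave v E.concave _ hu ⟨h3, h4.mono (by rw [e]; nlinarith)⟩
    rw [e] at this
    nlinarith
  · have e : wlen P (pt v w X Y) w ≤ (1 - |Y| / 2) * wlen P v w := by
      unfold wlen; nlinarith
    have e2 : |Y| * dist v w ≤ |Y| * wlen P v w := mul_le_mul_of_nonneg_left hwl hY.le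
    have := E.min_right _ hu ⟨h3, h4.mono (by nlinarith)⟩
    nlinarith

/-- Visible points seen under small slopes are the apices of nice triangles, and are not concave. -/
theorem niceTri_of_visible (E : Extremal P x y K v w) {p z : Plane} (hp : p ∈ segment ℝ v w)
    (hd : det (w - v) (z - v) ≠ 0) (hpz : segment ℝ p z ⊆ P)
    (hloc : ∀ᶠ x in nhds p, x ∈ tri v w z → x ∈ P) (hz : z ∈ region 1 v w) :
    NiceTri P v w z ∧ z ∉ concaveVertices P := by
  rcases E.polygon.exists_niceTri E.chord hp hd hpz hloc with h | ⟨u, h1, h2, h3⟩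
  · exact ⟨h, fun hzc => E.not_niceTri hzc hz h⟩
  · exact (E.not_niceTri h1 (tri_subset_region zero_le_one hz h2) h3).elim

end Extremal

/-! ### Boundary directions at the endpoints of an extremal chord -/

/-- A ray that starts in the interior either stays there up to time `1` or has a first contact with
the boundary. -/
theorem exists_first_contact {P : Set Plane} (hP : IsPolygon P) {v d : Plane} {ε : ℝ}
    (hε : 0 < ε) (h : ∀ s : ℝ, 0 < s → s ≤ ε → v + s • d ∈ interior P) :
    (∀ t : ℝ, 0 < t → t ≤ 1 → v + t • d ∈ interior P) ∨
      ∃ t : ℝ, 0 < t ∧ t ≤ 1 ∧ v + t • d ∈ frontier P ∧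
        ∀ s : ℝ, 0 < s → s < t → v + s • d ∈ interior P := by
  by_cases hall : ∀ t : ℝ, 0 < t → t ≤ 1 → v + t • d ∈ interior P
  · exact Or.inl hall
  · right
    push Not at hall
    obtain ⟨t₁, h0, h1, h2⟩ := hall
    have hg : Continuous fun t : ℝ => v + t • d := by fun_prop
    have hcomp : IsCompact (Set.Icc ε 1 ∩ (fun t : ℝ => v + t • d) ⁻¹' (interior P)ᶜ) :=
      isCompact_Icc.inter_right (isOpen_interior.isClosed_compl.preimage hg)
    have hεt : ε ≤ t₁ := by
      by_contra hlt
      exact h2 (h t₁ h0 (not_le.1 hlt).le)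
    obtain ⟨t, ⟨⟨k1, k2⟩, k3⟩, k4⟩ := hcomp.exists_isLeast ⟨t₁, ⟨hεt, h1⟩, h2⟩
    have k3 : v + t • d ∉ interior P := k3
    have ht0 : 0 < t := hε.trans_le k1
    have hlt : ∀ s : ℝ, 0 < s → s < t → v + s • d ∈ interior P := by
      intro s hs0 hst
      rcases le_total s ε with h5 | h5
      · exact h s hs0 h5
      · by_contra h6
        exact absurd (k4 ⟨⟨h5, by linarith⟩, h6⟩) (not_le.2 hst)
    have h5 : v + t • d ∈ P := by
      refine hP.isClosed.mem_of_tendsto (b := nhdsWithin t (Set.Iio t))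
        (hg.tendsto t |>.mono_left nhdsWithin_le_nhds) ?_
      filter_upwards [Ioo_mem_nhdsLT ht0] with s hs
      exact interior_subset (hlt s hs.1 hs.2)
    exact ⟨t, ht0, k2, (hP.mem_interior_or_frontier h5).resolve_left k3, hlt⟩

namespace Extremal

variable {P : Set Plane} {x y v w : Plane} {K : ℝ}

/-- The polygon does not end in a triangle on an extremal chord. -/
theorem false_of_endCond (E : Extremal P x y K v w) {a : Plane} (hd : det (w - v) (a - v) ≠ 0)
    (hv : EndCond P v a) (hw : EndCond P w a) (ha : dist v a ≤ 9 * dist v w)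
    (hno : ∀ u ∈ concaveVertices P, u ∈ tri v w a → ¬ NiceTri P v w u) : False := by
  obtain ⟨Q₁, Q₂, h1, h2⟩ := E.polygon.exists_ear E.chord hd hv hw hno
  have hl := E.dist_pos
  refine E.adm.2.false_of_ear E.hx E.hy h1 h2 (r := 9 * dist v w) (by positivity) ?_ (by linarith)
    ha
  linarith [E.hK, dist_le_wlen P v w]

/-- Let `b = pt v w x₀ y₀` be the point in which a boundary direction at `w`, at an angle of at most
45° with the chord, meets the ray of slope 45° from `v`. The segment from `v` to `b` does not hit
the boundary: one of the segments from the first contact to `v` and `w` would be a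
separating chord, but the former is too short and the latter cuts off a part of a triangle. -/
theorem no_contact (E : Extremal P x y K v w) {x₀ y₀ : ℝ} (hy₀ : y₀ ≠ 0) (hxy : |y₀| = x₀)
    (hx₀ : x₀ ≤ 1 / 2) (hedge : EdgeDir P w (pt v w x₀ y₀ - w))
    (hloc : LocalCone P w (v - w) (pt v w x₀ y₀ - w))
    (hcone : LocalCone P v (w - v) (pt v w x₀ y₀ - v)) {t : ℝ} (ht0 : 0 < t) (ht1 : t ≤ 1)
    (he : v + t • (pt v w x₀ y₀ - v) ∈ frontier P)
    (hint : ∀ s : ℝ, 0 < s → s < t → v + s • (pt v w x₀ y₀ - v) ∈ interior P) : False := by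
  set b := pt v w x₀ y₀ with hb
  have hP := E.polygon
  have hl := E.dist_pos
  have hd : det (w - v) (b - v) ≠ 0 := det_pt_ne_zero E.ne hy₀
  have hx₀pos : 0 < x₀ := hxy ▸ abs_pos.2 hy₀
  have hbreg : b ∈ region 1 v w := ⟨x₀, y₀, rfl, by linarith, by linarith⟩
  set e := v + t • (b - v) with hedef
  have hvb : segment ℝ v b ⊆ tri v w b :=
    (convex_tri _ _ _).segment_subset (left_mem_tri _ _ _) (right_mem_tri _ _ _)
  have heT : e ∈ tri v w b := hvb (by
    rw [segment_eq_image']; exact ⟨t, ⟨ht0.le, ht1⟩, rfl⟩)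
  have hept : e = pt v w (t * x₀) (t * y₀) := by rw [hedef, hb]; unfold pt; module
  have hopen : openSegment ℝ v e ⊆ interior P := by
    rw [openSegment_eq_image']
    rintro z ⟨s, ⟨hs0, hs1⟩, rfl⟩
    simp only
    rw [hedef, add_sub_cancel_left, smul_smul]
    exact hint _ (by positivity) (by nlinarith)
  have hseg : segment ℝ v e ⊆ P := by
    rw [segment_eq_insert_openSegment]
    rintro z (rfl | rfl | hz)
    · exact hP.frontier_subset E.concave.1.1
    · exact hP.frontier_subset he
    · exact interior_subset (hopen hz)
  have hde : det (w - v) (e - v) ≠ 0 := by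
    rw [hept]; exact det_pt_ne_zero E.ne (mul_ne_zero ht0.ne' hy₀)
  have hev := hcone.eventually_tri (hP.frontier_subset E.concave.1.1) hd
  obtain ⟨hnice, heC⟩ := E.niceTri_of_visible (left_mem_segment ℝ v w) hde hseg
    (hev.mono fun z hz hzT => hz (tri_mono (left_mem_tri _ _ _) (mid_mem_tri _ _ _) heT hzT))
    (tri_subset_region zero_le_one hbreg heT)
  have hty : t * x₀ ≤ 1 / 2 := by nlinarith
  have hty0 : 0 < t * x₀ := by positivity
  have hsq : (t * y₀) ^ 2 = (t * x₀) ^ 2 := by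
    rw [← hxy, mul_pow, mul_pow, sq_abs]
  have d1 : dist v e ≤ 71 / 100 * dist v w := by
    rw [dist_comm v, hept]
    exact dist_pt_left_le (by norm_num) (by nlinarith)
  have d2 : dist e (pt v w (t * x₀) 0) ≤ 1 / 2 * dist v w := by
    rw [hept]
    exact dist_pt_le (by norm_num) (by nlinarith)
  have d3 : dist e w ≤ 2 * dist v w := by
    rw [hept]
    exact dist_pt_right_le (by norm_num) (by nlinarith)
  have d4 : dist e b ≤ 2 * dist v w := by
    rw [hept]
    refine dist_pt_le (by norm_num) ?_
    have h1 : t * y₀ - y₀ = (t - 1) * y₀ := by ring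
    have h2 : t * x₀ - x₀ = (t - 1) * x₀ := by ring
    have h3 : y₀ ^ 2 = x₀ ^ 2 := by rw [← hxy, sq_abs]
    have h4 : x₀ ^ 2 ≤ 1 / 4 := by nlinarith
    have h5 : (t - 1) ^ 2 ≤ 1 := by nlinarith
    rw [h1, h2, mul_pow, mul_pow, h3]
    nlinarith [sq_nonneg x₀, sq_nonneg (t - 1)]
  have hwl := dist_le_wlen P v w
  rcases E.adm.2.transition hP E.chord E.hx E.hy he hnice
    (pt_mem_segment (v := v) (w := w) hty0.le (by linarith)) (r := dist v w)
    (by linarith [E.hK]) le_rfl (by linarith) with ⟨h1, h2⟩ | ⟨h1, h2⟩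
  · -- the chord from `v` to the contact point is much shorter
    have hlen := wlen_le P v e
    have := E.min_all v E.concave e he ⟨h1, h2.mono (by linarith)⟩
    linarith
  · -- the chord from the contact point to `w` cuts off a triangle
    have ht1' : t ≠ 1 := by
      rintro rfl
      obtain ⟨ε, hε, hF⟩ := hedge
      have hm : 0 < min ε (1 / 2) := lt_min hε (by norm_num)
      refine (hF (min ε (1 / 2)) hm (min_le_left _ _)).2 (h1.2.2.2 ?_)
      rw [openSegment_symm, openSegment_eq_image']
      refine ⟨min ε (1 / 2), ⟨hm, (min_le_right _ _).trans_lt (by norm_num)⟩, ?_⟩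
      simp only
      rw [hedef, one_smul, add_sub_cancel]
    have ht1'' : t < 1 := lt_of_le_of_ne ht1 ht1'
    have hdeb : det (w - e) (b - e) ≠ 0 := by
      rw [show w - e = (w - v) - t • (b - v) by rw [hedef]; module,
        show b - e = (1 - t) • (b - v) by rw [hedef]; module, det_sub_left, det_smul_right,
        det_smul_right, det_smul_left, det_self]
      rw [mul_zero, mul_zero, sub_zero]
      exact mul_ne_zero (by linarith) hd
    have hE₁ : EndCond P e b := by
      refine hP.endCond_of_opposite he heC ⟨t / 2, by positivity, fun s hs0 hs => ?_⟩
      have e1 : e + s • (e - b) = v + (t - s * (1 - t)) • (b - v) := by rw [hedef]; module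
      rw [e1]
      exact hint _ (by nlinarith) (by nlinarith)
    have hE₂ : EndCond P w b := hP.endCond_of_edgeDir hedge
    have hsub : tri e w b ⊆ tri v w b := tri_mono heT (mid_mem_tri _ _ _) (right_mem_tri _ _ _)
    obtain ⟨Q₁, Q₂, k1, k2⟩ := hP.exists_ear h1 hdeb hE₁ hE₂ (by
      intro u hu huT hnu
      have huT' := hsub huT
      have hwu : segment ℝ w u ⊆ P :=
        ((convex_tri e w u).segment_subset (mid_mem_tri _ _ _) (right_mem_tri _ _ _)).trans hnu.2.1
      have hdu : det (w - v) (u - v) ≠ 0 := by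
        intro h0
        obtain ⟨s, r, hs, hr, hsr, rfl⟩ := mem_tri_iff.1 huT
        have e1 : e + s • (w - e) + r • (b - e) - v =
            s • (w - v) + ((1 - s - r) * t + r) • (b - v) := by rw [hedef]; module
        rw [e1, det_add_right, det_smul_right, det_smul_right, det_self, mul_zero, zero_add] at h0
        have h3 := (mul_eq_zero.1 h0).resolve_right hd
        have h4 : 0 ≤ (1 - s - r) * t := mul_nonneg (by linarith) ht0.le
        have h5 : r = 0 := by linarith
        have h6 : (1 - s - r) * t = 0 := by linarith
        have h7 := (mul_eq_zero.1 h6).resolve_right ht0.ne'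
        have h8 : s = 1 := by linarith
        have h9 := hnu.1
        rw [h5, h8, one_smul, zero_smul, add_zero, add_sub_cancel, det_self] at h9
        exact h9 rfl
      have hdb : det (v - w) (b - w) ≠ 0 := by rw [det_swap_base]; exact neg_ne_zero.2 hd
      have hev := hloc.eventually_tri (hP.frontier_subset E.chord.2.1) hdb
      refine (E.niceTri_of_visible (right_mem_segment ℝ v w) hdu hwu (hev.mono fun z hz hzT =>
        hz ?_) (tri_subset_region zero_le_one hbreg huT')).2 hu
      rw [tri_swap]
      exact tri_mono (left_mem_tri _ _ _) (mid_mem_tri _ _ _) huT' hzT)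
    exact h2.false_of_ear E.hx E.hy k1 k2 (r := 2 * dist v w) (by positivity)
      (by linarith [E.hK]) d3 d4

/-- The normalized case of `no_edge_right`. -/
theorem no_edge_right_aux (E : Extremal P x y K v w) {x₀ y₀ : ℝ} (hy₀ : y₀ ≠ 0) (hxy : |y₀| = x₀)
    (hx₀ : x₀ ≤ 1 / 2) (hedge : EdgeDir P w (pt v w x₀ y₀ - w))
    (hloc : LocalCone P w (v - w) (pt v w x₀ y₀ - w)) : False := by
  set b := pt v w x₀ y₀ with hb
  have hP := E.polygon
  have hl := E.dist_pos
  have hd : det (w - v) (b - v) ≠ 0 := det_pt_ne_zero E.ne hy₀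
  have hx₀pos : 0 < x₀ := hxy ▸ abs_pos.2 hy₀
  have hbreg : b ∈ region 1 v w := ⟨x₀, y₀, rfl, by linarith, by linarith⟩
  have hvP := hP.frontier_subset E.concave.1.1
  rcases hP.localCone_or_edgeDir (q := b - v) E.concave.1.1 E.interior_left with
    hI | ⟨t, ht0, ht1, hdir, -⟩
  · have hcone : LocalCone P v (w - v) (b - v) := hI.mono interior_subset
    obtain ⟨ε, hε, hI'⟩ := hI
    rcases exists_first_contact hP (v := v) (d := b - v) hε (fun s hs0 hs => by
      have := hI' 0 s le_rfl hs0.le (by linarith) (by linarith)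
      rwa [zero_smul, add_zero] at this) with hall | ⟨t, ht0, ht1, he, hint⟩
    · have hseg : segment ℝ v b ⊆ P := by
        rw [segment_eq_image']
        rintro z ⟨s, ⟨hs0, hs1⟩, rfl⟩
        simp only
        rcases hs0.eq_or_lt with rfl | hs0
        · rwa [zero_smul, add_zero]
        · exact interior_subset (hall s hs0 hs1)
      obtain ⟨⟨-, -, -, hs⟩, -⟩ := E.niceTri_of_visible (left_mem_segment ℝ v w) hd hseg
        (hcone.eventually_tri hvP hd) hbreg
      have hbI : b ∈ interior P := by
        have := hall 1 one_pos le_rfl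
        rwa [one_smul, add_sub_cancel] at this
      rcases hs with hs | hs
      · obtain ⟨ε, hε, hF⟩ := hedge
        have hm : 0 < min ε (1 / 2) := lt_min hε (by norm_num)
        refine (hF (min ε (1 / 2)) hm (min_le_left _ _)).2 (hs ?_)
        rw [openSegment_symm, openSegment_eq_image']
        exact ⟨min ε (1 / 2), ⟨hm, (min_le_right _ _).trans_lt (by norm_num)⟩, rfl⟩
      · exact (hs (left_mem_segment ℝ _ _)).2 hbI
    · exact E.no_contact hy₀ hxy hx₀ hedge hloc hcone ht0 ht1 he hint
  · -- two boundary directions meet in a point of the segment from `w` to `b`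
    set a := w + t • (b - w) with ha
    have e1 : w - v + t • (b - v - (w - v)) = a - v := by rw [ha]; module
    rw [e1] at hdir
    have e2 : a - w = t • (b - w) := by rw [ha]; module
    have e3 : a = pt v w (1 - t * (1 - x₀)) (t * y₀) := by rw [ha, hb]; unfold pt; module
    have haT : a ∈ tri v w b := (convex_tri _ _ _).segment_subset (mid_mem_tri _ _ _)
      (right_mem_tri _ _ _) (by rw [segment_eq_image']; exact ⟨t, ⟨ht0.le, ht1⟩, rfl⟩)
    refine E.false_of_endCond (a := a) ?_ (hP.endCond_of_edgeDir hdir)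
      (hP.endCond_of_edgeDir (e2 ▸ hedge.smul ht0)) ?_ ?_
    · rw [e3]; exact det_pt_ne_zero E.ne (mul_ne_zero ht0.ne' hy₀)
    · have h1 : dist v b ≤ 9 * dist v w := by
        rw [dist_comm v]
        refine dist_pt_left_le (by norm_num) ?_
        have h3 : y₀ ^ 2 = x₀ ^ 2 := by rw [← hxy, sq_abs]
        rw [h3]; nlinarith
      have := tri_subset_closedBall (by linarith) h1 haT
      rwa [Metric.mem_closedBall, dist_comm] at this
    · exact fun u hu huT hn => E.not_niceTri hu (tri_subset_region zero_le_one hbreg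
        (tri_mono (left_mem_tri _ _ _) (mid_mem_tri _ _ _) haT huT)) hn

/-- The boundary does not leave the endpoint `w` of an extremal chord from `v` to `w` at an angle of
at most 45° with the chord. -/
theorem no_edge_right (E : Extremal P x y K v w) {X Y : ℝ} (hY : Y ≠ 0) (hXY : |Y| ≤ 1 - X)
    (hedge : EdgeDir P w (pt v w X Y - w)) (hloc : LocalCone P w (v - w) (pt v w X Y - w)) :
    False := by
  have hYpos := abs_pos.2 hY
  have hM : 0 < |Y| + (1 - X) := by linarith
  -- rescale to the intersection with the ray from `v` of slope 45°
  have hkpos : 0 < 1 / (|Y| + (1 - X)) := by positivity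
  have hk : 1 / (|Y| + (1 - X)) * (|Y| + (1 - X)) = 1 := by field_simp
  set k := 1 / (|Y| + (1 - X)) with hkdef
  have e : pt v w (1 - k * (1 - X)) (k * Y) - w = k • (pt v w X Y - w) := by unfold pt; module
  refine E.no_edge_right_aux (x₀ := 1 - k * (1 - X)) (y₀ := k * Y) (mul_ne_zero hkpos.ne' hY) ?_ ?_ ?_ ?_
  · rw [abs_mul, abs_of_pos hkpos]; linarith
  · nlinarith
  · rw [e]; exact hedge.smul hkpos
  · have := hloc.comb zero_le_one le_rfl le_rfl hkpos.le (by norm_num) (by linarith)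
    rw [e]
    simpa using this

/-- The boundary does not leave the endpoint `v` of an extremal chord from `v` to `w` in a direction
that is nearly that of the chord. -/
theorem no_edge_left (E : Extremal P x y K v w) {σ : ℝ} (hσ : σ ≠ 0) (hσ1 : |σ| ≤ 1 / 50)
    (hedge : EdgeDir P v (pt v w 1 σ - v)) (hloc : LocalCone P v (w - v) (pt v w 1 σ - v)) :
    False := by
  by_cases hw : w ∈ concaveVertices P
  · have e : pt v w 1 σ = pt w v 0 (-σ) := by rw [pt_swap v w, sub_zero, neg_neg]
    rw [e] at hedge hloc
    exact (E.symm hw).no_edge_right (neg_ne_zero.2 hσ) (by rw [abs_neg]; linarith) hedge hloc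
  have hP := E.polygon
  have hl := E.dist_pos
  set τ := |σ| with hτ
  have hτ0 : 0 < τ := abs_pos.2 hσ
  obtain ⟨s, hs, hsσ⟩ : ∃ s : ℝ, |s| = 1 ∧ σ = s * τ := by
    rcases le_total 0 σ with h | h
    · exact ⟨1, by norm_num, by rw [hτ, abs_of_nonneg h]; ring⟩
    · exact ⟨-1, by norm_num, by rw [hτ, abs_of_nonpos h]; ring⟩
  have hs0 : s ≠ 0 := by rintro rfl; norm_num at hs
  have hwt : wlen P v w = 5 / 4 * dist v w := by unfold wlen; rw [weight_of_notMem hw]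
  -- turn at `w` by 45° to the side away from the boundary direction at `v`
  rcases hP.localCone_or_edgeDir (q := pt v w (1 / 2) (-(s / 2)) - w) E.chord.2.1
    E.interior_right with hI | ⟨t, ht0, ht1, hdir, hloc'⟩
  · obtain ⟨ε, hε, hI⟩ := hI
    have h1τ : 0 < 1 - τ := by linarith
    set k := 1 / (1 - τ) with hkdef
    have hk0 : 0 < k := by positivity
    have hk : k * (1 - τ) = 1 := by rw [hkdef]; field_simp
    have hkτ : k * τ ≤ 1 / 49 := by nlinarith
    have hkτ0 : 0 < k * τ := by positivity
    -- the point in which the boundary direction at `v` meets the ray from `w` opposite to the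
    -- direction of slope 45°, which is interior
    set a := pt v w k (k * σ) with ha
    have e1 : a - v = k • (pt v w 1 σ - v) := by rw [ha]; unfold pt; module
    have e2 : w - a = (2 * (k * τ)) • (pt v w (1 / 2) (-(s / 2)) - w) := by
      have h : ∀ c κ μ : ℝ, κ = 1 + c → μ = s * c →
          w - pt v w κ μ = (2 * c) • (pt v w (1 / 2) (-(s / 2)) - w) := by
        rintro c _ _ rfl rfl
        unfold pt; module
      exact h _ _ _ (by linarith) (by rw [hsσ]; ring)
    have hE₁ : EndCond P v a := hP.endCond_of_edgeDir (e1 ▸ hedge.smul hk0)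
    have hE₂ : EndCond P w a := by
      refine hP.endCond_of_opposite E.chord.2.1 hw
        ⟨ε / (2 * (k * τ)), by positivity, fun r hr0 hr => ?_⟩
      rw [le_div_iff₀ (by positivity)] at hr
      have := hI 0 (r * (2 * (k * τ))) le_rfl (by positivity) (by rw [zero_add]; positivity)
        (by linarith)
      rw [zero_smul, add_zero] at this
      rwa [e2, smul_smul]
    have hda : dist v a ≤ 9 * dist v w := by
      rw [dist_comm v]
      refine dist_pt_left_le (by norm_num) ?_
      have h2 : (k * σ) ^ 2 = (k * τ) ^ 2 := by rw [mul_pow, mul_pow, hτ, sq_abs]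
      rw [h2]; nlinarith
    refine E.false_of_endCond (a := a) (det_pt_ne_zero E.ne (mul_ne_zero hk0.ne' hσ)) hE₁ hE₂ hda ?_
    intro u hu huT hn
    -- a concave vertex in this triangle that is not seen under small slopes is close to `w`
    obtain ⟨s₁, t₁, hs₁, ht₁, hst, rfl⟩ := mem_tri_iff.1 huT
    rw [ha, pt_comb] at hu hn
    set X := s₁ + t₁ * k with hX
    set Y := t₁ * (k * σ) with hYdef
    have hYabs : |Y| = t₁ * (k * τ) := by
      rw [hYdef, abs_mul, abs_mul, abs_of_nonneg ht₁, abs_of_pos hk0]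
    have hY1 : |Y| ≤ 1 / 49 := by rw [hYabs]; nlinarith
    have hXY : |Y| ≤ X := by rw [hYabs, hX]; nlinarith
    have hX1 : X - 1 ≤ |Y| := by rw [hYabs, hX]; nlinarith
    have hX2 : 1 - X < |Y| := by
      by_contra hle
      exact E.not_niceTri hu ⟨X, Y, rfl, by linarith, by linarith⟩ hn
    have hYsq : Y ^ 2 = |Y| ^ 2 := (sq_abs Y).symm
    have d1 : dist (pt v w X Y) w ≤ 3 / 100 * dist v w :=
      dist_pt_right_le (by norm_num) (by nlinarith)
    have d2 : dist v (pt v w X Y) ≤ 103 / 100 * dist v w := by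
      have := dist_triangle v w (pt v w X Y)
      rw [dist_comm w] at this
      linarith
    rcases E.adm.2.transition hP E.chord E.hx E.hy hu.1.1 hn (right_mem_segment ℝ v w)
      (r := 2 * dist v w) (by linarith [E.hK]) (by linarith) (by linarith) with ⟨h3, h4⟩ | ⟨h3, h4⟩
    · -- the new chord may be longer, but both of its endpoints are concave vertices
      have e : wlen P v (pt v w X Y) = dist v (pt v w X Y) := by
        unfold wlen; rw [weight_of_mem hu, one_mul]
      have := E.min_concave v E.concave _ hu ⟨h3, h4.mono (by linarith)⟩
      linarith
    · have e := wlen_le P (pt v w X Y) w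
      have := E.min_right _ hu ⟨h3, h4.mono (by linarith)⟩
      linarith
  · have e : v - w + t • (pt v w (1 / 2) (-(s / 2)) - w - (v - w)) =
        pt v w (t / 2) (-(s * t / 2)) - w := by unfold pt; module
    rw [e] at hdir hloc'
    refine E.no_edge_right (X := t / 2) (Y := -(s * t / 2)) ?_ ?_ hdir hloc'
    · exact neg_ne_zero.2 (div_ne_zero (mul_ne_zero hs0 ht0.ne') two_ne_zero)
    · rw [abs_neg, abs_div, abs_mul, hs, abs_of_pos ht0, abs_of_pos two_pos]; linarith

end Extremal

/-! ### The segmentation property of extremal chords -/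

theorem isClosed_region {σ : ℝ} {v w : Plane} (hvw : v ≠ w) : IsClosed (region σ v w) := by
  have hd : det (w - v) (v + rot (w - v) - v) ≠ 0 := by
    rw [add_sub_cancel_left]; exact (det_rot_pos (sub_ne_zero.2 hvw.symm)).ne'
  have e : ∀ X Y : ℝ, pt v w X Y = v + X • (w - v) + Y • (v + rot (w - v) - v) := by
    intro X Y; rw [add_sub_cancel_left]; rfl
  have : region σ v w = {u | |coordC v w (v + rot (w - v)) u| ≤ σ * coordB v w (v + rot (w - v)) u} ∩
      {u | |coordC v w (v + rot (w - v)) u| ≤ σ * (1 - coordB v w (v + rot (w - v)) u)} := by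
    ext u
    constructor
    · rintro ⟨X, Y, rfl, h1, h2⟩
      rw [e]
      constructor
      · rwa [Set.mem_ofPred_eq, coordB_eq hd, coordC_eq hd]
      · rwa [Set.mem_ofPred_eq, coordB_eq hd, coordC_eq hd]
    · rintro ⟨h1, h2⟩
      exact ⟨_, _, by rw [e]; exact eq_coord hd u, h1, h2⟩
  rw [this]
  exact (isClosed_le (by fun_prop) (by fun_prop)).inter (isClosed_le (by fun_prop) (by fun_prop))

theorem closure_segmentCigar_subset {v w : Plane} (hvw : v ≠ w) {η : ℝ} (hη0 : 0 < η)
    (hη : η ≤ 1 / 100) : closure (segmentCigar v w η) ⊆ region (1 / 50) v w := by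
  refine closure_minimal ?_ (isClosed_region hvw)
  intro u hu
  have hl : 0 < dist v w := dist_pos.2 hvw
  unfold segmentCigar cigar at hu
  simp only [Set.mem_iUnion, Metric.mem_ball] at hu
  obtain ⟨t, ⟨ht0, ht1⟩, hu⟩ := hu
  obtain ⟨X, Y, rfl⟩ := exists_pt hvw u
  set τ := t / dist v w with hτ
  have htτ : t = τ * dist v w := by rw [hτ]; field_simp
  have hτ0 : 0 ≤ τ := by positivity
  have hτ1 : τ ≤ 1 := by rwa [hτ, div_le_one hl]
  have e1 : (AffineMap.lineMap v w τ : Plane) = pt v w τ 0 := by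
    rw [AffineMap.lineMap_apply_module']; unfold pt; module
  have e2 : min t (dist v w - t) = min τ (1 - τ) * dist v w := by
    rw [min_mul_of_nonneg _ _ hl.le, ← htτ, htτ]; ring_nf
  rw [e1, e2, ← mul_assoc] at hu
  set m := min τ (1 - τ) with hm
  have hm0 : 0 ≤ m := le_min hτ0 (by linarith)
  have hmτ : m ≤ τ := min_le_left _ _
  have hmτ' : m ≤ 1 - τ := min_le_right _ _
  have h1 := sq_le_of_dist_pt_le hvw hu.le
  have hηm : η * m ≤ m / 100 := by nlinarith
  have hηm0 : 0 ≤ η * m := by positivity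
  have hY : |Y| ≤ m / 100 := by
    refine le_trans (abs_le_of_sq_le_sq ?_ hηm0) hηm
    nlinarith [sq_nonneg (X - τ)]
  have hX : |X - τ| ≤ m / 100 := by
    refine le_trans (abs_le_of_sq_le_sq ?_ hηm0) hηm
    nlinarith [sq_nonneg Y]
  obtain ⟨hX1, hX2⟩ := abs_le.1 hX
  exact ⟨X, Y, rfl, by linarith, by linarith⟩

theorem pt_mem_tri {v w : Plane} {σ ε X c : ℝ} (hε : 0 < ε) (hc0 : 0 ≤ c) (hcX : c ≤ X)
    (hX : X ≤ 1 / 2) (hcε : c ≤ ε / 2) : pt v w X (c * σ) ∈ tri v w (pt v w ε (ε * σ)) := by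
  refine mem_tri_iff.2 ⟨X - c, c / ε, by linarith, by positivity, ?_, ?_⟩
  · have : c / ε ≤ 1 / 2 := by rw [div_le_iff₀ hε]; linarith
    linarith
  · have h1 : c / ε * ε = c := div_mul_cancel₀ _ hε.ne'
    rw [pt_comb, ← mul_assoc, h1, sub_add_cancel]

theorem half_arcsin_lt {η : ℝ} (hη0 : 0 < η) (hη : η ≤ 1 / 100) :
    1 / 2 * Real.arcsin η < 1 / 60 := by
  have h0 : 0 ≤ Real.arcsin η := Real.arcsin_nonneg.2 hη0.le
  have h1 := Real.mul_le_sin h0 (Real.arcsin_le_pi_div_two η)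
  rw [Real.sin_arcsin (by linarith) (by linarith)] at h1
  have hpi := Real.pi_pos
  have hpi4 := Real.pi_lt_d2
  have h2 : Real.arcsin η ≤ η * Real.pi / 2 := by
    rw [div_mul_eq_mul_div, div_le_iff₀ hpi] at h1
    linarith
  nlinarith

theorem pt_polar {v w : Plane} {a l : ℝ} (h : w - v = l • unitVec a) (hl : l ≠ 0) (ψ t : ℝ) :
    v + t • unitVec (a + ψ) = pt v w (t * Real.cos ψ / l) (t * Real.sin ψ / l) := by
  unfold pt
  rw [h]
  apply plane_ext
  · simp [unitVec, rot_zero, Real.cos_add]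
    field_simp
    ring
  · simp [unitVec, rot_one, Real.sin_add]
    field_simp
    ring

/-- If `Q` contains a thin triangle at `v` then its interior angle at `v` is not small. -/
theorem le_interiorAngle_of_tri {Q : Set Plane} {v w : Plane} (hvw : v ≠ w) {σ ε : ℝ}
    (hσ : |σ| = 1 / 50) (hε : 0 < ε) (hT : tri v w (pt v w ε (ε * σ)) ⊆ Q) :
    1 / 60 ≤ interiorAngle Q v := by
  obtain ⟨l, a, hl, -, -, h⟩ := exists_polar (sub_ne_zero.2 hvw.symm)
  have hσ0 : σ ≠ 0 := by rintro rfl; norm_num at hσ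
  have key : ∀ ψ : ℝ, |ψ| < 1 / 60 → 0 ≤ ψ * σ → a + ψ ∈ directions Q v := by
    intro ψ hψ hψσ
    have hψsq : ψ ^ 2 ≤ (1 / 60) ^ 2 := by
      rw [← sq_abs ψ]; exact pow_le_pow_left₀ (abs_nonneg _) hψ.le 2
    have hcos : 9 / 10 ≤ Real.cos ψ := by
      have := Real.one_sub_sq_div_two_le_cos (x := ψ)
      linarith
    have hcos1 := Real.cos_le_one ψ
    have hsin : |Real.sin ψ| ≤ 1 / 60 := (Real.abs_sin_le_abs (x := ψ)).trans hψ.le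
    have hψpi : |ψ| ≤ Real.pi := by have := Real.pi_gt_three; linarith
    have hsign : 0 ≤ Real.sin ψ / σ := by
      rcases lt_or_gt_of_ne hσ0 with h1 | h1
      · exact div_nonneg_of_nonpos (Real.sin_nonpos_of_nonpos_of_neg_pi_le (by nlinarith)
          (by linarith [neg_abs_le ψ])) h1.le
      · exact div_nonneg (Real.sin_nonneg_of_nonneg_of_le_pi (by nlinarith)
          (by linarith [le_abs_self ψ])) h1.le
    have hratio : Real.sin ψ / σ ≤ 50 / 60 := by
      refine (le_abs_self _).trans ?_
      rw [abs_div, hσ, div_le_iff₀ (by norm_num)]; linarith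
    refine ⟨l * min (1 / 2) (ε / 2), by positivity, fun t ht => hT ?_⟩
    have e : v + t • unitVec (a + ψ) =
        pt v w (t / l * Real.cos ψ) (t / l * (Real.sin ψ / σ) * σ) := by
      rw [pt_polar h hl.ne' ψ t, mul_assoc (t / l), div_mul_cancel₀ _ hσ0]
      congr 1 <;> ring
    rw [e]
    have ht0 : 0 < t / l := div_pos ht.1 hl
    have htm : t / l ≤ min (1 / 2) (ε / 2) := by
      rw [div_le_iff₀ hl]; linarith [ht.2]
    have h1 := htm.trans (min_le_left _ _)
    have h2 := htm.trans (min_le_right _ _)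
    refine pt_mem_tri hε (by positivity) ?_ ?_ ?_ <;> nlinarith
  have hpi := Real.pi_gt_three
  rcases lt_or_gt_of_ne hσ0 with h1 | h1
  · refine le_interiorAngle (a := a - 1 / 60) (by norm_num) (by linarith) fun φ hφ => ?_
    have := key (φ - a) (abs_lt.2 ⟨by linarith [hφ.1], by linarith [hφ.2]⟩)
      (mul_nonneg_of_nonpos_of_nonpos (by linarith [hφ.2]) h1.le)
    rwa [add_sub_cancel] at this
  · refine le_interiorAngle (a := a) (by norm_num) (by linarith) fun φ hφ => ?_
    have := key (φ - a) (abs_lt.2 ⟨by linarith [hφ.1], by linarith [hφ.2]⟩)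
      (mul_nonneg (by linarith [hφ.1]) h1.le)
    rwa [add_sub_cancel] at this

namespace Extremal

variable {P : Set Plane} {x y v w : Plane} {K : ℝ}

/-- The directions at `v` that are close to the direction of the chord are interior. -/
theorem localCone_left (E : Extremal P x y K v w) {X Y : ℝ} (hX : 0 < X) (hY : Y ≠ 0)
    (hXY : |Y| ≤ 1 / 50 * X) : LocalCone (interior P) v (w - v) (pt v w X Y - v) := by
  refine (E.polygon.localCone_or_edgeDir E.concave.1.1 E.interior_left).resolve_right ?_
  rintro ⟨t, ht0, ht1, hdir, hloc⟩
  have hM : 0 < 1 - t + t * X := by nlinarith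
  have hkpos : 0 < 1 / (1 - t + t * X) := by positivity
  have hk : 1 / (1 - t + t * X) * (1 - t + t * X) = 1 := by field_simp
  set k := 1 / (1 - t + t * X) with hkdef
  have e : pt v w 1 (k * (t * Y)) - v = k • (w - v + t • (pt v w X Y - v - (w - v))) := by
    rw [← hk]; unfold pt; module
  refine E.no_edge_left (σ := k * (t * Y)) (mul_ne_zero hkpos.ne' (mul_ne_zero ht0.ne' hY)) ?_ ?_ ?_
  · rw [abs_mul, abs_mul, abs_of_pos hkpos, abs_of_pos ht0]
    have h1 : t * |Y| ≤ 1 / 50 * (1 - t + t * X) := by nlinarith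
    have h2 := mul_le_mul_of_nonneg_left h1 hkpos.le
    linarith
  · rw [e]; exact hdir.smul hkpos
  · rw [e]
    have := hloc.comb zero_le_one le_rfl le_rfl hkpos.le (by norm_num) (by linarith)
    simpa using this

/-- The directions at `w` at an angle of at most 45° with the chord are interior. -/
theorem localCone_right (E : Extremal P x y K v w) {X Y : ℝ} (hX : 0 < X) (hX1 : X < 1)
    (hY : Y ≠ 0) (hXY : |Y| ≤ 1 - X) :
    LocalCone (interior P) w (v - w) (pt v w X Y - w) := by
  refine (E.polygon.localCone_or_edgeDir E.chord.2.1 E.interior_right).resolve_right ?_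
  rintro ⟨t, ht0, ht1, hdir, hloc⟩
  have e : v - w + t • (pt v w X Y - w - (v - w)) = pt v w (t * X) (t * Y) - w := by
    unfold pt; module
  rw [e] at hdir hloc
  refine E.no_edge_right (mul_ne_zero ht0.ne' hY) ?_ hdir hloc
  rw [abs_mul, abs_of_pos ht0]
  nlinarith

theorem concave_inter_visibleCigar (E : Extremal P x y K v w) {η : ℝ} (hη0 : 0 < η)
    (hη : η ≤ 1 / 100) : concaveVertices P ∩ visibleCigar P v w η ⊆ {v, w} := by
  rintro z ⟨hzC, hzc, p, hp, hpz⟩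
  have hP := E.polygon
  obtain ⟨X, Y, rfl, h1, h2⟩ := closure_segmentCigar_subset E.ne hη0 hη hzc
  have hY0 := abs_nonneg Y
  have hreg : pt v w X Y ∈ region 1 v w := ⟨X, Y, rfl, by linarith, by linarith⟩
  rcases eq_or_ne Y 0 with rfl | hY
  · have hs : pt v w X 0 ∈ segment ℝ v w := pt_mem_segment (by linarith) (by linarith)
    rw [segment_eq_insert_openSegment] at hs
    rcases hs with hs | hs | hs
    · exact Or.inl hs
    · exact Or.inr hs
    · exact absurd (E.chord.2.2.2 hs) hzC.1.1.2
  · exfalso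
    have hYpos := abs_pos.2 hY
    have hd := det_pt_ne_zero (x := X) E.ne hY
    have hloc : ∀ᶠ x in nhds p, x ∈ tri v w (pt v w X Y) → x ∈ P := by
      have hp' := hp
      rw [segment_eq_insert_openSegment] at hp'
      rcases hp' with rfl | rfl | hp'
      · exact ((E.localCone_left (by linarith) hY h1).mono
          interior_subset).eventually_tri (hP.frontier_subset E.concave.1.1) hd
      · rw [tri_swap]
        exact ((E.localCone_right (by linarith) (by linarith) hY (by linarith)).mono
          interior_subset).eventually_tri (hP.frontier_subset E.chord.2.1)
          (by rw [det_swap_base]; exact neg_ne_zero.2 hd)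
      · filter_upwards [isOpen_interior.mem_nhds (E.chord.2.2.2 hp')] with x hx _
        exact interior_subset hx
    exact (E.niceTri_of_visible hp hd hpz hloc hreg).2 hzC

/-- `P` contains a triangle on the chord with a fixed angle at `v`, on either side. -/
theorem exists_tri_subset (E : Extremal P x y K v w) {σ : ℝ} (hσ : |σ| = 1 / 50) :
    ∃ ε > 0, tri v w (pt v w ε (ε * σ)) ⊆ P := by
  have hσ0 : σ ≠ 0 := by rintro rfl; norm_num at hσ
  have hP := E.polygon
  obtain ⟨ε, hε, h⟩ := E.localCone_left (X := 1) one_pos hσ0 (by linarith)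
  set δ := min ε (1 / 2) with hδ
  have hδ0 : 0 < δ := lt_min hε (by norm_num)
  have hδ1 : δ ≤ 1 / 2 := min_le_right _ _
  have e : ∀ c : ℝ, v + c • (pt v w δ (δ * σ) - v) =
      v + (0:ℝ) • (w - v) + (c * δ) • (pt v w 1 σ - v) := by
    intro c; unfold pt; module
  refine ⟨δ, hδ0, (E.niceTri_of_visible (left_mem_segment ℝ v w)
    (det_pt_ne_zero E.ne (mul_ne_zero hδ0.ne' hσ0)) ?_ ?_ ?_).1.2.1⟩
  · rw [segment_eq_image']
    rintro _ ⟨c, ⟨hc0, hc1⟩, rfl⟩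
    simp only
    rcases hc0.eq_or_lt with rfl | hc0
    · rw [zero_smul, add_zero]; exact hP.frontier_subset E.concave.1.1
    · rw [e]
      refine interior_subset (h _ _ le_rfl (by positivity) (by positivity) ?_)
      have := min_le_left ε (1 / 2)
      nlinarith
  · refine LocalCone.eventually_tri (hP.frontier_subset E.concave.1.1)
      (det_pt_ne_zero E.ne (mul_ne_zero hδ0.ne' hσ0)) ?_
    refine (E.localCone_left hδ0 (mul_ne_zero hδ0.ne' hσ0) ?_).mono interior_subset
    rw [abs_mul, abs_of_pos hδ0, hσ]; linarith
  · refine ⟨_, _, rfl, ?_, ?_⟩ <;> rw [abs_mul, abs_of_pos hδ0, hσ] <;> linarith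

/-- Both parts have a fixed angle at `v`, whether or not they are triangles. -/
theorem lt_interiorAngle (E : Extremal P x y K v w) {η : ℝ} (hη0 : 0 < η) (hη : η ≤ 1 / 100)
    {Q₁ Q₂ : Set Plane} (h : InducesPartition P v w Q₁ Q₂) :
    1 / 2 * Real.arcsin η < interiorAngle Q₁ v := by
  refine (half_arcsin_lt hη0 hη).trans_le ?_
  have hP := E.polygon
  set e : Plane := pt v w (1 / 2) 0 with he
  have heo : e ∈ openSegment ℝ v w := by
    rw [openSegment_eq_image']
    exact ⟨1 / 2, by norm_num, by simp [he, pt]⟩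
  obtain ⟨r, hr, hcase⟩ := h.halfPlane hP heo
  have hdr := det_rot_pos (sub_ne_zero.2 E.ne.symm)
  have key : ∀ σ : ℝ, |σ| = 1 / 50 →
      (∀ x ∈ Metric.ball e r, x ∈ Q₂ → det (w - v) (x - e) * σ ≤ 0) → 1 / 60 ≤ interiorAngle Q₁ v := by
    intro σ hσ hside
    have hσ0 : σ ≠ 0 := by rintro rfl; norm_num at hσ
    obtain ⟨ε, hε, hT⟩ := E.exists_tri_subset hσ
    rcases h.tri_subset (det_pt_ne_zero E.ne (mul_ne_zero hε.ne' hσ0)) hT with h1 | h1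
    · exact le_interiorAngle_of_tri E.ne hσ hε h1
    · exfalso
      have hev := eventually_add_smul_mem (τ := σ • rot (w - v)) (Metric.ball_mem_nhds e hr)
      have hev2 : ∀ᶠ s in nhdsWithin (0 : ℝ) (Set.Ioi 0), s ∈ Set.Ioo (0 : ℝ) (min (1 / 2) (ε / 2)) :=
        Ioo_mem_nhdsGT (by positivity)
      obtain ⟨s, hs1, hs2⟩ := (hev.and hev2).exists
      have e1 : e + s • σ • rot (w - v) = pt v w (1 / 2) (s * σ) := by
        rw [he]; unfold pt; module
      have hmem : pt v w (1 / 2) (s * σ) ∈ Q₂ := h1 (pt_mem_tri hε hs2.1.le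
        (hs2.2.le.trans (min_le_left _ _)) le_rfl (hs2.2.le.trans (min_le_right _ _)))
      have h2 := hside _ hs1 (e1 ▸ hmem)
      rw [add_sub_cancel_left, det_smul_right, det_smul_right] at h2
      have h3 := mul_pos hs2.1 (mul_pos hdr (pow_pos (abs_pos.2 hσ0) 2))
      rw [sq_abs] at h3
      nlinarith
  rcases hcase with ⟨-, h2⟩ | ⟨-, h2⟩
  · exact key (1 / 50) (abs_of_pos (by norm_num)) fun x hx hxQ => by
      have := (h2 x hx).1 hxQ; linarith
  · exact key (-(1 / 50)) (by rw [abs_neg]; exact abs_of_pos (by norm_num)) fun x hx hxQ => by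
      have := (h2 x hx).1 hxQ; linarith

theorem segmentationProperty (E : Extremal P x y K v w) {η : ℝ} (hη0 : 0 < η) (hη : η ≤ 1 / 100)
    {Q₁ Q₂ : Set Plane} (h : InducesPartition P v w Q₁ Q₂) :
    SegmentationProperty η P v w Q₁ Q₂ :=
  ⟨E.concave_inter_visibleCigar hη0 hη, fun _ => E.lt_interiorAngle hη0 hη h,
    fun _ => E.lt_interiorAngle hη0 hη h.symm⟩

end Extremal

/-! ### Existence of extremal chords -/

/-- Chords starting at concave vertices are not arbitrarily short. -/
theorem IsPolygon.exists_le_dist {P : Set Plane} (hP : IsPolygon P) :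
    ∃ ρ > 0, ∀ v ∈ concaveVertices P, ∀ w, IsChord P v w → ρ ≤ dist v w := by
  have h : ∀ v ∈ concaveVertices P, ∃ r > 0, ∀ w, IsChord P v w → r ≤ dist v w := by
    intro v hv
    obtain ⟨r, hr, hcon⟩ := hP.conic hv.1.1
    refine ⟨r, hr, fun w hw => ?_⟩
    by_contra hlt
    rw [not_le, dist_comm, dist_eq_norm] at hlt
    have h1 := (hcon (w - v) (1 / 2) hlt (by norm_num) (by norm_num)).2.2
    rw [add_sub_cancel] at h1
    refine hw.2.1.2 (h1.1 (hw.2.2.2 ?_))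
    rw [openSegment_eq_image']
    exact ⟨1 / 2, by norm_num, rfl⟩
  choose! r hr h using h
  rcases (concaveVertices P).eq_empty_or_nonempty with h0 | hne
  · exact ⟨1, one_pos, fun v hv => by rw [h0] at hv; exact hv.elim⟩
  · obtain ⟨v₀, hv₀, hmin⟩ := Set.exists_min_image _ r hP.finite_concaveVertices hne
    exact ⟨r v₀, hr v₀ hv₀, fun v hv w hw => (hmin v hv).trans (h v hv w hw)⟩

theorem IsPolygon.exists_extremal {P : Set Plane} (hP : IsPolygon P) {x y v₀ w₀ : Plane} {K : ℝ}
    (hx : x ∈ P) (hy : y ∈ P) (hK : 0 ≤ K) (hv₀ : v₀ ∈ concaveVertices P)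
    (h₀ : Admissible P x y K v₀ w₀) :
    ∃ v w, Extremal P x y K v w ∧ wlen P v w ≤ 11 / 10 * wlen P v₀ w₀ := by
  set S : Set ℝ := {r | ∃ a ∈ concaveVertices P, ∃ b, Admissible P x y K a b ∧ r = wlen P a b}
    with hS
  have hmem : ∀ a ∈ concaveVertices P, ∀ b, Admissible P x y K a b → wlen P a b ∈ S :=
    fun a ha b hab => ⟨a, ha, b, hab, rfl⟩
  obtain ⟨ρ, hρ, hρle⟩ := hP.exists_le_dist
  have hne : S.Nonempty := ⟨_, hmem v₀ hv₀ w₀ h₀⟩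
  have hlow : ∀ r ∈ S, ρ ≤ r := by
    rintro _ ⟨a, ha, b, hab, rfl⟩
    exact (hρle a ha b hab.1).trans (dist_le_wlen P a b)
  have hbdd : BddBelow S := ⟨ρ, hlow⟩
  have hm : 0 < sInf S := hρ.trans_le (le_csInf hne hlow)
  obtain ⟨_, ⟨v₁, hv₁, w₁, h₁, rfl⟩, hlt⟩ := exists_lt_of_csInf_lt hne
    (show sInf S < 11 / 10 * sInf S by linarith)
  set T : Set (Plane × Plane) := {q | q.1 ∈ concaveVertices P ∧ q.2 ∈ insert w₁ (concaveVertices P) ∧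
    Admissible P x y K q.1 q.2} with hT
  have hfin : T.Finite := (hP.finite_concaveVertices.prod (hP.finite_concaveVertices.insert w₁)).subset
    fun q hq => ⟨hq.1, hq.2.1⟩
  obtain ⟨⟨v, w⟩, ⟨hv, hw, hadm⟩, hmin⟩ := Set.exists_min_image T (fun q => wlen P q.1 q.2) hfin
    ⟨(v₁, w₁), hv₁, Set.mem_insert _ _, h₁⟩
  have hle : wlen P v w ≤ 11 / 10 * sInf S :=
    (hmin (v₁, w₁) ⟨hv₁, Set.mem_insert _ _, h₁⟩).trans hlt.le
  have hall : ∀ a ∈ concaveVertices P, ∀ b, Admissible P x y K a b →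
      wlen P v w ≤ 11 / 10 * wlen P a b := by
    intro a ha b hab
    have := csInf_le hbdd (hmem a ha b hab)
    linarith
  exact ⟨v, w, ⟨hP, hx, hy, hK, hv, hadm,
    fun a ha b hb hab => hmin (a, b) ⟨ha, Set.mem_insert_of_mem _ hb, hab⟩,
    fun a ha haw => hmin (a, w) ⟨ha, hw, haw⟩, fun a ha b _ hab => hall a ha b hab⟩,
    hall v₀ hv₀ w₀ h₀⟩

/-- Each of the two parts cut off by an extremal chord is large. -/
theorem Extremal.le_min_intrinsicDiam {P : Set Plane} {x y v w : Plane} {K : ℝ}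
    (E : Extremal P x y K v w) {Q₁ Q₂ : Set Plane} (h : InducesPartition P v w Q₁ Q₂) :
    ENNReal.ofReal K ≤ min (intrinsicDiam Q₁) (intrinsicDiam Q₂) := by
  obtain ⟨hs, hfx, hfy⟩ := E.adm.2
  have hlen : 0 < wlen P v w := E.dist_pos.trans_le (dist_le_wlen P v w)
  have hnot : ∀ z ∈ P, Far P z (segment ℝ v w) (K + 10 * wlen P v w) → z ∉ segment ℝ v w := by
    intro z hzP hz hzc
    have h3 := hz.le_dist hzc (by rw [segment_same]; exact Set.singleton_subset_iff.2 hzP)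
    rw [dist_self] at h3
    linarith [E.hK]
  have hv := left_mem_segment ℝ v w
  have key : ∀ {A B : Set Plane} {z : Plane}, InducesPartition P v w A B → z ∈ A →
      Far P z (segment ℝ v w) (K + 10 * wlen P v w) → ENNReal.ofReal K ≤ intrinsicDiam A :=
    fun hAB hzA hz => ((hz.mono (by linarith)).mono_set hAB.left_subset).le_intrinsicDiam hzA hv
      (hAB.seg_left hv)
  rcases h.mem_of_separates hs E.hx E.hy (hnot x E.hx hfx) (hnot y E.hy hfy) with ⟨h1, h2⟩ | ⟨h1, h2⟩
  · exact le_min (key h h1 hfx) (key h.symm h2 hfy)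
  · exact le_min (key h h2 hfy) (key h.symm h1 hfx)

theorem mainTheorem5 :
    ∃ η₀ : ℝ, 0 < η₀ ∧ η₀ < 1 ∧
      ∀ ϑ : ℝ, 0 < ϑ → ϑ < 1 →
        ∃ ϑ' : ℝ, 0 < ϑ' ∧ ϑ' ≤ ϑ ∧
          ∀ η : ℝ, 0 < η → η ≤ η₀ → ϑ ≤ 1 / 2 * η →
            ∀ P : Set Plane, IsPolygon P → IsSPSemiconvex η ϑ P → IsSemiconvex ϑ' P := by
  refine ⟨1 / 100, by norm_num, by norm_num, fun ϑ hϑ0 hϑ1 => ⟨ϑ / 100, by positivity, by linarith,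
    fun η hη0 hη _ P hP hSP v₀ hv₀ w₀ _ Q₁ Q₂ hpart => ?_⟩⟩
  by_contra hlt
  rw [not_le] at hlt
  have hchord := hpart.isChord hP
  set l := dist v₀ w₀ with hl
  have hl0 : 0 < l := dist_pos.2 hchord.2.2.1
  have hlarge : ∀ d : ℝ≥0∞, min (intrinsicDiam Q₁) (intrinsicDiam Q₂) ≤ d →
      ENNReal.ofReal (100 * (l / ϑ)) < d := by
    intro d hd
    by_contra hle
    rw [not_lt] at hle
    refine absurd (hlt.trans_le (mul_le_mul_right (hd.trans hle) _)) (not_lt.2 ?_)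
    rw [← ENNReal.ofReal_mul (by positivity)]
    apply ENNReal.ofReal_le_ofReal
    field_simp
    rfl
  obtain ⟨x, hx, hfx⟩ := hpart.exists_far (hlarge _ (min_le_left _ _))
  obtain ⟨y, hy, hfy⟩ := hpart.symm.exists_far (hlarge _ (min_le_right _ _))
  have hlϑ : l ≤ l / ϑ := by rw [le_div_iff₀ hϑ0]; nlinarith
  have hlen₀ := wlen_le P v₀ w₀
  -- `(100 l / ϑ - l) / 2` is `50 l / ϑ - 13 l` plus ten times the largest possible weighted length
  have hadm : Admissible P x y (50 * (l / ϑ) - 13 * l) v₀ w₀ :=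
    ⟨hchord, hpart.separates hx hy, hfx.mono (by linarith), hfy.mono (by linarith)⟩
  obtain ⟨v, w, E, hlen⟩ := hP.exists_extremal (hpart.left_subset hx) (hpart.symm.left_subset hy)
    (by linarith) hv₀ hadm
  obtain ⟨A, B, hAB⟩ := E.chord.exists_partition hP
  have h1 := hSP v E.concave w E.chord.2.1 A B hAB (E.segmentationProperty hη0 hη hAB)
  have h2 := (mul_le_mul_right (E.le_min_intrinsicDiam hAB) (ENNReal.ofReal ϑ)).trans h1
  rw [← ENNReal.ofReal_mul hϑ0.le, ENNReal.ofReal_le_ofReal_iff dist_nonneg] at h2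
  have h3 : ϑ * (50 * (l / ϑ) - 13 * l) = 50 * l - 13 * (ϑ * l) := by field_simp
  have h4 := dist_le_wlen P v w
  nlinarith
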